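/- Let $\mathbb F$ be a field and $d>0$. For $N\ge 1$ let $\mathrm{Sym}_N$ be the set of symmetric $N\times N$ matrices all of whose entries are non-zero elements of $\mathbb F$. **Model.** Let $1\le n\le N$, $P\ge 1$, $J_N\in\mathrm{Sym}_N$ and $p\ge 0$. Let $(q(a,b))_{a,b\in[N]}$ be i.i.d. uniform on $[0,1]$ and $\tau$ a uniform permutation of $[N]$. The random matrix $T_{n,p}=T^{(N)}_{n,p}\in\mathbb F^{n\times n}$ is the symmetric matrix with zero diagonal and $$T_{n,p}(i,j)=T_{n,p}(j,i)=\mathbf 1\{q(\tau(i),\tau(j))<p\}\,J_N(\tau(i),\tau(j))\qquad(i<j).$$ Let $\theta=(\theta_r,\theta_c)$ be uniform on $\{1,\dots,P\}^2$, and let $$T_{n,p}[\theta]=\begin{pmatrix}T_{n,p}&\Theta_c\\ \Theta_r&0\end{pmatrix},$$ where $\Theta_r\in\{0,1\}^{\theta_r\times n}$ has exactly one entry $1$ in each row, $\Theta_c\in\{0,1\}^{n\times\theta_c}$ has exactly one entry $1$ in each column, and the positions of these entries are i.i.d. uniform on $[n]$. All of $q$, $\tau$, $\theta$ and these positions are independent.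 **Types.** For a matrix $A$ over $\mathbb F$, a column index $i$ is *frozen* in $A$, written $i\in\mathcal F(A)$, if there is a row vector $y$ such that $i$ is the only non-zero coordinate of $yA$. Write $A\langle i;\rangle$ for $A$ with row $i$ removed (the other rows and all columns keep their labels). For an index $i$ of both a row and a column, $i$ is *frailly frozen* in $A$ if $i\in\mathcal F(A)\setminus\mathcal F(A\langle i;\rangle)$, *firmly frozen* in $A$ if $i\in\mathcal F(A\langle i;\rangle)$, and *completely frozen* in $A$ if it is firmly frozen in both $A$ and $A^T$. Let $x_{n,t/n},y_{n,t/n},z_{n,t/n},u_{n,t/n},v_{n,t/n}$ be the proportions, among $i\in[n]$, of those $i$ that in $A=T_{n,t/n}[\theta]$ are, respectively: frailly frozen in $A$; completely frozen in $A$; frozen neither in $A$ nor in $A^T$; not frozen in $A$ and firmly frozen in $A^T$; firmly frozen in $A$ and not frozen in $A^T$. **Error terms.** For uniformly bounded random variables $b=b_{n,P,N,J_N,t}$ write $b=\bar o_{\mathbb P}(1)$ if $$\limsup_{P\to\infty}\ \limsup_{n\to\infty}\ \sup_{N\ge n,\ J_N\in\mathrm{Sym}_N}\ \sup_{t\in[0,d]}\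 \mathbb E|b_{n,P,N,J_N,t}|=0,$$ and $b\ge\bar o_{\mathbb P}(1)$ if the negative part $\max(0,-b)$ is $\bar o_{\mathbb P}(1)$. Let $\phi_t(\alpha)=\exp(t(\alpha-1))$. **Proposition.** With $x=x_{n,t/n}$, $y=y_{n,t/n}$, $z=z_{n,t/n}$, $u=u_{n,t/n}$, $v=v_{n,t/n}$, $$y-\bigl(1-\phi_t(x+y+u)-\phi_t(x+y+v)+\phi_t(x+y)\bigr)=\bar o_{\mathbb P}(1),$$ $$u-\bigl(\phi_t(x+y+u)-\phi_t(x+y)\bigr)=\bar o_{\mathbb P}(1),\qquad v-\bigl(\phi_t(x+y+v)-\phi_t(x+y)\bigr)=\bar o_{\mathbb P}(1),$$ $$z-\phi_t(y)\ge\bar o_{\mathbb P}(1).$$ -/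

import Mathlib

open MeasureTheory

namespace SymRank

section Types

variable {F : Type*} [Field F] {m n : Type*} [Fintype m] [Fintype n] [DecidableEq m]
  [DecidableEq n]

/-- A set `I` of columns is a relation of `A` if some row vector `y` satisfies
`∅ ≠ supp (y A) ⊆ I`. -/
def IsRelation {F : Type*} [Field F] {m n : Type*} [Fintype m]
    (A : Matrix m n F) (I : Set n) : Prop :=
  ∃ y : m → F, (Function.support (Matrix.vecMul y A)).Nonempty ∧
    Function.support (Matrix.vecMul y A) ⊆ I

/-- The set of frozen variables of `A`: the columns `j` such that `{j}` is a relation of `A`. -/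
def frozen {F : Type*} [Field F] {m n : Type*} [Fintype m] (A : Matrix m n F) : Set n :=
  {j | IsRelation A {j}}

/-- The matrix obtained from `A` by removing row `r`; the other rows keep their names. -/
def removeRow {F : Type*} {m n : Type*} (A : Matrix m n F) (r : m) :
    Matrix {k : m // k ≠ r} n F :=
  A.submatrix Subtype.val id

/- In the definitions below, `r` and `c` are the row and the column of `A` that carry the same
label `i`, so that "`i` is frozen in `A`" reads `c ∈ frozen A`, "`i` is frozen in the transpose"
reads `r ∈ frozen Aᵀ`, and removing row `i` from `A` (from `Aᵀ`) is removing `r` (`c`). -/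

/-- The label is frozen in `A`, but no longer after removal of the row with this label. -/
def FraillyFrozen (A : Matrix m n F) (r : m) (c : n) : Prop :=
  c ∈ frozen A ∧ c ∉ frozen (removeRow A r)

/-- The label is frozen in `A` with the row with this label removed. -/
def FirmlyFrozen (A : Matrix m n F) (r : m) (c : n) : Prop :=
  c ∈ frozen (removeRow A r)

/-- The label is firmly frozen both in `A` and in its transpose. -/
def CompletelyFrozen (A : Matrix m n F) (r : m) (c : n) : Prop :=
  FirmlyFrozen A r c ∧ FirmlyFrozen A.transpose c r

/-- The five types of variables: frailly frozen (`X`), completely frozen (`Y`), frozen neither in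
`A` nor in its transpose (`Z`), not frozen in `A` and firmly frozen in the transpose (`U`), firmly
frozen in `A` and not frozen in the transpose (`V`). -/
inductive VarType where
  | X | Y | Z | U | V

/-- The label with row `r` and column `c` has the given type in `A`. -/
def HasType (A : Matrix m n F) (r : m) (c : n) : VarType → Prop
  | .X => FraillyFrozen A r c
  | .Y => CompletelyFrozen A r c
  | .Z => c ∉ frozen A ∧ r ∉ frozen A.transpose
  | .U => c ∉ frozen A ∧ FirmlyFrozen A.transpose c r
  | .V => FirmlyFrozen A r c ∧ r ∉ frozen A.transpose

end Types

section Model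

/-- Symmetric `N × N` matrices all of whose entries are nonzero. -/
def Template (F : Type*) [Field F] (N : ℕ) : Type _ :=
  {J : Matrix (Fin N) (Fin N) F // J.IsSymm ∧ ∀ i j, J i j ≠ 0}

/-- The symmetrised matrix `T_{n,p}^{(N)}`, given the outcomes `q` of the uniform variables and
the permutation `τ`. -/
noncomputable def matT {F : Type*} [Field F] {n N : ℕ} (h : n ≤ N) (J : Template F N) (p : ℝ)
    (q : Fin N × Fin N → unitInterval) (τ : Equiv.Perm (Fin N)) : Matrix (Fin n) (Fin n) F :=
  Matrix.of fun i j =>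
    let a := τ (Fin.castLE h i)
    let b := τ (Fin.castLE h j)
    if i < j then (if (q (a, b) : ℝ) < p then J.1 a b else 0)
    else if j < i then (if (q (b, a) : ℝ) < p then J.1 b a else 0)
    else 0

/-- The row-perturbation matrix with its unique entry `1` of row `k` in column `pos k`. -/
def rowPert (F : Type*) [Field F] {θ n : ℕ} (pos : Fin θ → Fin n) : Matrix (Fin θ) (Fin n) F :=
  Matrix.of fun k j => if j = pos k then 1 else 0

/-- The column-perturbation matrix with its unique entry `1` of column `k` in row `pos k`. -/
def colPert (F : Type*) [Field F] {θ n : ℕ} (pos : Fin θ → Fin n) : Matrix (Fin n) (Fin θ) F :=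
  Matrix.of fun i k => if i = pos k then 1 else 0

/-- The perturbed matrix `A[θ]`: unit columns attached to the right of `A`, unit rows attached
below `A`, and a zero block in the corner. -/
def perturb {F : Type*} [Field F] {n θr θc : ℕ} (A : Matrix (Fin n) (Fin n) F)
    (rowPos : Fin θr → Fin n) (colPos : Fin θc → Fin n) :
    Matrix (Fin n ⊕ Fin θr) (Fin n ⊕ Fin θc) F :=
  Matrix.fromBlocks A (colPert F colPos) (rowPert F rowPos) 0

instance permMeasurableSpace (N : ℕ) : MeasurableSpace (Equiv.Perm (Fin N)) := ⊤

/-- Outcomes of all the randomness: the array `q`, the permutation `τ`, the pair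
`(θ_r - 1, θ_c - 1)`, and the positions of the unit entries of the first `P` rows (columns) of the
row (column) perturbation, of which the first `θ_r` (`θ_c`) are used. -/
abbrev Sample (n P N : ℕ) : Type :=
  (Fin N × Fin N → unitInterval) × Equiv.Perm (Fin N) × (Fin P × Fin P) ×
    (Fin P → Fin n) × (Fin P → Fin n)

/-- The joint law: the entries of `q` are i.i.d. uniform on `[0,1]`, `τ` is a uniform permutation,
`θ` is uniform on `{1,…,P}²`, the positions are i.i.d. uniform, and all of these are
independent. -/
noncomputable def law (n P N : ℕ) : Measure (Sample n P N) :=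
  (Measure.pi fun _ => (volume : Measure unitInterval)).prod
    ((ProbabilityTheory.uniformOn Set.univ).prod
      ((ProbabilityTheory.uniformOn Set.univ).prod
        ((ProbabilityTheory.uniformOn Set.univ).prod (ProbabilityTheory.uniformOn Set.univ))))

/-- The random matrix `T_{n,p}^{(N)}[θ]` at an outcome. -/
noncomputable def pertT {F : Type*} [Field F] {n P N : ℕ} (h : n ≤ N) (J : Template F N) (p : ℝ) :
    (ω : Sample n P N) →
      Matrix (Fin n ⊕ Fin (ω.2.2.1.1 + 1)) (Fin n ⊕ Fin (ω.2.2.1.2 + 1)) F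
  | (q, τ, (a, b), rowPos, colPos) =>
    perturb (matT h J p q τ)
      (fun k : Fin (a + 1) => rowPos (Fin.castLE a.isLt k))
      (fun k : Fin (b + 1) => colPos (Fin.castLE b.isLt k))

/-- The proportion of the labels `i ∈ [n]` that have type `W` in `T_{n,t/n}^{(N)}[θ]`. -/
noncomputable def proportion {F : Type*} [Field F] {n P N : ℕ} (W : VarType) (h : n ≤ N)
    (J : Template F N) (t : ℝ) (ω : Sample n P N) : ℝ :=
  (Set.ncard {i : Fin n | HasType (pertT h J (t / n) ω) (Sum.inl i) (Sum.inl i) W} : ℝ) / n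

/-- The probability generating function of the Poisson distribution with parameter `t`. -/
noncomputable def phi (t α : ℝ) : ℝ := Real.exp (t * (α - 1))

end Model

section Convergence

/-- Families of random variables indexed by `n, P, N` with `n ≤ N`, a template, and `t`. -/
abbrev Family (F : Type*) [Field F] : Type _ :=
  ∀ {n P N : ℕ}, n ≤ N → Template F N → ℝ → Sample n P N → ℝ

/-- `b = ō_ℙ(1)`: the iterated upper limit, first `n → ∞` and then `P → ∞`, of the supremum of
`𝔼|b|` over `N ≥ n`, over the templates and over `t ∈ [0,d]` is zero. -/
def IsLittleOneP {F : Type*} [Field F] (d : ℝ) (b : Family F) : Prop :=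
  Filter.limsup (fun P : ℕ => Filter.limsup (fun n : ℕ =>
    ⨆ (N : ℕ) (h : n ≤ N) (J : Template F N) (t : Set.Icc (0 : ℝ) d),
      ∫⁻ ω, ENNReal.ofReal |b h J (t : ℝ) ω| ∂(law n P N)) Filter.atTop) Filter.atTop = 0

/-- `b ≥ ō_ℙ(1)`: the negative part of `b` is `ō_ℙ(1)`. -/
def GeLittleOneP {F : Type*} [Field F] (d : ℝ) (b : Family F) : Prop :=
  IsLittleOneP d (F := F) fun h J t ω => max 0 (-(b h J t ω))

end Convergence

end SymRank

/-! Fix the permutation. The matrix is then a weighted adjacency matrix of a random graph with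
independent edges of probability p = t/n. Compare the perturbed matrix A with the matrix B in which
vertex i has lost its edges; the edges at i are independent of B. If no unit entry sits at i, then A
is B bordered by a row b and a column b'. Linear algebra shows that i is firmly frozen in A iff b'
lies outside the column space of B, and firmly frozen in the transpose iff b lies outside the row
space (`Border.firmlyFrozen_iff`). A vector supported exactly on the neighbourhood lies in such a
space iff all neighbours are frozen there, unless some neighbour depends on the others modulo the
space (`elim_mem_iff`). Outside exceptional events, whether i has type Y, U or V is therefore
decided by whether its neighbours all lie in `rowSet` and whether they all lie in `colSet`
(`mem_iff_nbrs`).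

Neighbourhoods are nearly Poisson, so "all neighbours lie in S" has probability about `phi t
(|S|/n)`. Since x+y+u, x+y+v and x+y are the densities of `rowSet`, `colSet` and `bothSet`,
inclusion-exclusion yields the three equations. For z only one implication is available: if all
neighbours are completely frozen and do not interact, i is frozen on neither side (`nbrInd_le`).
Hence the inequality.

The perturbation controls the exceptional events and the fluctuations. Averaged over a uniform
number of unit rows up to P, m further uniform unit rows raise a set function with values in [0,n]
by at most mn/P, by telescoping (`wE_increment_le`). A neighbourhood is dominated by a Poisson-like
mixture of uniform tuples (`wE_star_le`), so dependent neighbours are rare; the same increment bound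
shows that deleting one row unfreezes at most n/√P labels on average (`wE_card_affected_le`).
Consequently the frozen sets hardly change when a vertex is isolated (`Stable`), and a second moment
computation gives concentration (`Stable.wE_abs_sub_phi_le`). All errors are bounded by `totalRate d
n P`, uniformly in N, J and t, and vanish as first n and then P tends to infinity. -/

namespace SymRank

/-! ### Linear algebra of frozen labels and bordered matrices. -/

section LinearAlgebra

variable {F : Type*} [Field F] {m n : Type*} [Fintype m] [Fintype n] [DecidableEq m]
  [DecidableEq n]

/-- The row space of a matrix. -/
def rowSpace (M : Matrix m n F) : Submodule F (n → F) :=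
  LinearMap.range M.vecMulLinear

/-- The span of the rows of `M` other than row `r`. -/
def rowSpaceOff (M : Matrix m n F) (r : m) : Submodule F (n → F) :=
  (LinearMap.ker (LinearMap.proj (R := F) (φ := fun _ : m => F) r)).map M.vecMulLinear

omit [Fintype n] [DecidableEq m] [DecidableEq n] in
theorem mem_rowSpace {M : Matrix m n F} {v : n → F} :
    v ∈ rowSpace M ↔ ∃ y, Matrix.vecMul y M = v := Iff.rfl

omit [Fintype n] [DecidableEq m] [DecidableEq n] in
theorem mem_rowSpaceOff {M : Matrix m n F} {r : m} {v : n → F} :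
    v ∈ rowSpaceOff M r ↔ ∃ y : m → F, y r = 0 ∧ Matrix.vecMul y M = v := Iff.rfl

omit [Fintype n] [DecidableEq m] [DecidableEq n] in
theorem rowSpaceOff_le (M : Matrix m n F) (r : m) : rowSpaceOff M r ≤ rowSpace M := by
  rintro v ⟨y, -, rfl⟩
  exact ⟨y, rfl⟩

omit [Fintype n] [DecidableEq m] in
theorem mem_frozen_iff {M : Matrix m n F} {c : n} :
    c ∈ frozen M ↔ Pi.single c 1 ∈ rowSpace M := by
  constructor
  · rintro ⟨y, ⟨j, hj⟩, hy⟩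
    obtain rfl : j = c := hy hj
    refine ⟨(Matrix.vecMul y M j)⁻¹ • y, ?_⟩
    rw [Matrix.vecMulLinear_apply, Matrix.smul_vecMul]
    ext k
    by_cases hk : k = j
    · subst hk
      simpa using inv_mul_cancel₀ hj
    · have : Matrix.vecMul y M k = 0 := by
        by_contra h
        exact hk (hy h)
      simp [this, hk]
  · rintro ⟨y, hy⟩
    rw [Matrix.vecMulLinear_apply] at hy
    refine ⟨y, ⟨c, by simp [hy]⟩, fun k hk => ?_⟩
    by_contra h
    rw [Function.mem_support, hy] at hk
    exact hk (Pi.single_eq_of_ne h _)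

omit [Fintype n] [DecidableEq n] in
theorem vecMul_removeRow (M : Matrix m n F) {r : m} {y : m → F} (hy : y r = 0) :
    Matrix.vecMul (fun i : {k // k ≠ r} => y i.1) (removeRow M r) = Matrix.vecMul y M := by
  ext j
  simp only [Matrix.vecMul, dotProduct, removeRow, Matrix.submatrix_apply, id]
  rw [Fintype.sum_eq_add_sum_subtype_ne _ r, hy]
  simp

omit [Fintype n] [DecidableEq n] in
theorem rowSpace_removeRow (M : Matrix m n F) (r : m) :
    rowSpace (removeRow M r) = rowSpaceOff M r := by
  ext v
  constructor
  · rintro ⟨y, rfl⟩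
    refine ⟨fun i => if h : i ≠ r then y ⟨i, h⟩ else 0, by simp, ?_⟩
    rw [Matrix.vecMulLinear_apply, Matrix.vecMulLinear_apply, ← vecMul_removeRow _ (r := r) (by simp)]
    congr 1
    ext i
    simp [i.2]
  · rintro ⟨y, hy, rfl⟩
    exact ⟨fun i => y i.1, vecMul_removeRow M hy⟩

omit [Fintype n] in
theorem firmlyFrozen_iff {M : Matrix m n F} {r : m} {c : n} :
    FirmlyFrozen M r c ↔ Pi.single c 1 ∈ rowSpaceOff M r := by
  rw [FirmlyFrozen, mem_frozen_iff, rowSpace_removeRow]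

/-- A vector outside of the row space is detected by a vector in the kernel. -/
theorem exists_mulVec_eq_zero {M : Matrix m n F} {b : n → F} (hb : b ∉ rowSpace M) :
    ∃ z, M.mulVec z = 0 ∧ b ⬝ᵥ z ≠ 0 := by
  obtain ⟨f, hf, hle⟩ := Submodule.exists_le_ker_of_notMem hb
  have key : ∀ v : n → F, f v = v ⬝ᵥ fun j => f (Pi.single j 1) := by
    intro v
    conv_lhs => rw [pi_eq_sum_univ' v]
    simp [dotProduct]
  refine ⟨fun j => f (Pi.single j 1), ?_, by rwa [← key]⟩
  ext i
  have h : f (Matrix.vecMul (Pi.single i 1) M) = 0 := hle ⟨Pi.single i 1, rfl⟩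
  rw [key, ← Matrix.dotProduct_mulVec] at h
  simpa using h

omit [DecidableEq n] [DecidableEq m] in
theorem dotProduct_eq_of_vecMul_of_mulVec {M : Matrix m n F} {y p : m → F} {z v : n → F}
    (hy : Matrix.vecMul y M = v) (hz : M.mulVec z = p) : y ⬝ᵥ p = v ⬝ᵥ z := by
  rw [← hz, ← hy, Matrix.dotProduct_mulVec]

omit [DecidableEq m] [DecidableEq n] [Fintype m] in
theorem mem_rowSpace_transpose {M : Matrix m n F} {v : m → F} :
    v ∈ rowSpace M.transpose ↔ ∃ z, M.mulVec z = v := by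
  simp [mem_rowSpace, Matrix.vecMul_transpose]

omit [DecidableEq m] [DecidableEq n] [Fintype m] in
theorem mem_rowSpaceOff_transpose {M : Matrix m n F} {c : n} {v : m → F} :
    v ∈ rowSpaceOff M.transpose c ↔ ∃ z, z c = 0 ∧ M.mulVec z = v := by
  simp [mem_rowSpaceOff, Matrix.vecMul_transpose]

/-- If a label is frozen on both sides, the coefficients of its row and of its column in the two
representations agree. -/
theorem coeff_eq_coeff {M : Matrix m n F} {r : m} {c : n} {y : m → F} {z : n → F}
    (hy : Matrix.vecMul y M = Pi.single c 1) (hz : M.mulVec z = Pi.single r 1) : y r = z c := by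
  have := dotProduct_eq_of_vecMul_of_mulVec hy hz
  simpa using this

/-- A firmly frozen column label whose row is frozen is completely frozen. -/
theorem firmlyFrozen_transpose {M : Matrix m n F} {r : m} {c : n} (h : FirmlyFrozen M r c)
    (hr : r ∈ frozen M.transpose) : FirmlyFrozen M.transpose c r := by
  rw [firmlyFrozen_iff, mem_rowSpaceOff] at h
  obtain ⟨y, hy0, hy⟩ := h
  rw [mem_frozen_iff, mem_rowSpace_transpose] at hr
  obtain ⟨z, hz⟩ := hr
  rw [firmlyFrozen_iff, mem_rowSpaceOff_transpose]
  exact ⟨z, by rw [← coeff_eq_coeff hy hz, hy0], hz⟩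

/-- If the row label were not frozen in the transpose, some left kernel vector `w` would have `w r ≠
0`. Subtracting a multiple of it removes row `r` from the representation of the unit vector, so the
label would be firmly frozen. -/
theorem FraillyFrozen.frozen_transpose {M : Matrix m n F} {r : m} {c : n}
    (h : FraillyFrozen M r c) : r ∈ frozen M.transpose := by
  obtain ⟨h1, h2⟩ := h
  by_contra hr
  rw [mem_frozen_iff] at hr h1
  obtain ⟨w, hw, hw0⟩ := exists_mulVec_eq_zero hr
  obtain ⟨y, hy⟩ := h1
  rw [Matrix.vecMulLinear_apply] at hy
  have hwr : w r ≠ 0 := by simpa using hw0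
  rw [Matrix.mulVec_transpose] at hw
  refine h2 (firmlyFrozen_iff.2 (mem_rowSpaceOff.2 ⟨y - (y r / w r) • w, ?_, ?_⟩))
  · simp [hwr]
  · rw [Matrix.sub_vecMul, Matrix.smul_vecMul, hw, hy]; simp

omit [Fintype n] in
theorem FirmlyFrozen.frozen {M : Matrix m n F} {r : m} {c : n} (h : FirmlyFrozen M r c) :
    c ∈ frozen M :=
  mem_frozen_iff.2 (rowSpaceOff_le _ _ (firmlyFrozen_iff.1 h))

/-- A label that is firmly frozen in the transpose but not firmly frozen is not frozen. -/
theorem not_frozen_of_not_firmlyFrozen {A : Matrix m n F} {r : m} {c : n}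
    (h1 : ¬ FirmlyFrozen A r c)
    (h2 : FirmlyFrozen A.transpose c r) : c ∉ frozen A := by
  intro hc
  apply h1
  have := firmlyFrozen_transpose (M := A.transpose) h2 (by simpa using hc)
  simpa using this

/-- `A` arises from `B`, whose row `r` and column `c` vanish, by inserting `b` as row `r` and `b'`
as column `c`. -/
structure Border (A B : Matrix m n F) (r : m) (c : n) (b : n → F) (b' : m → F) : Prop where
  vecMul_eq : ∀ y, Matrix.vecMul y A = Matrix.vecMul y B + y r • b + (y ⬝ᵥ b') • Pi.single c 1
  mulVec_eq : ∀ z, A.mulVec z = B.mulVec z + z c • b' + (z ⬝ᵥ b) • Pi.single r 1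
  row_eq : ∀ j, B r j = 0
  col_eq : ∀ i, B i c = 0
  row_apply : b c = 0
  col_apply : b' r = 0

namespace Border

variable {A B : Matrix m n F} {r : m} {c : n} {b : n → F} {b' : m → F}

theorem transpose (h : Border A B r c b b') : Border A.transpose B.transpose c r b' b where
  vecMul_eq z := by simpa [Matrix.vecMul_transpose] using h.mulVec_eq z
  mulVec_eq y := by simpa [Matrix.mulVec_transpose] using h.vecMul_eq y
  row_eq := h.col_eq
  col_eq := h.row_eq
  row_apply := h.col_apply
  col_apply := h.row_apply

omit [Fintype n] in
theorem of_eq (h : A = B + Matrix.vecMulVec (Pi.single r 1) b + Matrix.vecMulVec b' (Pi.single c 1))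
    (hr : ∀ j, B r j = 0) (hc : ∀ i, B i c = 0) (hb : b c = 0) (hb' : b' r = 0) [Fintype n] :
    Border A B r c b b' where
  vecMul_eq y := by
    rw [h, Matrix.vecMul_add, Matrix.vecMul_add, Matrix.vecMul_vecMulVec, Matrix.vecMul_vecMulVec]
    simp
  mulVec_eq z := by
    rw [h, Matrix.add_mulVec, Matrix.add_mulVec, Matrix.vecMulVec_mulVec, Matrix.vecMulVec_mulVec]
    simp [dotProduct_comm b z, add_right_comm]
  row_eq := hr
  col_eq := hc
  row_apply := hb
  col_apply := hb'

/-- Row `r` of `B` and the entry `b' r` vanish, so the coefficient at `r` is free and can be set to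
zero. The inserted row then does not contribute to the product with `A`. -/
theorem exists_row_zero (h : Border A B r c b b') (y : m → F) :
    ∃ y', y' r = 0 ∧ Matrix.vecMul y' B = Matrix.vecMul y B ∧ y' ⬝ᵥ b' = y ⬝ᵥ b' := by
  refine ⟨y - y r • Pi.single r 1, by simp, ?_, ?_⟩
  · rw [Matrix.sub_vecMul, Matrix.smul_vecMul]
    have : Matrix.vecMul (Pi.single r (1 : F)) B = 0 := by
      ext j; simp [h.row_eq]
    simp [this]
  · simp [sub_dotProduct, h.col_apply]

theorem vecMul_col (h : Border A B r c b b') (y : m → F) : Matrix.vecMul y B c = 0 := by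
  simp [Matrix.vecMul, dotProduct, h.col_eq]

/-- Without row `r`, a representation of the unit vector at `c` must be a left kernel vector of `B`
that pairs to 1 with `b'`. By duality one exists iff `b'` is not in the column space of `B`. -/
theorem firmlyFrozen_iff (h : Border A B r c b b') :
    FirmlyFrozen A r c ↔ b' ∉ rowSpace B.transpose := by
  rw [SymRank.firmlyFrozen_iff, mem_rowSpaceOff]
  constructor
  · rintro ⟨y, hyr, hy⟩ hb
    rw [h.vecMul_eq, hyr, zero_smul, add_zero] at hy
    rw [mem_rowSpace_transpose] at hb
    obtain ⟨z, hz⟩ := hb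
    have hc : y ⬝ᵥ b' = 1 := by
      have := congrFun hy c
      simpa [h.vecMul_col] using this
    have hy0 : Matrix.vecMul y B = 0 := by
      rw [hc, one_smul] at hy
      simpa using hy
    have := dotProduct_eq_of_vecMul_of_mulVec hy0 hz
    rw [hc] at this
    simp at this
  · intro hb
    obtain ⟨w, hw, hw0⟩ := exists_mulVec_eq_zero hb
    rw [Matrix.mulVec_transpose] at hw
    obtain ⟨y, hyr, hy, hyb⟩ := h.exists_row_zero w
    rw [dotProduct_comm, ← hyb] at hw0
    refine ⟨(y ⬝ᵥ b')⁻¹ • y, by simp [hyr], ?_⟩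
    rw [h.vecMul_eq, Matrix.smul_vecMul, hy, hw, smul_dotProduct]
    simp [hyr, hw0]

theorem firmlyFrozen_transpose_iff (h : Border A B r c b b') :
    FirmlyFrozen A.transpose c r ↔ b ∉ rowSpace B := h.transpose.firmlyFrozen_iff

/-- If the inserted column is the image of `z` and the inserted row annihilates `z`, the new label
is not frozen. -/
theorem not_frozen_of_dotProduct (h : Border A B r c b b') {z : n → F} (hz : B.mulVec z = b')
    (hbz : b ⬝ᵥ z = 0) : c ∉ frozen A := by
  rw [mem_frozen_iff]
  rintro ⟨y, hy⟩
  rw [Matrix.vecMulLinear_apply, h.vecMul_eq] at hy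
  have hc : y ⬝ᵥ b' = 1 := by
    have := congrFun hy c
    simpa [h.vecMul_col, h.row_apply] using this
  rw [hc, one_smul, add_eq_right] at hy
  -- Pairing with `z` gives a contradiction: the first summand contributes `y ⬝ᵥ b' = 1`, the second
  -- vanishes because `b ⬝ᵥ z = 0`.
  have h0 : (Matrix.vecMul y B + y r • b) ⬝ᵥ z = 0 := by rw [hy]; simp
  rw [add_dotProduct, ← Matrix.dotProduct_mulVec, hz, hc, smul_dotProduct, hbz] at h0
  simp at h0

end Border

end LinearAlgebra

/-! ### How attaching a vertex changes the sets of frozen labels. -/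

section Labels

open scoped Classical in
/-- The labels whose unit vector lies in `R`. -/
noncomputable def unitsIn {F : Type*} [Field F] {ι β : Type*} [Fintype ι]
    [DecidableEq ι] [DecidableEq β] (R : Submodule F (ι ⊕ β → F)) : Finset ι :=
  Finset.univ.filter fun k => (Pi.single (Sum.inl k) 1 : ι ⊕ β → F) ∈ R

/-- The subspace `R` enlarged by the unit vectors with labels in `S`. -/
noncomputable def extend {F : Type*} [Field F] {ι β : Type*}
    [DecidableEq ι] [DecidableEq β] (R : Submodule F (ι ⊕ β → F)) (S : Finset ι) : Submodule F (ι ⊕ β → F) :=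
  R ⊔ Submodule.span F ((fun k => (Pi.single (Sum.inl k) 1 : ι ⊕ β → F)) '' S)

variable {F : Type*} [Field F] {ι α β : Type*} [Fintype ι] [Fintype α] [Fintype β]
  [DecidableEq ι] [DecidableEq α] [DecidableEq β]

omit [Fintype β] in
theorem mem_unitsIn {R : Submodule F (ι ⊕ β → F)} {k : ι} :
    k ∈ unitsIn R ↔ (Pi.single (Sum.inl k) 1 : ι ⊕ β → F) ∈ R := by
  simp [unitsIn]

omit [Fintype β] in
theorem unitsIn_mono {R R' : Submodule F (ι ⊕ β → F)} (h : R ≤ R') : unitsIn R ⊆ unitsIn R' :=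
  fun _ hk => mem_unitsIn.2 (h (mem_unitsIn.1 hk))

omit [Fintype ι] [Fintype β] in
theorem extend_mono (R : Submodule F (ι ⊕ β → F)) {S S' : Finset ι} (h : S ⊆ S') :
    extend R S ≤ extend R S' :=
  sup_le_sup_left (Submodule.span_mono (Set.image_mono h)) _

omit [Fintype ι] [Fintype β] in
theorem le_extend (R : Submodule F (ι ⊕ β → F)) (S : Finset ι) : R ≤ extend R S := le_sup_left

omit [Fintype ι] [Fintype β] in
theorem extend_extend (R : Submodule F (ι ⊕ β → F)) (S S' : Finset ι) :
    extend (extend R S) S' = extend R (S ∪ S') := by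
  rw [extend, extend, extend, sup_assoc, ← Submodule.span_union, ← Set.image_union]
  simp

omit [Fintype ι] [Fintype β] in
theorem single_mem_extend (R : Submodule F (ι ⊕ β → F)) {S : Finset ι} {k : ι} (h : k ∈ S) :
    (Pi.single (Sum.inl k) 1 : ι ⊕ β → F) ∈ extend R S :=
  le_sup_right (a := R) (Submodule.subset_span ⟨k, h, rfl⟩)

/-- The labels of `N` that depend on the other labels of `N` modulo `R`. -/
noncomputable def dependent (R : Submodule F (ι ⊕ β → F)) (N : Finset ι) : Finset ι :=
  N.filter fun k => k ∈ unitsIn (extend R (N.erase k)) \ unitsIn R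

omit [Fintype ι] [Fintype β] in
theorem elim_eq_sum {w : ι → F} {N : Finset ι}
    (hw : ∀ k, w k ≠ 0 ↔ k ∈ N) :
    (Sum.elim w 0 : ι ⊕ β → F) = ∑ k ∈ N, w k • Pi.single (Sum.inl k) 1 := by
  ext j
  rcases j with j | j
  · simp only [Sum.elim_inl, Finset.sum_apply, Pi.smul_apply, Pi.single_apply, smul_eq_mul,
      Sum.inl.injEq]
    by_cases hj : j ∈ N
    · simp [hj]
    · have := not_not.1 (mt (hw j).1 hj)
      simp [hj, this]
  · simp

omit [Fintype β] in
theorem elim_mem_of_subset {R : Submodule F (ι ⊕ β → F)} {N : Finset ι} {w : ι → F}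
    (hw : ∀ k, w k ≠ 0 ↔ k ∈ N) (h : N ⊆ unitsIn R) : (Sum.elim w 0 : ι ⊕ β → F) ∈ R := by
  rw [elim_eq_sum hw]
  exact Submodule.sum_mem _ fun k hk => Submodule.smul_mem _ _ (mem_unitsIn.1 (h hk))

omit [Fintype β] in
theorem elim_mem_extend (R : Submodule F (ι ⊕ β → F)) {N : Finset ι} {w : ι → F}
    (hw : ∀ k, w k ≠ 0 ↔ k ∈ N) : (Sum.elim w 0 : ι ⊕ β → F) ∈ extend R N :=
  elim_mem_of_subset hw fun _ hk => mem_unitsIn.2 (single_mem_extend R hk)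

-- If the vector lies in `R` but the unit vector at some `k ∈ N` does not, solving for that unit
-- vector expresses it through the others modulo `R`, so `k` is dependent. Only the support of `w`
-- matters, not its values.
omit [Fintype β] in
theorem elim_mem_iff {R : Submodule F (ι ⊕ β → F)} {N : Finset ι} {w : ι → F}
    (hw : ∀ k, w k ≠ 0 ↔ k ∈ N) (hN : dependent R N = ∅) :
    (Sum.elim w 0 : ι ⊕ β → F) ∈ R ↔ N ⊆ unitsIn R := by
  refine ⟨fun h k hk => ?_, elim_mem_of_subset hw⟩
  by_contra hkR
  have hmem : k ∈ dependent R N := by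
    rw [dependent, Finset.mem_filter, Finset.mem_sdiff]
    refine ⟨hk, mem_unitsIn.2 ?_, hkR⟩
    rw [elim_eq_sum hw, ← Finset.add_sum_erase N _ hk] at h
    have h1 : ∑ l ∈ N.erase k, w l • (Pi.single (Sum.inl l) 1 : ι ⊕ β → F) ∈
        extend R (N.erase k) :=
      Submodule.sum_mem _ fun l hl => Submodule.smul_mem _ _ (single_mem_extend R hl)
    have h2 := Submodule.sub_mem _ (le_extend R (N.erase k) h) h1
    rw [add_sub_cancel_right] at h2
    exact (Submodule.smul_mem_iff _ ((hw k).2 hk)).1 h2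
  simp [hN] at hmem

omit [Fintype β] in
theorem dependent_subset (R : Submodule F (ι ⊕ β → F)) {N N' : Finset ι} (h : N ⊆ N') :
    dependent R N ⊆ dependent R N' := by
  intro k hk
  rw [dependent, Finset.mem_filter, Finset.mem_sdiff] at hk ⊢
  exact ⟨h hk.1, unitsIn_mono (extend_mono R (Finset.erase_subset_erase k h)) hk.2.1, hk.2.2⟩

/-- The labels that are frozen, but no longer after removal of row `k`. -/
noncomputable def affected (M : Matrix (ι ⊕ α) (ι ⊕ β) F) (k : ι) : Finset ι :=
  unitsIn (rowSpace M) \ unitsIn (rowSpaceOff M (Sum.inl k))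

/-- The frozen labels. -/
noncomputable def frozenSet (M : Matrix (ι ⊕ α) (ι ⊕ β) F) : Finset ι := unitsIn (rowSpace M)

open scoped Classical in
/-- The completely frozen labels. -/
noncomputable def completeSet (M : Matrix (ι ⊕ α) (ι ⊕ β) F) : Finset ι :=
  Finset.univ.filter fun k => CompletelyFrozen M (Sum.inl k) (Sum.inl k)

omit [Fintype β] [DecidableEq α] in
theorem mem_frozenSet {M : Matrix (ι ⊕ α) (ι ⊕ β) F} {k : ι} :
    k ∈ frozenSet M ↔ Sum.inl k ∈ frozen M := by
  rw [frozenSet, mem_unitsIn, mem_frozen_iff]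

theorem mem_completeSet {M : Matrix (ι ⊕ α) (ι ⊕ β) F} {k : ι} :
    k ∈ completeSet M ↔ CompletelyFrozen M (Sum.inl k) (Sum.inl k) := by
  simp [completeSet]

/-- By `coeff_eq_coeff` the coefficient at `k` is the same for every solution `z` once `k` is frozen
on both sides. Complete freezing thus becomes the vanishing of a single number. -/
theorem mem_completeSet_iff {M : Matrix (ι ⊕ α) (ι ⊕ β) F} {k : ι} {z : ι ⊕ β → F}
    (hz : M.mulVec z = Pi.single (Sum.inl k) 1) (hk : k ∈ frozenSet M) :
    k ∈ completeSet M ↔ z (Sum.inl k) = 0 := by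
  rw [mem_completeSet]
  constructor
  · rintro ⟨h, -⟩
    obtain ⟨y, hy0, hy⟩ := mem_rowSpaceOff.1 (firmlyFrozen_iff.1 h)
    rw [← coeff_eq_coeff hy hz, hy0]
  · intro h
    have h1 : FirmlyFrozen M.transpose (Sum.inl k) (Sum.inl k) :=
      firmlyFrozen_iff.2 (mem_rowSpaceOff_transpose.2 ⟨z, h, hz⟩)
    exact ⟨firmlyFrozen_transpose (M := M.transpose) h1 (mem_frozenSet.1 hk), h1⟩

/-- Every representation of the unit vector at `l` uses row `k` with coefficient `z (Sum.inl l)`, as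
the bilinear form evaluated in two ways shows. -/
theorem mem_affected {M : Matrix (ι ⊕ α) (ι ⊕ β) F} {k l : ι} {y : ι ⊕ α → F} {z : ι ⊕ β → F}
    (hy : Matrix.vecMul y M = Pi.single (Sum.inl l) 1) (hz : M.mulVec z = Pi.single (Sum.inl k) 1)
    (h : z (Sum.inl l) ≠ 0) : l ∈ affected M k := by
  rw [affected, Finset.mem_sdiff, mem_unitsIn, mem_unitsIn]
  refine ⟨⟨y, hy⟩, ?_⟩
  rw [mem_rowSpaceOff]
  rintro ⟨y', h0, hy'⟩
  have := dotProduct_eq_of_vecMul_of_mulVec hy' hz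
  simp only [dotProduct_single, mul_one, h0, single_dotProduct, one_mul] at this
  exact h this.symm

/-- A label `j ≠ i` frozen in `A` has a representation with `y ⬝ᵥ b' = 0` (coordinate `i`), so `j`
is frozen in `B` once the unit vectors of `N` are added. Conversely let `y` represent `j` in `B`. If
`b'` is outside the column space, a left kernel vector corrects `y` so that it works for `A`. If
`b'` is inside, all of `N` is frozen in the transpose, and a loss of `j` forces `y` to use the row
of some `k ∈ N`, so that `j` is affected by `k`. -/
theorem symmDiff_frozenSet_subset {A B : Matrix (ι ⊕ α) (ι ⊕ β) F} {i : ι} {w w' : ι → F}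
    {N : Finset ι} (h : Border A B (Sum.inl i) (Sum.inl i) (Sum.elim w 0) (Sum.elim w' 0))
    (hw : ∀ k, w k ≠ 0 ↔ k ∈ N) (hw' : ∀ k, w' k ≠ 0 ↔ k ∈ N)
    (hN : dependent (rowSpace B.transpose) N = ∅) :
    symmDiff (frozenSet A) (frozenSet B) ⊆
      insert i ((unitsIn (extend (rowSpace B) N) \ unitsIn (rowSpace B)) ∪
        N.biUnion (affected B)) := by
  intro j hj
  rw [Finset.mem_insert, Finset.mem_union, or_iff_not_imp_left]
  intro hji
  rw [Finset.mem_symmDiff] at hj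
  rcases hj with ⟨hA, hB⟩ | ⟨hB, hA⟩
  · left
    rw [Finset.mem_sdiff]
    refine ⟨?_, hB⟩
    rw [frozenSet, mem_unitsIn] at hA
    obtain ⟨y, hy⟩ := hA
    rw [Matrix.vecMulLinear_apply, h.vecMul_eq] at hy
    have h0 := congrFun hy (Sum.inl i)
    have hwi := h.row_apply
    simp only [Pi.add_apply, h.vecMul_col, Pi.smul_apply, hwi, Pi.single_eq_same, smul_eq_mul,
      mul_zero, zero_add, mul_one] at h0
    rw [Pi.single_eq_of_ne (fun h => hji (Sum.inl_injective h).symm)] at h0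
    rw [h0, zero_smul, add_zero] at hy
    rw [mem_unitsIn, ← hy]
    exact Submodule.add_mem _ (le_extend _ _ ⟨y, rfl⟩)
      (Submodule.smul_mem _ _ (elim_mem_extend _ hw))
  · right
    rw [frozenSet, mem_unitsIn] at hA hB
    obtain ⟨y₀, hy₀⟩ := hB
    obtain ⟨y, hyi, hy, -⟩ := h.exists_row_zero y₀
    rw [Matrix.vecMulLinear_apply] at hy₀
    rw [hy₀] at hy
    by_cases hb : (Sum.elim w' 0 : ι ⊕ α → F) ∈ rowSpace B.transpose
    · have hsub := (elim_mem_iff hw' hN).1 hb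
      have hne : y ⬝ᵥ Sum.elim w' 0 ≠ 0 := by
        intro h0
        exact hA ⟨y, by rw [Matrix.vecMulLinear_apply, h.vecMul_eq, hyi, h0, hy]; simp⟩
      rw [elim_eq_sum hw', dotProduct_sum] at hne
      obtain ⟨k, hk, hne⟩ := Finset.exists_ne_zero_of_sum_ne_zero hne
      have hyk : y (Sum.inl k) ≠ 0 := by
        intro h0
        simp [h0] at hne
      obtain ⟨z, hz⟩ := mem_rowSpace_transpose.1 (mem_unitsIn.1 (hsub hk))
      rw [Finset.mem_biUnion]
      refine ⟨k, hk, mem_affected hy hz ?_⟩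
      have := dotProduct_eq_of_vecMul_of_mulVec hy hz
      simp only [dotProduct_single, mul_one, single_dotProduct, one_mul] at this
      rwa [← this]
    · exfalso
      obtain ⟨v₀, hv, hv0⟩ := exists_mulVec_eq_zero hb
      rw [Matrix.mulVec_transpose] at hv
      obtain ⟨v, hvi, hv1, hv2⟩ := h.exists_row_zero v₀
      rw [dotProduct_comm, ← hv2] at hv0
      refine hA ⟨y - ((y ⬝ᵥ Sum.elim w' 0) / (v ⬝ᵥ Sum.elim w' 0)) • v, ?_⟩
      rw [Matrix.vecMulLinear_apply, h.vecMul_eq, Matrix.sub_vecMul, Matrix.smul_vecMul, hv1, hv,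
        hy, sub_dotProduct, smul_dotProduct]
      simp [hyi, hvi, hv0]

/-- For a label frozen on both sides in both matrices, `mem_completeSet_iff` reduces the claim to
finding solutions for `A` and `B` with the same coordinate `k`. If `b` is in the row space, the
solution `z` for `B` vanishes on `N`, because `k` affects no neighbour, and so solves for `A`.
Otherwise `z` is corrected by a kernel vector of `B`, which vanishes at `k` because `k` is frozen in
`B`. -/
theorem symmDiff_completeSet_subset {A B : Matrix (ι ⊕ α) (ι ⊕ β) F} {i : ι} {w w' : ι → F}
    {N : Finset ι} (h : Border A B (Sum.inl i) (Sum.inl i) (Sum.elim w 0) (Sum.elim w' 0))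
    (hw : ∀ k, w k ≠ 0 ↔ k ∈ N)
    (hN : dependent (rowSpace B) N = ∅) :
    symmDiff (completeSet A) (completeSet B) ⊆
      insert i (symmDiff (frozenSet A) (frozenSet B) ∪
        symmDiff (frozenSet A.transpose) (frozenSet B.transpose) ∪
        Finset.univ.filter fun k => ∃ l ∈ N, l ∈ affected B k) := by
  intro k hk
  by_contra hcon
  simp only [Finset.mem_insert, Finset.mem_union, Finset.mem_symmDiff, Finset.mem_filter,
    Finset.mem_univ, true_and, not_or, not_exists, not_and, not_not] at hcon
  obtain ⟨hki, ⟨⟨hAB, hBA⟩, ⟨hAB', hBA'⟩⟩, hΓ⟩ := hcon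
  have hcA : ∀ {M : Matrix (ι ⊕ α) (ι ⊕ β) F}, k ∈ completeSet M →
      k ∈ frozenSet M ∧ k ∈ frozenSet M.transpose := fun hM => by
    rw [mem_completeSet] at hM
    exact ⟨mem_frozenSet.2 hM.1.frozen, mem_frozenSet.2 hM.2.frozen⟩
  have hF : (k ∈ frozenSet A ∧ k ∈ frozenSet A.transpose) ∧
      (k ∈ frozenSet B ∧ k ∈ frozenSet B.transpose) := by
    rw [Finset.mem_symmDiff] at hk
    rcases hk with ⟨hA, -⟩ | ⟨hB, -⟩
    · have := hcA hA
      exact ⟨this, hAB this.1, hAB' this.2⟩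
    · have := hcA hB
      exact ⟨⟨hBA this.1, hBA' this.2⟩, this⟩
  obtain ⟨z₀, hz₀⟩ := mem_rowSpace_transpose.1 (mem_unitsIn.1 hF.2.2)
  obtain ⟨z, hzi, hz, -⟩ := h.transpose.exists_row_zero z₀
  rw [Matrix.vecMul_transpose, Matrix.vecMul_transpose, hz₀] at hz
  have key : ∃ z', A.mulVec z' = Pi.single (Sum.inl k) 1 ∧ z' (Sum.inl k) = z (Sum.inl k) := by
    by_cases hb : (Sum.elim w 0 : ι ⊕ β → F) ∈ rowSpace B
    · have hsub := (elim_mem_iff hw hN).1 hb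
      refine ⟨z, ?_, rfl⟩
      have h0 : z ⬝ᵥ Sum.elim w 0 = 0 := by
        rw [elim_eq_sum hw, dotProduct_sum]
        refine Finset.sum_eq_zero fun l hl => ?_
        have hzl : z (Sum.inl l) = 0 := by
          by_contra hne
          obtain ⟨y, hy⟩ := mem_unitsIn.1 (hsub hl)
          exact hΓ l hl (mem_affected hy hz hne)
        simp [hzl]
      rw [h.mulVec_eq, hzi, h0, hz]
      simp
    · obtain ⟨v₀, hv, hv0⟩ := exists_mulVec_eq_zero hb
      obtain ⟨v, hvi, hv1, hv2⟩ := h.transpose.exists_row_zero v₀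
      rw [Matrix.vecMul_transpose, Matrix.vecMul_transpose, hv] at hv1
      rw [dotProduct_comm, ← hv2] at hv0
      refine ⟨z - ((z ⬝ᵥ Sum.elim w 0) / (v ⬝ᵥ Sum.elim w 0)) • v, ?_, ?_⟩
      · rw [h.mulVec_eq, Matrix.mulVec_sub, Matrix.mulVec_smul, hv1, hz, sub_dotProduct,
          smul_dotProduct]
        simp [hzi, hvi, hv0]
      · obtain ⟨y, hy⟩ := mem_unitsIn.1 hF.2.1
        have := dotProduct_eq_of_vecMul_of_mulVec hy hv1
        simp only [dotProduct_zero, single_dotProduct, one_mul] at this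
        simp [← this]
  obtain ⟨z', hz', hzk⟩ := key
  rw [Finset.mem_symmDiff, mem_completeSet_iff hz' hF.1.1, mem_completeSet_iff hz hF.2.1, hzk] at hk
  tauto

/-- If all neighbours are completely frozen and their rows and columns do not interact, the new
label is not frozen. -/
theorem Border.not_frozen_of_subset_completeSet {A B : Matrix (ι ⊕ α) (ι ⊕ β) F} {i : ι}
    {w w' : ι → F} {N : Finset ι}
    (h : Border A B (Sum.inl i) (Sum.inl i) (Sum.elim w 0) (Sum.elim w' 0))
    (hw : ∀ k, w k ≠ 0 ↔ k ∈ N) (hw' : ∀ k, w' k ≠ 0 ↔ k ∈ N) (hN : N ⊆ completeSet B)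
    (hΓ : ∀ k ∈ N, ∀ l ∈ N, k ≠ l → l ∉ affected B k) : Sum.inl i ∉ frozen A := by
  have hz : ∀ k ∈ N, ∃ z, B.mulVec z = Pi.single (Sum.inl k) 1 ∧ z (Sum.inl k) = 0 := by
    intro k hk
    have := (mem_completeSet.1 (hN hk)).2
    obtain ⟨z, h0, hz⟩ := mem_rowSpaceOff_transpose.1 (SymRank.firmlyFrozen_iff.1 this)
    exact ⟨z, hz, h0⟩
  choose! z hz hz0 using hz
  refine h.not_frozen_of_dotProduct (z := ∑ k ∈ N, w' k • z k) ?_ ?_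
  · rw [Matrix.mulVec_sum, elim_eq_sum hw']
    refine Finset.sum_congr rfl fun k hk => ?_
    rw [Matrix.mulVec_smul, hz k hk]
  · rw [dotProduct_sum]
    refine Finset.sum_eq_zero fun k hk => ?_
    rw [elim_eq_sum hw, sum_dotProduct]
    refine Finset.sum_eq_zero fun l hl => ?_
    have : z k (Sum.inl l) = 0 := by
      by_cases hkl : k = l
      · rw [← hkl, hz0 k hk]
      · by_contra hne
        obtain ⟨y, -, hy⟩ :=
          mem_rowSpaceOff.1 (SymRank.firmlyFrozen_iff.1 (mem_completeSet.1 (hN hl)).1)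
        exact hΓ k hk l hl hkl (mem_affected hy (hz k hk) hne)
    simp [this]

end Labels

/-! ### Perturbed adjacency matrices and stability under isolating a vertex. -/

section Graph

variable {F : Type*} [Field F] {n P : ℕ}

theorem perturb_transpose {a b : ℕ} (A : Matrix (Fin n) (Fin n) F) (rp : Fin a → Fin n)
    (cp : Fin b → Fin n) : (perturb A rp cp).transpose = perturb A.transpose cp rp := by
  rw [perturb, Matrix.fromBlocks_transpose, perturb]
  congr 1

theorem vecMul_perturb {a b : ℕ} (A : Matrix (Fin n) (Fin n) F) (rp : Fin a → Fin n)
    (cp : Fin b → Fin n) (y : Fin n ⊕ Fin a → F) :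
    Matrix.vecMul y (perturb A rp cp) =
      Matrix.vecMul (y ∘ Sum.inl) (Matrix.fromCols A (colPert F cp)) +
        ∑ k, y (Sum.inr k) • Pi.single (Sum.inl (rp k)) 1 := by
  ext j
  rcases j with j | j
  · simp [perturb, Matrix.vecMul, dotProduct, rowPert, Pi.single_apply, Matrix.fromCols]
  · simp [perturb, Matrix.vecMul, dotProduct, Matrix.fromCols]

theorem sum_single_mem_extend {ι β : Type*} [Fintype ι] [DecidableEq ι] [DecidableEq β] {a : ℕ}
    (R : Submodule F (ι ⊕ β → F)) (rp : Fin a → ι) (c : Fin a → F) :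
    ∑ k, c k • (Pi.single (Sum.inl (rp k)) 1 : ι ⊕ β → F) ∈ extend R (Finset.univ.image rp) :=
  Submodule.sum_mem _ fun k _ => Submodule.smul_mem _ _
    (single_mem_extend R (Finset.mem_image_of_mem _ (Finset.mem_univ k)))

/-- Attaching unit rows enlarges the row space by unit vectors. The effect of the row perturbation
depends only on the set of labels that it hits, once the column perturbation is fixed. -/
theorem rowSpace_perturb {a b : ℕ} (A : Matrix (Fin n) (Fin n) F) (rp : Fin a → Fin n)
    (cp : Fin b → Fin n) :
    rowSpace (perturb A rp cp) =
      extend (rowSpace (Matrix.fromCols A (colPert F cp))) (Finset.univ.image rp) := by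
  apply le_antisymm
  · rintro v ⟨y, rfl⟩
    rw [Matrix.vecMulLinear_apply, vecMul_perturb]
    exact Submodule.add_mem _ (le_extend _ _ ⟨_, rfl⟩) (sum_single_mem_extend _ _ _)
  · refine sup_le ?_ (Submodule.span_le.2 ?_)
    · rintro v ⟨y, rfl⟩
      refine ⟨Sum.elim y 0, ?_⟩
      rw [Matrix.vecMulLinear_apply, vecMul_perturb]
      simp
    · rintro v ⟨k, hk, rfl⟩
      obtain ⟨j, -, rfl⟩ := Finset.mem_image.1 (Finset.mem_coe.1 hk)
      refine ⟨Pi.single (Sum.inr j) 1, ?_⟩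
      rw [Matrix.vecMulLinear_apply, vecMul_perturb]
      have : (Pi.single (Sum.inr j) (1 : F) : Fin n ⊕ Fin a → F) ∘ Sum.inl = 0 := by
        ext; simp
      simp [this, Pi.single_apply]

theorem rowSpaceOff_perturb {a b : ℕ} (A : Matrix (Fin n) (Fin n) F) (rp : Fin a → Fin n)
    (cp : Fin b → Fin n) (i : Fin n) :
    rowSpaceOff (perturb A rp cp) (Sum.inl i) =
      extend (rowSpaceOff (Matrix.fromCols A (colPert F cp)) i) (Finset.univ.image rp) := by
  apply le_antisymm
  · rintro v ⟨y, hy, rfl⟩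
    rw [Matrix.vecMulLinear_apply, vecMul_perturb]
    exact Submodule.add_mem _ (le_extend _ _ ⟨_, hy, rfl⟩) (sum_single_mem_extend _ _ _)
  · refine sup_le ?_ (Submodule.span_le.2 ?_)
    · rintro v ⟨y, hy, rfl⟩
      refine ⟨Sum.elim y 0, by simpa using hy, ?_⟩
      rw [Matrix.vecMulLinear_apply, vecMul_perturb]
      simp
    · rintro v ⟨k, hk, rfl⟩
      obtain ⟨j, -, rfl⟩ := Finset.mem_image.1 (Finset.mem_coe.1 hk)
      refine ⟨Pi.single (Sum.inr j) 1, by simp, ?_⟩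
      rw [Matrix.vecMulLinear_apply, vecMul_perturb]
      have : (Pi.single (Sum.inr j) (1 : F) : Fin n ⊕ Fin a → F) ∘ Sum.inl = 0 := by
        ext; simp
      simp [this, Pi.single_apply]

/-- Outcomes of the perturbation: the sizes and the positions of the unit entries. -/
abbrev Pert (n P : ℕ) : Type := (Fin P × Fin P) × (Fin P → Fin n) × (Fin P → Fin n)

/-- The perturbation with the roles of rows and columns exchanged. -/
def Pert.swap (θ : Pert n P) : Pert n P := (θ.1.swap, θ.2.swap)

/-- The labels of the columns hit by the row perturbation. -/
def Pert.rowLabels (θ : Pert n P) : Finset (Fin n) := (Finset.Iic θ.1.1).image θ.2.1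

/-- The perturbed matrix at an outcome of the perturbation. -/
noncomputable def pert (A : Matrix (Fin n) (Fin n) F) (θ : Pert n P) :
    Matrix (Fin n ⊕ Fin (θ.1.1 + 1)) (Fin n ⊕ Fin (θ.1.2 + 1)) F :=
  perturb A (fun k => θ.2.1 (Fin.castLE θ.1.1.isLt k)) (fun k => θ.2.2 (Fin.castLE θ.1.2.isLt k))

theorem pert_transpose (A : Matrix (Fin n) (Fin n) F) (θ : Pert n P) :
    (pert A θ).transpose = pert A.transpose θ.swap := perturb_transpose _ _ _

/-- The matrix with the column perturbation only. -/
noncomputable def colMat (A : Matrix (Fin n) (Fin n) F) (b : Fin P) (cp : Fin P → Fin n) :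
    Matrix (Fin n) (Fin n ⊕ Fin (b + 1)) F :=
  Matrix.fromCols A (colPert F fun k : Fin (b + 1) => cp (Fin.castLE b.isLt k))

theorem image_castLE (a : Fin P) (rp : Fin P → Fin n) :
    Finset.univ.image (fun k : Fin (a + 1) => rp (Fin.castLE a.isLt k)) =
      (Finset.Iic a).image rp := by
  ext x
  simp only [Finset.mem_image, Finset.mem_univ, true_and, Finset.mem_Iic]
  constructor
  · rintro ⟨k, rfl⟩
    exact ⟨_, Fin.le_def.2 (Nat.lt_succ_iff.1 k.isLt), rfl⟩
  · rintro ⟨k, hk, rfl⟩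
    exact ⟨⟨k, Nat.lt_succ_iff.2 hk⟩, rfl⟩

theorem rowSpace_pert (A : Matrix (Fin n) (Fin n) F) (θ : Pert n P) :
    rowSpace (pert A θ) = extend (rowSpace (colMat A θ.1.2 θ.2.2)) θ.rowLabels := by
  rw [pert, rowSpace_perturb, image_castLE]
  rfl

theorem rowSpaceOff_pert (A : Matrix (Fin n) (Fin n) F) (θ : Pert n P) (i : Fin n) :
    rowSpaceOff (pert A θ) (Sum.inl i) =
      extend (rowSpaceOff (colMat A θ.1.2 θ.2.2) i) θ.rowLabels := by
  rw [pert, rowSpaceOff_perturb, image_castLE]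
  rfl

/-- The weighted adjacency matrix of the graph with edge indicators `g`. -/
def graphMat (K : Fin n → Fin n → F) (g : Sym2 (Fin n) → Bool) : Matrix (Fin n) (Fin n) F :=
  Matrix.of fun i j => if i ≠ j ∧ g s(i, j) = true then K i j else 0

/-- Removal of all edges at `i`. -/
def isolate (i : Fin n) (g : Sym2 (Fin n) → Bool) : Sym2 (Fin n) → Bool :=
  fun z => if i ∈ z then false else g z

/-- The labels `k` whose pair with `i` is switched on. -/
def star (i : Fin n) (g : Sym2 (Fin n) → Bool) : Finset (Fin n) :=
  Finset.univ.filter fun k => g s(i, k) = true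

/-- The neighbours of `i`. -/
def nbrs (i : Fin n) (g : Sym2 (Fin n) → Bool) : Finset (Fin n) := (star i g).erase i

theorem graphMat_transpose (K : Fin n → Fin n → F) (g : Sym2 (Fin n) → Bool) :
    (graphMat K g).transpose = graphMat (fun i j => K j i) g := by
  ext i j
  simp only [graphMat, Matrix.transpose_apply, Matrix.of_apply, Sym2.eq_swap (a := j), ne_comm]

/-- Some unit entry of the perturbation is placed at label `i`. -/
def Pert.Hits (θ : Pert n P) (i : Fin n) : Prop := (∃ k, θ.2.1 k = i) ∨ ∃ k, θ.2.2 k = i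

theorem graphMat_ne_zero {K : Fin n → Fin n → F} (hK : ∀ i j, K i j ≠ 0)
    (g : Sym2 (Fin n) → Bool) (i k : Fin n) : graphMat K g i k ≠ 0 ↔ k ∈ nbrs i g := by
  simp [graphMat, nbrs, star, hK, @eq_comm _ i k]

/-- A unit entry at label `i` would survive in row or column `i` of the isolated matrix, which has
to vanish for a `Border`. This is why hits are excluded. -/
theorem border_pert (K : Fin n → Fin n → F)
    (g : Sym2 (Fin n) → Bool) {θ : Pert n P} {i : Fin n} (hi : ¬ θ.Hits i) :
    Border (pert (graphMat K g) θ) (pert (graphMat K (isolate i g)) θ) (Sum.inl i) (Sum.inl i)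
      (Sum.elim (fun k => graphMat K g i k) 0) (Sum.elim (fun k => graphMat K g k i) 0) := by
  simp only [Pert.Hits, not_or, not_exists] at hi
  refine Border.of_eq ?_ ?_ ?_ ?_ ?_
  · ext j k
    rcases j with j | j <;> rcases k with k | k
    · simp only [pert, perturb, Matrix.fromBlocks_apply₁₁, Matrix.add_apply, Matrix.vecMulVec_apply,
        Sum.elim_inl, Pi.single_apply, Sum.inl.injEq, graphMat, isolate, Matrix.of_apply,
        Sym2.mem_iff]
      by_cases hj : j = i <;> by_cases hk : k = i
      · simp [hj, hk]
      · simp [hj, hk]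
      · simp [hj, hk]
      · simp [hj, hk, Ne.symm hj, Ne.symm hk]
    · simp [pert, perturb, Matrix.vecMulVec_apply]
    · simp [pert, perturb, Matrix.vecMulVec_apply]
    · simp [pert, perturb, Matrix.vecMulVec_apply]
  · rintro (j | j)
    · simp [pert, perturb, graphMat, isolate]
    · simp [pert, perturb, colPert, Ne.symm (hi.2 _)]
  · rintro (j | j)
    · simp [pert, perturb, graphMat, isolate]
    · simp [pert, perturb, rowPert, Ne.symm (hi.1 _)]
  · simp [graphMat]
  · simp [graphMat]

/-- The labels whose frozen status may change when a vertex with neighbourhood `N` is attached. -/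
noncomputable def influenced {ι α β : Type*} [Fintype ι] [Fintype α] [Fintype β] [DecidableEq ι]
    [DecidableEq α] [DecidableEq β] (B : Matrix (ι ⊕ α) (ι ⊕ β) F) (N : Finset ι) : Finset ι :=
  (unitsIn (extend (rowSpace B) N) \ unitsIn (rowSpace B)) ∪ N.biUnion (affected B) ∪
    Finset.univ.filter fun k => ∃ l ∈ N, l ∈ affected B k

theorem Border.symmDiff_subset {ι α β : Type*} [Fintype ι] [Fintype α] [Fintype β] [DecidableEq ι]
    [DecidableEq α] [DecidableEq β] {A B : Matrix (ι ⊕ α) (ι ⊕ β) F} {i : ι} {w w' : ι → F}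
    {N : Finset ι} (h : Border A B (Sum.inl i) (Sum.inl i) (Sum.elim w 0) (Sum.elim w' 0))
    (hw : ∀ k, w k ≠ 0 ↔ k ∈ N) (hw' : ∀ k, w' k ≠ 0 ↔ k ∈ N)
    (hN : dependent (rowSpace B) N = ∅) (hN' : dependent (rowSpace B.transpose) N = ∅) :
    symmDiff (frozenSet A) (frozenSet B) ⊆
        insert i (influenced B N ∪ influenced B.transpose N) ∧
      symmDiff (frozenSet A.transpose) (frozenSet B.transpose) ⊆
        insert i (influenced B N ∪ influenced B.transpose N) ∧
      symmDiff (completeSet A) (completeSet B) ⊆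
        insert i (influenced B N ∪ influenced B.transpose N) := by
  have h1 : symmDiff (frozenSet A) (frozenSet B) ⊆
      insert i (influenced B N ∪ influenced B.transpose N) := by
    refine (symmDiff_frozenSet_subset h hw hw' hN').trans (Finset.insert_subset_insert _ ?_)
    exact fun x hx => Finset.mem_union_left _ (Finset.mem_union_left _ hx)
  have h2 : symmDiff (frozenSet A.transpose) (frozenSet B.transpose) ⊆
      insert i (influenced B N ∪ influenced B.transpose N) := by
    refine (symmDiff_frozenSet_subset h.transpose hw' hw hN).trans
      (Finset.insert_subset_insert _ ?_)
    exact fun x hx => Finset.mem_union_right _ (Finset.mem_union_left _ hx)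
  refine ⟨h1, h2, (symmDiff_completeSet_subset h hw hN).trans ?_⟩
  refine Finset.insert_subset (Finset.mem_insert_self _ _)
    (Finset.union_subset (Finset.union_subset h1 h2) ?_)
  exact fun x hx => Finset.mem_insert_of_mem (Finset.mem_union_left _ (Finset.mem_union_right _ hx))

/-- A bound for the influence of a new vertex with neighbourhood in `U` on the row side. -/
noncomputable def side {ι α β : Type*} [Fintype ι] [Fintype α] [Fintype β] [DecidableEq ι]
    [DecidableEq α] [DecidableEq β] (B : Matrix (ι ⊕ α) (ι ⊕ β) F) (U : Finset ι) : ℝ :=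
  (unitsIn (extend (rowSpace B) U) \ unitsIn (rowSpace B)).card +
    Fintype.card ι * (dependent (rowSpace B) U).card +
    ∑ k, ((if k ∈ U then ((affected B k).card : ℝ) else 0) + (U ∩ affected B k).card)

/-- `side` is additive over labels and increasing in `U`, so that its mean can be computed and `N`
can be replaced by `star`. The factor `Fintype.card ι` makes a single dependent label cost as much
as the trivial bound on a set of labels. -/
theorem card_influenced_le {ι α β : Type*} [Fintype ι] [Fintype α] [Fintype β] [DecidableEq ι]
    [DecidableEq α] [DecidableEq β] (B : Matrix (ι ⊕ α) (ι ⊕ β) F) {N U : Finset ι} (h : N ⊆ U) :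
    ((influenced B N).card : ℝ) + Fintype.card ι * (dependent (rowSpace B) N).card ≤ side B U := by
  have h1 : (unitsIn (extend (rowSpace B) N) \ unitsIn (rowSpace B)).card ≤
      (unitsIn (extend (rowSpace B) U) \ unitsIn (rowSpace B)).card :=
    Finset.card_le_card (Finset.sdiff_subset_sdiff (unitsIn_mono (extend_mono _ h)) le_rfl)
  have h2 : (N.biUnion (affected B)).card ≤ ∑ k, if k ∈ U then (affected B k).card else 0 := by
    rw [Finset.sum_ite_mem, Finset.univ_inter]
    exact Finset.card_biUnion_le.trans (Finset.sum_le_sum_of_subset h)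
  have h3 : (Finset.univ.filter fun k => ∃ l ∈ N, l ∈ affected B k).card ≤
      ∑ k, (U ∩ affected B k).card := by
    rw [Finset.card_filter]
    refine Finset.sum_le_sum fun k _ => ?_
    split_ifs with hk
    · obtain ⟨l, hl, hlk⟩ := hk
      exact Finset.card_pos.2 ⟨l, Finset.mem_inter.2 ⟨h hl, hlk⟩⟩
    · exact Nat.zero_le _
  have h4 := Finset.card_le_card (dependent_subset (rowSpace B) h)
  have h5 : (influenced B N).card ≤ _ :=
    (Finset.card_union_le _ _).trans (Nat.add_le_add_right (Finset.card_union_le _ _) _)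
  have h6 := h5.trans (Nat.add_le_add (Nat.add_le_add h1 h2) h3)
  have h7 := Nat.add_le_add h6 (Nat.mul_le_mul_left (Fintype.card ι) h4)
  rw [side, Finset.sum_add_distrib]
  have h8 : (((influenced B N).card + Fintype.card ι * (dependent (rowSpace B) N).card : ℕ) : ℝ) ≤
    _ := Nat.cast_le.2 h7
  push_cast at h8
  linarith

open scoped Classical in
/-- A bound for the influence of a new vertex `i` with neighbourhood in `U`. -/
noncomputable def influence (A : Matrix (Fin n) (Fin n) F) (θ : Pert n P) (i : Fin n)
    (U : Finset (Fin n)) : ℝ :=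
  1 + (if θ.Hits i then (n : ℝ) else 0) + side (pert A θ) U + side (pert A.transpose θ.swap) U

theorem side_nonneg {ι α β : Type*} [Fintype ι] [Fintype α] [Fintype β] [DecidableEq ι]
    [DecidableEq α] [DecidableEq β] (B : Matrix (ι ⊕ α) (ι ⊕ β) F) (U : Finset ι) :
    0 ≤ side B U := by
  refine add_nonneg (by positivity) (Finset.sum_nonneg fun k _ => ?_)
  split_ifs <;> positivity

/-- A random set of labels that is hardly affected by the removal of the edges at one vertex. -/
def Stable (K : Fin n → Fin n → F) (S : Pert n P → (Sym2 (Fin n) → Bool) → Finset (Fin n)) : Prop :=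
  ∀ θ g i U, nbrs i g ⊆ U →
    ((symmDiff (S θ g) (S θ (isolate i g))).card : ℝ) ≤
      influence (graphMat K (isolate i g)) θ i U

/-- If `i` is hit or its neighbourhood has a dependent label on either side, the influence is at
least `n` and the bound is trivial. Otherwise `Border.symmDiff_subset` applies. -/
theorem Stable.of_subset {K : Fin n → Fin n → F} (hK : ∀ i j, K i j ≠ 0)
    {S : Pert n P → (Sym2 (Fin n) → Bool) → Finset (Fin n)}
    (hS : ∀ θ g i E, symmDiff (frozenSet (pert (graphMat K g) θ))
          (frozenSet (pert (graphMat K (isolate i g)) θ)) ⊆ E →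
        symmDiff (frozenSet (pert (graphMat K g) θ).transpose)
          (frozenSet (pert (graphMat K (isolate i g)) θ).transpose) ⊆ E →
        symmDiff (completeSet (pert (graphMat K g) θ))
          (completeSet (pert (graphMat K (isolate i g)) θ)) ⊆ E →
        symmDiff (S θ g) (S θ (isolate i g)) ⊆ E) : Stable K S := by
  intro θ g i U hU
  have hn : ((symmDiff (S θ g) (S θ (isolate i g))).card : ℝ) ≤ n := by
    simpa using (Finset.card_le_univ (symmDiff (S θ g) (S θ (isolate i g))))
  set B := pert (graphMat K (isolate i g)) θ with hB
  have hs := card_influenced_le B hU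
  have hs' := card_influenced_le B.transpose hU
  have e0 : side (pert (graphMat K (isolate i g)).transpose θ.swap) U = side B.transpose U := by
    rw [hB, pert_transpose]
    rfl
  rw [influence, e0]
  rw [Fintype.card_fin] at hs hs'
  by_cases hi : θ.Hits i
  · rw [if_pos hi]
    have := side_nonneg B U
    have := side_nonneg B.transpose U
    linarith
  · rw [if_neg hi]
    have hcard : ∀ {x : ℕ}, x ≠ 0 → (n : ℝ) ≤ n * x := fun {x} hx =>
      le_mul_of_one_le_right (by positivity) (by exact_mod_cast Nat.one_le_iff_ne_zero.2 hx)
    have p1 : (0 : ℝ) ≤ (influenced B (nbrs i g)).card := by positivity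
    have p2 : (0 : ℝ) ≤ (influenced B.transpose (nbrs i g)).card := by positivity
    by_cases h1 : dependent (rowSpace B) (nbrs i g) = ∅
    · by_cases h2 : dependent (rowSpace B.transpose) (nbrs i g) = ∅
      · obtain ⟨q1, q2, q3⟩ := (border_pert K g hi).symmDiff_subset (graphMat_ne_zero hK g i)
          (fun k => by
            have := graphMat_ne_zero (K := fun i j => K j i) (fun i j => hK j i) g i k
            rwa [← graphMat_transpose] at this) h1 h2
        have hc := Finset.card_le_card (hS θ g i _ q1 q2 q3)
        have hc' := hc.trans ((Finset.card_insert_le _ _).trans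
          (Nat.add_le_add_right (Finset.card_union_le _ _) 1))
        have hc2 : ((symmDiff (S θ g) (S θ (isolate i g))).card : ℝ) ≤ _ := Nat.cast_le.2 hc'
        push_cast at hc2
        have r1 : (0 : ℝ) ≤ n * (dependent (rowSpace B) (nbrs i g)).card := by positivity
        have r2 : (0 : ℝ) ≤ n * (dependent (rowSpace B.transpose) (nbrs i g)).card := by positivity
        linarith
      · have := hcard (mt Finset.card_eq_zero.1 h2)
        have := side_nonneg B U
        linarith
    · have := hcard (mt Finset.card_eq_zero.1 h1)
      have := side_nonneg B.transpose U
      linarith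

theorem stable_frozenSet {K : Fin n → Fin n → F} (hK : ∀ i j, K i j ≠ 0) :
    Stable (P := P) K fun θ g => frozenSet (pert (graphMat K g) θ) := by
  apply Stable.of_subset hK
  intro θ g i E h _ _
  exact h

theorem stable_frozenSet_transpose {K : Fin n → Fin n → F} (hK : ∀ i j, K i j ≠ 0) :
    Stable (P := P) K fun θ g => frozenSet (pert (graphMat K g) θ).transpose := by
  apply Stable.of_subset hK
  intro θ g i E _ h _
  exact h

theorem stable_completeSet {K : Fin n → Fin n → F} (hK : ∀ i j, K i j ≠ 0) :
    Stable (P := P) K fun θ g => completeSet (pert (graphMat K g) θ) := by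
  apply Stable.of_subset hK
  intro θ g i E _ _ h
  exact h

theorem symmDiff_inter_subset {ι : Type*} [DecidableEq ι] (a b c d : Finset ι) :
    symmDiff (a ∩ b) (c ∩ d) ⊆ symmDiff a c ∪ symmDiff b d := by
  intro x hx
  simp only [Finset.mem_symmDiff, Finset.mem_inter, Finset.mem_union] at hx ⊢
  tauto

theorem stable_inter {K : Fin n → Fin n → F} (hK : ∀ i j, K i j ≠ 0) :
    Stable (P := P) K fun θ g => frozenSet (pert (graphMat K g) θ) ∩
      frozenSet (pert (graphMat K g) θ).transpose := by
  apply Stable.of_subset hK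
  intro θ g i E h1 h2 _
  exact (symmDiff_inter_subset _ _ _ _).trans (Finset.union_subset h1 h2)

end Graph

/-! ### Finite expectations and independent indicators. -/

section Expectation

variable {α β ε : Type*} [Fintype α] [Fintype β] [Fintype ε] [DecidableEq ε]

/-- A probability weight on a finite type. -/
structure IsProb (w : α → ℝ) : Prop where
  nonneg : ∀ x, 0 ≤ w x
  sum_eq : ∑ x, w x = 1

/-- The expectation of `f` with respect to the weight `w`. -/
def wE (w : α → ℝ) (f : α → ℝ) : ℝ := ∑ x, w x * f x

theorem wE_add (w f f' : α → ℝ) : wE w (fun x => f x + f' x) = wE w f + wE w f' := by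
  simp [wE, mul_add, Finset.sum_add_distrib]

theorem wE_sub (w f f' : α → ℝ) : wE w (fun x => f x - f' x) = wE w f - wE w f' := by
  simp [wE, mul_sub, Finset.sum_sub_distrib]

theorem wE_mul_left (w f : α → ℝ) (c : ℝ) : wE w (fun x => c * f x) = c * wE w f := by
  simp [wE, Finset.mul_sum, mul_left_comm]

theorem wE_sum {κ : Type*} (s : Finset κ) (w : α → ℝ) (f : κ → α → ℝ) :
    wE w (fun x => ∑ k ∈ s, f k x) = ∑ k ∈ s, wE w (f k) := by
  simp only [wE, Finset.mul_sum]
  exact Finset.sum_comm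

theorem wE_comm (w : α → ℝ) (w' : β → ℝ) (f : α → β → ℝ) :
    wE w (fun x => wE w' (f x)) = wE w' fun y => wE w fun x => f x y := by
  simp only [wE, Finset.mul_sum]
  rw [Finset.sum_comm]
  exact Finset.sum_congr rfl fun _ _ => Finset.sum_congr rfl fun _ _ => by ring

theorem IsProb.const {w : α → ℝ} (hw : IsProb w) (c : ℝ) : wE w (fun _ => c) = c := by
  rw [wE, ← Finset.sum_mul, hw.sum_eq, one_mul]

theorem IsProb.mono {w : α → ℝ} (hw : IsProb w) {f f' : α → ℝ} (h : ∀ x, f x ≤ f' x) :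
    wE w f ≤ wE w f' :=
  Finset.sum_le_sum fun x _ => mul_le_mul_of_nonneg_left (h x) (hw.nonneg x)

theorem IsProb.le_const {w : α → ℝ} (hw : IsProb w) {f : α → ℝ} {c : ℝ} (h : ∀ x, f x ≤ c) :
    wE w f ≤ c := (hw.mono h).trans_eq (hw.const c)

theorem IsProb.wE_nonneg {w : α → ℝ} (hw : IsProb w) {f : α → ℝ} (h : ∀ x, 0 ≤ f x) :
    0 ≤ wE w f := Finset.sum_nonneg fun x _ => mul_nonneg (hw.nonneg x) (h x)

/-- A first moment is controlled by a bound for the second moment. -/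
theorem IsProb.wE_abs_le_sqrt {w : α → ℝ} (hw : IsProb w) (f : α → ℝ) {v : ℝ} (hv : 0 < v)
    (h : wE w (fun x => f x ^ 2) ≤ v) : wE w (fun x => |f x|) ≤ √v := by
  have hs : 0 < √v := Real.sqrt_pos.2 hv
  -- The inequality of arithmetic and geometric means with the optimal weight √v replaces
  -- Cauchy-Schwarz.
  have h1 : ∀ x, |f x| ≤ √v / 2 + (1 / (2 * √v)) * f x ^ 2 := by
    intro x
    have h2 : 0 ≤ (|f x| - √v) ^ 2 := sq_nonneg _
    have h3 : √v / 2 + (1 / (2 * √v)) * f x ^ 2 = (√v ^ 2 + |f x| ^ 2) / (2 * √v) := by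
      rw [sq_abs]; field_simp
    rw [h3, le_div_iff₀ (by positivity)]
    nlinarith
  refine (hw.mono h1).trans ?_
  rw [wE_add, hw.const, wE_mul_left]
  have h4 : (1 / (2 * √v)) * wE w (fun x => f x ^ 2) ≤ (1 / (2 * √v)) * v :=
    mul_le_mul_of_nonneg_left h (by positivity)
  have h5 : (1 / (2 * √v)) * v = √v / 2 := by
    nth_rw 2 [← Real.sq_sqrt hv.le]
    field_simp
  linarith

/-- The uniform weight. -/
noncomputable def unif (α : Type*) [Fintype α] : α → ℝ := fun _ => (Fintype.card α : ℝ)⁻¹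

theorem isProb_unif [Nonempty α] : IsProb (unif α) where
  nonneg _ := by unfold unif; positivity
  sum_eq := by simp [unif]

theorem wE_unif (f : α → ℝ) : wE (unif α) f = (∑ x, f x) / Fintype.card α := by
  rw [wE, Finset.sum_div]
  exact Finset.sum_congr rfl fun x _ => by rw [unif, mul_comm, div_eq_mul_inv]

theorem wE_unif_equiv (e : α ≃ β) (f : β → ℝ) :
    wE (unif α) (fun x => f (e x)) = wE (unif β) f := by
  rw [wE_unif, wE_unif, Fintype.card_congr e, e.sum_comp]

theorem wE_unif_prod (f : α × β → ℝ) :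
    wE (unif (α × β)) f = wE (unif α) fun x => wE (unif β) fun y => f (x, y) := by
  simp only [wE_unif, Fintype.card_prod, Fintype.sum_prod_type, Nat.cast_mul]
  rw [← Finset.sum_div, div_div, mul_comm (Fintype.card β : ℝ)]

/-- The law of independent indicators with success probability `p`. -/
noncomputable def bw (ε : Type*) [Fintype ε] (p : ℝ) : (ε → Bool) → ℝ :=
  fun g => ∏ e, if g e = true then p else 1 - p

theorem wE_bw_prod (p : ℝ) (f : ε → Bool → ℝ) :
    wE (bw ε p) (fun g => ∏ e, f e (g e)) = ∏ e, (p * f e true + (1 - p) * f e false) := by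
  simp only [wE, bw, ← Finset.prod_mul_distrib]
  rw [← Fintype.prod_sum (fun e b => (if b = true then p else 1 - p) * f e b)]
  exact Finset.prod_congr rfl fun e _ => by simp

theorem isProb_bw {p : ℝ} (h0 : 0 ≤ p) (h1 : p ≤ 1) : IsProb (bw ε p) where
  nonneg g := Finset.prod_nonneg fun e _ => by split_ifs <;> linarith
  sum_eq := by
    have := wE_bw_prod (ε := ε) p fun _ _ => 1
    simpa [wE] using this

theorem wE_bw_forall (p : ℝ) (b : Bool) (T : Finset ε) :
    wE (bw ε p) (fun g => if ∀ e ∈ T, g e = b then 1 else 0) =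
      (if b = true then p else 1 - p) ^ T.card := by
  have h1 := wE_bw_prod p fun e c => if e ∈ T → c = b then (1 : ℝ) else 0
  have h2 : ∀ g : ε → Bool, (if ∀ e ∈ T, g e = b then (1 : ℝ) else 0) =
      ∏ e, if e ∈ T → g e = b then 1 else 0 := by
    intro g
    rw [Finset.prod_boole]
    simp
  simp only [h2, h1]
  rw [Finset.prod_congr rfl (g := fun e => if e ∈ T then (if b = true then p else 1 - p) else 1)]
  · rw [Finset.prod_ite_mem, Finset.univ_inter, Finset.prod_const]
  · intro e _
    by_cases he : e ∈ T <;> cases b <;> simp [he]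

/-- Replacing the indicators in `D` by independent copies does not change the law. -/
theorem wE_bw_resample {p : ℝ} (D : Finset ε) (h0 : 0 ≤ p) (h1 : p ≤ 1) (f : (ε → Bool) → ℝ) :
    wE (bw ε p) f = wE (bw ε p) fun g => wE (bw ε p) fun g' => f (D.piecewise g' g) := by
  have hw : ∀ g g' : ε → Bool, bw ε p (D.piecewise g' g) * bw ε p (D.piecewise g g') =
      bw ε p g * bw ε p g' := by
    intro g g'
    simp only [bw, ← Finset.prod_mul_distrib]
    refine Finset.prod_congr rfl fun e _ => ?_
    by_cases he : e ∈ D <;> simp [he, mul_comm]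
  -- Exchanging the two configurations on `D` is an involution that preserves the product weight.
  have hinv : Function.Involutive fun x : (ε → Bool) × (ε → Bool) =>
      (D.piecewise x.2 x.1, D.piecewise x.1 x.2) := by
    rintro ⟨g, g'⟩
    ext e <;> by_cases he : e ∈ D <;> simp [he]
  have h2 : wE (bw ε p) f = ∑ x : (ε → Bool) × (ε → Bool), bw ε p x.1 * bw ε p x.2 * f x.1 := by
    rw [Fintype.sum_prod_type, wE]
    refine Finset.sum_congr rfl fun g _ => ?_
    simp only [mul_right_comm _ _ (f g)]
    rw [← Finset.mul_sum, (isProb_bw h0 h1).sum_eq, mul_one]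
  rw [h2, ← Equiv.sum_comp hinv.toPerm]
  simp only [wE, Finset.mul_sum, Function.Involutive.coe_toPerm]
  rw [Fintype.sum_prod_type]
  refine Finset.sum_congr rfl fun g _ => Finset.sum_congr rfl fun g' _ => ?_
  rw [hw, mul_assoc]

end Expectation

/-! ### Random neighbourhoods compared with uniform tuples, and the telescoping bound. -/

section RandomSets

variable {n : ℕ}

/-- Each set of size `m` is the image of at least `m!` tuples, namely of the permutations of its
increasing enumeration. Non-injective tuples only add to the right-hand side. -/
theorem factorial_mul_sum_le {α : Type*} [Fintype α] [LinearOrder α] (m : ℕ) {h : Finset α → ℝ}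
    (h0 : ∀ S, 0 ≤ h S) :
    (m.factorial : ℝ) * ∑ S ∈ Finset.powersetCard m Finset.univ, h S ≤
      ∑ s : Fin m → α, h (Finset.univ.image s) := by
  rw [← Finset.sum_fiberwise Finset.univ (fun s : Fin m → α => Finset.univ.image s), Finset.mul_sum]
  refine (Finset.sum_le_sum fun S hS => ?_).trans (Finset.sum_le_sum_of_subset_of_nonneg
    (Finset.subset_univ _) fun S _ _ => Finset.sum_nonneg fun s _ => h0 _)
  rw [Finset.sum_congr rfl (g := fun _ => h S) (fun s hs => by rw [(Finset.mem_filter.1 hs).2]),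
    Finset.sum_const, nsmul_eq_mul]
  refine mul_le_mul_of_nonneg_right ?_ (h0 S)
  have hc := (Finset.mem_powersetCard.1 hS).2
  have : (Finset.univ : Finset (Equiv.Perm (Fin m))).card ≤
      (Finset.univ.filter fun s : Fin m → α => Finset.univ.image s = S).card := by
    refine Finset.card_le_card_of_injOn (fun σ k => S.orderEmbOfFin hc (σ k)) ?_ ?_
    · intro σ _
      simp only [Finset.coe_filter, Finset.mem_univ, true_and, Set.mem_ofPred_eq]
      apply Finset.coe_injective
      rw [Finset.coe_image, Finset.coe_univ, Set.image_univ]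
      change Set.range (S.orderEmbOfFin hc ∘ σ) = S
      rw [Set.range_comp, σ.surjective.range_eq, Set.image_univ, Finset.range_orderEmbOfFin]
    · intro σ _ σ' _ hσ
      ext k
      have := congrFun hσ k
      exact congrArg Fin.val ((S.orderEmbOfFin hc).injective this)
  rw [Finset.card_univ, Fintype.card_perm, Fintype.card_fin] at this
  exact_mod_cast this

theorem mem_star {i k : Fin n} {g : Sym2 (Fin n) → Bool} : k ∈ star i g ↔ g s(i, k) = true := by
  simp [star]

theorem pair_injective (i : Fin n) : Function.Injective fun k => s(i, k) := fun _ _ h =>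
  Sym2.congr_right.1 h

theorem wE_bw_star_eq_le {p : ℝ} (h0 : 0 ≤ p) (h1 : p ≤ 1) (i : Fin n) (S : Finset (Fin n)) :
    wE (bw (Sym2 (Fin n)) p) (fun g => if star i g = S then 1 else 0) ≤ p ^ S.card := by
  rw [← Finset.card_image_of_injective S (pair_injective i), ]
  have := wE_bw_forall p true (S.image fun k => s(i, k))
  rw [if_pos rfl] at this
  rw [← this]
  refine (isProb_bw h0 h1).mono fun g => ?_
  by_cases h : star i g = S
  · rw [if_pos h, if_pos]
    intro e he
    obtain ⟨k, hk, rfl⟩ := Finset.mem_image.1 he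
    rw [← h, mem_star] at hk
    exact hk
  · rw [if_neg h]
    split_ifs <;> norm_num

/-- Comparison of a random set of labels with the labels of independent uniform positions. -/
theorem wE_star_le [NeZero n] {p : ℝ} (h0 : 0 ≤ p) (h1 : p ≤ 1) (i : Fin n)
    {h : Finset (Fin n) → ℝ} (hh : ∀ S, 0 ≤ h S) :
    wE (bw (Sym2 (Fin n)) p) (fun g => h (star i g)) ≤
      ∑ m ∈ Finset.range (n + 1), (n * p) ^ m / m.factorial *
        wE (unif (Fin m → Fin n)) fun s => h (Finset.univ.image s) := by
  have e1 : ∀ g : Sym2 (Fin n) → Bool, h (star i g) =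
      ∑ S, h S * if star i g = S then 1 else 0 := fun g => by simp
  simp only [e1]
  rw [wE_sum]
  simp only [wE_mul_left]
  -- The factor for absent edges is dropped: a given star has probability at most `p ^ S.card`. The
  -- resulting weights `(n p)^m / m!` add up to at most `exp (n p)`, not to 1.
  have e2 : ∑ S, h S * wE (bw (Sym2 (Fin n)) p) (fun g => if star i g = S then 1 else 0) ≤
      ∑ S ∈ (Finset.univ : Finset (Fin n)).powerset, h S * p ^ S.card := by
    rw [Finset.powerset_univ]
    exact Finset.sum_le_sum fun S _ =>
      mul_le_mul_of_nonneg_left (wE_bw_star_eq_le h0 h1 i S) (hh S)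
  refine e2.trans ?_
  rw [Finset.sum_powerset, Finset.card_univ, Fintype.card_fin]
  refine Finset.sum_le_sum fun m _ => ?_
  rw [Finset.sum_congr rfl (g := fun S => h S * p ^ m)
    (fun S hS => by rw [(Finset.mem_powersetCard.1 hS).2]), ← Finset.sum_mul]
  have e3 := factorial_mul_sum_le (α := Fin n) m hh
  have hn : (0 : ℝ) < n := by exact_mod_cast Nat.pos_of_ne_zero (NeZero.ne n)
  have hm : (0 : ℝ) < m.factorial := by exact_mod_cast m.factorial_pos
  have hcard : ((Fintype.card (Fin m → Fin n) : ℕ) : ℝ) = (n : ℝ) ^ m := by simp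
  rw [wE_unif, hcard, mul_pow]
  have e4 : (n : ℝ) ^ m * p ^ m / m.factorial * ((∑ s : Fin m → Fin n, h (Finset.univ.image s)) /
      (n : ℝ) ^ m) = (∑ s : Fin m → Fin n, h (Finset.univ.image s)) / m.factorial * p ^ m := by
    field_simp
  rw [e4]
  refine mul_le_mul_of_nonneg_right ?_ (by positivity)
  rw [le_div_iff₀ hm, mul_comm]
  exact e3

/-- Averages over the positions of a concatenation of two tuples. -/
theorem wE_unif_append {α : Type*} [Fintype α] (k l : ℕ) (f : (Fin k → α) → (Fin l → α) → ℝ) :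
    wE (unif (Fin (k + l) → α)) (fun x => f (fun i => x (Fin.castAdd l i))
      fun i => x (Fin.natAdd k i)) =
      wE (unif (Fin k → α)) fun y => wE (unif (Fin l → α)) fun z => f y z := by
  rw [← wE_unif_equiv (Fin.appendEquiv k l), wE_unif_prod]
  simp [Fin.appendEquiv]

theorem image_append {α : Type*} [DecidableEq α] {k l : ℕ} (x : Fin (k + l) → α) :
    Finset.univ.image x = Finset.univ.image (fun i => x (Fin.castAdd l i)) ∪
      Finset.univ.image fun i => x (Fin.natAdd k i) := by
  ext a
  simp only [Finset.mem_image, Finset.mem_univ, true_and, Finset.mem_union]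
  constructor
  · rintro ⟨j, rfl⟩
    refine Fin.addCases (fun i => Or.inl ⟨i, rfl⟩) (fun i => Or.inr ⟨i, rfl⟩) j
  · rintro (⟨i, rfl⟩ | ⟨i, rfl⟩) <;> exact ⟨_, rfl⟩

/-- The index `a : Fin P` stands for the size `a + 1`; the unused positions integrate out. -/
theorem wE_unif_Iic {α : Type*} [Fintype α] [Nonempty α] [DecidableEq α] {P : ℕ} (a : Fin P)
    (f : Finset α → ℝ) :
    wE (unif (Fin P → α)) (fun rp => f ((Finset.Iic a).image rp)) =
      wE (unif (Fin (a + 1) → α)) fun x => f (Finset.univ.image x) := by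
  obtain ⟨a, ha⟩ := a
  obtain ⟨l, rfl⟩ : ∃ l, P = a + 1 + l := ⟨P - (a + 1), by omega⟩
  have := wE_unif_append (α := α) (a + 1) l fun y _ => f (Finset.univ.image y)
  simp only [isProb_unif.const] at this
  rw [← this]
  congr 1
  ext rp
  congr 1
  ext x
  simp only [Finset.mem_image, Finset.mem_univ, true_and, Finset.mem_Iic]
  constructor
  · rintro ⟨k, hk, rfl⟩
    exact ⟨⟨k, Nat.lt_succ_iff.2 (Fin.le_def.1 hk)⟩, rfl⟩
  · rintro ⟨k, rfl⟩
    exact ⟨_, Fin.le_def.2 (Nat.lt_succ_iff.1 k.isLt), rfl⟩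

/-- For each unit of shift the sum telescopes to a difference of two values in `[0, C]`. -/
theorem sum_shift_sub_le {Ψ : ℕ → ℝ} {C : ℝ} (h0 : ∀ k, 0 ≤ Ψ k) (hC : ∀ k, Ψ k ≤ C) (P m : ℕ) :
    ∑ a ∈ Finset.range P, (Ψ (a + m) - Ψ a) ≤ m * C := by
  induction m with
  | zero => simp
  | succ m ih =>
    have h1 := Finset.sum_range_sub (fun a => Ψ (a + m)) P
    have h2 : ∑ a ∈ Finset.range P, (Ψ (a + (m + 1)) - Ψ a) =
        ∑ a ∈ Finset.range P, (Ψ (a + 1 + m) - Ψ (a + m)) +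
          ∑ a ∈ Finset.range P, (Ψ (a + m) - Ψ a) := by
      rw [← Finset.sum_add_distrib]
      exact Finset.sum_congr rfl fun a _ => by rw [show a + (m + 1) = a + 1 + m by ring]; ring
    rw [h2, h1]
    have := h0 (0 + m)
    have := hC (P + m)
    push_cast
    linarith

/-- After a random number of random additions, few further random additions matter little. -/
theorem wE_increment_le {α : Type*} [Fintype α] [Nonempty α] [DecidableEq α] {P : ℕ} [NeZero P]
    (m : ℕ) {ψ : Finset α → ℝ} {C : ℝ} (h0 : ∀ S, 0 ≤ ψ S) (hC : ∀ S, ψ S ≤ C) :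
    wE (unif (Fin m → α)) (fun s => wE (unif (Fin P)) fun a => wE (unif (Fin P → α)) fun rp =>
      ψ ((Finset.Iic a).image rp ∪ Finset.univ.image s) - ψ ((Finset.Iic a).image rp)) ≤
      m * C / P := by
  set Ψ : ℕ → ℝ := fun k => wE (unif (Fin (k + 1) → α)) fun x => ψ (Finset.univ.image x) with hΨ
  rw [wE_comm]
  -- The `a + 1` used positions and the `m` new ones form one uniform tuple of length `a + 1 + m`,
  -- so only the total number counts and the average over `a` telescopes.
  have key : ∀ a : Fin P, (wE (unif (Fin m → α)) fun s => wE (unif (Fin P → α)) fun rp =>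
      ψ ((Finset.Iic a).image rp ∪ Finset.univ.image s) - ψ ((Finset.Iic a).image rp)) =
      Ψ (a + m) - Ψ a := by
    intro a
    simp only [wE_sub]
    rw [isProb_unif.const]
    congr 1
    · have h1 := fun s : Fin m → α => wE_unif_Iic a fun S => ψ (S ∪ Finset.univ.image s)
      simp only [h1]
      rw [wE_comm, ← wE_unif_append (a + 1) m fun y z =>
        ψ (Finset.univ.image y ∪ Finset.univ.image z)]
      simp only [← image_append]
      rw [hΨ]
      simp only
      rw [show (a : ℕ) + m + 1 = a + 1 + m by ring]
    · exact wE_unif_Iic a ψ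
  simp only [key]
  rw [wE_unif, Fintype.card_fin, Fin.sum_univ_eq_sum_range (fun a => Ψ (a + m) - Ψ a)]
  refine div_le_div_of_nonneg_right (sum_shift_sub_le (fun k => ?_) (fun k => ?_) P m)
    (Nat.cast_nonneg P)
  · exact isProb_unif.wE_nonneg fun x => h0 _
  · exact isProb_unif.le_const fun x => hC _

theorem sum_pow_div_factorial_mul_le {t : ℝ} (ht : 0 ≤ t) (n : ℕ) :
    ∑ m ∈ Finset.range (n + 1), t ^ m / m.factorial * m ≤ t * Real.exp t := by
  rw [Finset.sum_range_succ']
  have : ∀ m ∈ Finset.range n, t ^ (m + 1) / (m + 1).factorial * ((m + 1 : ℕ) : ℝ) =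
      t * (t ^ m / m.factorial) := by
    intro m _
    rw [Nat.factorial_succ]
    push_cast
    have : (m.factorial : ℝ) ≠ 0 := by exact_mod_cast m.factorial_ne_zero
    field_simp
    ring
  rw [Finset.sum_congr rfl this, ← Finset.mul_sum]
  simp only [pow_zero, Nat.factorial_zero, Nat.cast_one, div_one, Nat.cast_zero, mul_zero, add_zero]
  exact mul_le_mul_of_nonneg_left (Real.sum_le_exp_of_nonneg ht n) ht

/-- Adding a random set of labels after a random number of random additions. -/
theorem wE_increment_star_le [NeZero n] {P : ℕ} [NeZero P] {p : ℝ} (h0 : 0 ≤ p) (h1 : p ≤ 1)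
    (i : Fin n) {ψ : Finset (Fin n) → ℝ} {C : ℝ} (hψ : ∀ S, 0 ≤ ψ S) (hC : ∀ S, ψ S ≤ C)
    (hmono : ∀ S S', S ⊆ S' → ψ S ≤ ψ S') :
    wE (unif (Fin P)) (fun a => wE (unif (Fin P → Fin n)) fun rp =>
      wE (bw (Sym2 (Fin n)) p) fun g =>
        ψ ((Finset.Iic a).image rp ∪ star i g) - ψ ((Finset.Iic a).image rp)) ≤
      C * (n * p) * Real.exp (n * p) / P := by
  have hC0 : 0 ≤ C := (hψ ∅).trans (hC ∅)
  have e1 : ∀ (a : Fin P) (rp : Fin P → Fin n), (wE (bw (Sym2 (Fin n)) p) fun g =>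
      ψ ((Finset.Iic a).image rp ∪ star i g) - ψ ((Finset.Iic a).image rp)) ≤
      ∑ m ∈ Finset.range (n + 1), (n * p) ^ m / m.factorial *
        wE (unif (Fin m → Fin n)) fun s =>
          ψ ((Finset.Iic a).image rp ∪ Finset.univ.image s) - ψ ((Finset.Iic a).image rp) :=
    fun a rp => wE_star_le h0 h1 i
      (h := fun S => ψ ((Finset.Iic a).image rp ∪ S) - ψ ((Finset.Iic a).image rp))
      fun S => sub_nonneg.2 (hmono _ _ Finset.subset_union_left)
  refine (isProb_unif.mono fun a => isProb_unif.mono fun rp => e1 a rp).trans ?_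
  simp only [wE_sum, wE_mul_left]
  have e2 : ∀ m : ℕ, (wE (unif (Fin P)) fun a => wE (unif (Fin P → Fin n)) fun rp =>
      wE (unif (Fin m → Fin n)) fun s =>
        ψ ((Finset.Iic a).image rp ∪ Finset.univ.image s) - ψ ((Finset.Iic a).image rp)) ≤
      m * C / P := by
    intro m
    have := wE_increment_le (P := P) m hψ hC
    rw [wE_comm] at this
    refine le_of_eq_of_le ?_ this
    congr 1
    ext a
    exact wE_comm _ _ _
  have e3 := sum_pow_div_factorial_mul_le (mul_nonneg (Nat.cast_nonneg n) h0) n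
  calc _ ≤ ∑ m ∈ Finset.range (n + 1), (n * p) ^ m / m.factorial * (m * C / P) :=
        Finset.sum_le_sum fun m _ => mul_le_mul_of_nonneg_left (e2 m) (by positivity)
    _ = (∑ m ∈ Finset.range (n + 1), (n * p) ^ m / m.factorial * m) * (C / P) := by
        rw [Finset.sum_mul]
        exact Finset.sum_congr rfl fun m _ => by ring
    _ ≤ (n * p * Real.exp (n * p)) * (C / P) := mul_le_mul_of_nonneg_right e3 (by positivity)
    _ = _ := by ring

end RandomSets

/-! ### Expected influence of a vertex under the random perturbation. -/

section Influence

variable {F : Type*} [Field F] {n P : ℕ}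

/-- The indicator at `z` is independent of `f`; resampling this one coordinate makes the factor `p`
visible. -/
theorem wE_bw_ite_of_indep {ε : Type*} [Fintype ε] [DecidableEq ε] {p : ℝ} (h0 : 0 ≤ p)
    (h1 : p ≤ 1) (z : ε) {f : (ε → Bool) → ℝ}
    (hf : ∀ g g', (∀ e, e ≠ z → g e = g' e) → f g = f g') :
    wE (bw ε p) (fun g => if g z = true then f g else 0) = p * wE (bw ε p) f := by
  rw [wE_bw_resample {z} h0 h1, ← wE_mul_left]
  congr 1
  ext g
  have e1 : ∀ g' : ε → Bool, (if (({z} : Finset ε).piecewise g' g) z = true then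
      f (({z} : Finset ε).piecewise g' g) else 0) =
      f g * if ∀ e ∈ ({z} : Finset ε), g' e = true then 1 else 0 := by
    intro g'
    rw [hf _ g fun e he => by simp [he]]
    simp
  simp only [e1, wE_mul_left]
  rw [wE_bw_forall]
  simp [mul_comm]

theorem wE_mem_star {p : ℝ} (h0 : 0 ≤ p) (h1 : p ≤ 1) (i k : Fin n) (c : ℝ) :
    wE (bw (Sym2 (Fin n)) p) (fun g => if k ∈ star i g then c else 0) = p * c := by
  simp only [mem_star]
  rw [wE_bw_ite_of_indep h0 h1 s(i, k) fun _ _ _ => rfl, (isProb_bw h0 h1).const]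

theorem wE_card_star_inter {p : ℝ} (h0 : 0 ≤ p) (h1 : p ≤ 1) (i : Fin n) (S : Finset (Fin n)) :
    wE (bw (Sym2 (Fin n)) p) (fun g => ((star i g ∩ S).card : ℝ)) = p * S.card := by
  have : ∀ g : Sym2 (Fin n) → Bool, ((star i g ∩ S).card : ℝ) =
      ∑ k ∈ S, if k ∈ star i g then (1 : ℝ) else 0 := by
    intro g
    rw [Finset.sum_boole, Finset.inter_comm]
    congr 2
  simp only [this, wE_sum, wE_mem_star h0 h1, mul_one, Finset.sum_const, nsmul_eq_mul, mul_comm]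

/-- Whether `k` is newly captured by `(star i g).erase k` does not depend on the edge `s(i, k)`, so
the presence of that edge costs an independent factor `p`. This factor compensates for the weight
`n` of dependent labels in `side`. -/
theorem wE_card_dependent_le {β : Type*} [Fintype β] [DecidableEq β] {p : ℝ} (h0 : 0 ≤ p)
    (h1 : p ≤ 1) (i : Fin n) (R : Submodule F (Fin n ⊕ β → F)) :
    wE (bw (Sym2 (Fin n)) p) (fun g => ((dependent R (star i g)).card : ℝ)) ≤
      p * wE (bw (Sym2 (Fin n)) p) fun g =>
        ((unitsIn (extend R (star i g)) \ unitsIn R).card : ℝ) := by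
  have e1 : ∀ g : Sym2 (Fin n) → Bool, ((dependent R (star i g)).card : ℝ) =
      ∑ k, if g s(i, k) = true then
        (if k ∈ unitsIn (extend R ((star i g).erase k)) \ unitsIn R then (1 : ℝ) else 0) else 0 := by
    intro g
    rw [dependent, Finset.card_filter, Nat.cast_sum, star, Finset.sum_filter]
    refine Finset.sum_congr rfl fun k _ => ?_
    split_ifs <;> simp
  simp only [e1]
  rw [wE_sum, ← wE_mul_left]
  have e2 : ∀ k, wE (bw (Sym2 (Fin n)) p) (fun g => if g s(i, k) = true then
      (if k ∈ unitsIn (extend R ((star i g).erase k)) \ unitsIn R then (1 : ℝ) else 0) else 0) ≤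
      p * wE (bw (Sym2 (Fin n)) p)
        fun g => if k ∈ unitsIn (extend R (star i g)) \ unitsIn R then (1 : ℝ) else 0 := by
    intro k
    rw [wE_bw_ite_of_indep h0 h1 s(i, k)
      (f := fun g => if k ∈ unitsIn (extend R ((star i g).erase k)) \ unitsIn R then (1 : ℝ) else 0)]
    · refine mul_le_mul_of_nonneg_left ((isProb_bw h0 h1).mono fun g => ?_) h0
      by_cases h : k ∈ unitsIn (extend R ((star i g).erase k)) \ unitsIn R
      · rw [if_pos h, if_pos]
        exact Finset.sdiff_subset_sdiff (unitsIn_mono (extend_mono R (Finset.erase_subset k _)))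
          le_rfl h
      · rw [if_neg h]
        split_ifs <;> norm_num
    · intro g g' hg
      have : (star i g).erase k = (star i g').erase k := by
        ext l
        simp only [Finset.mem_erase, mem_star]
        refine and_congr_right fun hl => ?_
        rw [hg _ fun h => hl (pair_injective i h)]
      simp only [this]
  refine (Finset.sum_le_sum fun k _ => e2 k).trans_eq ?_
  rw [← Finset.mul_sum, ← wE_sum, ← wE_mul_left]
  congr 1
  ext g
  rw [Finset.sum_boole]
  congr 3
  ext; simp

theorem wE_side_le {α β : Type*} [Fintype α] [Fintype β] [DecidableEq α] [DecidableEq β]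
    {p : ℝ} (h0 : 0 ≤ p) (h1 : p ≤ 1) (i : Fin n) (B : Matrix (Fin n ⊕ α) (Fin n ⊕ β) F) :
    wE (bw (Sym2 (Fin n)) p) (fun g => side B (star i g)) ≤
      (1 + n * p) * wE (bw (Sym2 (Fin n)) p) (fun g =>
        ((unitsIn (extend (rowSpace B) (star i g)) \ unitsIn (rowSpace B)).card : ℝ)) +
      2 * p * ∑ k, ((affected B k).card : ℝ) := by
  simp only [side, wE_add, wE_mul_left, wE_sum, wE_mem_star h0 h1, wE_card_star_inter h0 h1]
  have := mul_le_mul_of_nonneg_left (wE_card_dependent_le h0 h1 i (rowSpace B))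
    (Nat.cast_nonneg (α := ℝ) n)
  rw [Fintype.card_fin, ← Finset.sum_add_distrib.symm, ← Finset.mul_sum]
  linarith

/-- Once row `k` is deleted, restoring one affected label `l` by a unit row restores all of them,
since two representations that use row `k` can be combined to eliminate it. Hence each affected `l`
contributes at least the number of affected labels to the sum. -/
theorem card_affected_sq_le {α β : Type*} [Fintype α] [Fintype β] [DecidableEq α] [DecidableEq β]
    (B : Matrix (Fin n ⊕ α) (Fin n ⊕ β) F) (k : Fin n) :
    ((affected B k).card : ℝ) ^ 2 ≤ ∑ l, ((unitsIn (extend (rowSpaceOff B (Sum.inl k)) {l}) \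
      unitsIn (rowSpaceOff B (Sum.inl k))).card : ℝ) := by
  have key : ∀ l ∈ affected B k, affected B k ⊆ unitsIn (extend (rowSpaceOff B (Sum.inl k)) {l}) \
      unitsIn (rowSpaceOff B (Sum.inl k)) := by
    intro l hl l' hl'
    rw [affected, Finset.mem_sdiff, mem_unitsIn] at hl hl'
    rw [Finset.mem_sdiff]
    refine ⟨mem_unitsIn.2 ?_, hl'.2⟩
    obtain ⟨⟨y, hy⟩, hl⟩ := hl
    obtain ⟨⟨y', hy'⟩, hl'⟩ := hl'
    rw [Matrix.vecMulLinear_apply] at hy hy'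
    have hyk : y (Sum.inl k) ≠ 0 := fun h => hl (mem_unitsIn.2 (mem_rowSpaceOff.2 ⟨y, h, hy⟩))
    have h2 : (Pi.single (Sum.inl l') 1 : Fin n ⊕ β → F) =
        Matrix.vecMul (y' - (y' (Sum.inl k) / y (Sum.inl k)) • y) B +
          (y' (Sum.inl k) / y (Sum.inl k)) • Pi.single (Sum.inl l) 1 := by
      rw [Matrix.sub_vecMul, Matrix.smul_vecMul, hy, hy']
      simp
    rw [h2]
    refine Submodule.add_mem _ (le_extend _ _ (mem_rowSpaceOff.2 ⟨_, ?_, rfl⟩))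
      (Submodule.smul_mem _ _ (single_mem_extend _ (Finset.mem_singleton_self l)))
    simp [hyk]
  have h1 : ((affected B k).card : ℝ) ^ 2 = ∑ l ∈ affected B k, ((affected B k).card : ℝ) := by
    rw [Finset.sum_const, nsmul_eq_mul, sq]
  rw [h1]
  refine (Finset.sum_le_sum fun l hl => Nat.cast_le.2 (Finset.card_le_card (key l hl))).trans ?_
  exact Finset.sum_le_sum_of_subset_of_nonneg (Finset.subset_univ _) fun _ _ _ => by positivity

theorem wE_pert (f : Pert n P → ℝ) :
    wE (unif (Pert n P)) f = wE (unif (Fin P)) fun b => wE (unif (Fin P → Fin n)) fun cp =>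
      wE (unif (Fin P)) fun a => wE (unif (Fin P → Fin n)) fun rp => f ((a, b), rp, cp) := by
  simp only [Pert, wE_unif_prod]
  rw [wE_comm]
  congr 1
  ext b
  rw [wE_comm (unif (Fin P → Fin n)) (unif (Fin P))]
  congr 1
  ext a
  exact wE_comm _ _ _

theorem wE_pert_le [NeZero n] [NeZero P] {f : Pert n P → ℝ} {c : ℝ}
    (h : ∀ b cp, (wE (unif (Fin P)) fun a => wE (unif (Fin P → Fin n)) fun rp =>
      f ((a, b), rp, cp)) ≤ c) : wE (unif (Pert n P)) f ≤ c := by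
  rw [wE_pert]
  exact isProb_unif.le_const fun b => isProb_unif.le_const fun cp => h b cp

theorem card_extend_sdiff {β : Type*} [Fintype β] [DecidableEq β]
    (R : Submodule F (Fin n ⊕ β → F)) (L U : Finset (Fin n)) :
    ((unitsIn (extend (extend R L) U) \ unitsIn (extend R L)).card : ℝ) =
      (unitsIn (extend R (L ∪ U))).card - (unitsIn (extend R L)).card := by
  rw [Finset.card_sdiff_of_subset (unitsIn_mono (le_extend _ _)), extend_extend, Nat.cast_sub]
  exact Finset.card_le_card (unitsIn_mono (extend_mono R Finset.subset_union_left))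

theorem card_unitsIn_le {β : Type*} [Fintype β] [DecidableEq β]
    (R : Submodule F (Fin n ⊕ β → F)) : ((unitsIn R).card : ℝ) ≤ n := by
  have := Finset.card_le_univ (unitsIn R)
  rw [Fintype.card_fin] at this
  exact_mod_cast this

theorem wE_card_increment_le [NeZero n] [NeZero P] {p : ℝ} (h0 : 0 ≤ p) (h1 : p ≤ 1) (i : Fin n)
    (A : Matrix (Fin n) (Fin n) F) :
    wE (unif (Pert n P)) (fun θ => wE (bw (Sym2 (Fin n)) p) fun g =>
      ((unitsIn (extend (rowSpace (pert A θ)) (star i g)) \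
        unitsIn (rowSpace (pert A θ))).card : ℝ)) ≤ n * (n * p) * Real.exp (n * p) / P := by
  simp only [rowSpace_pert, card_extend_sdiff]
  refine wE_pert_le fun b cp => ?_
  exact wE_increment_star_le h0 h1 i
    (ψ := fun S => ((unitsIn (extend (rowSpace (colMat A b cp)) S)).card : ℝ))
    (fun S => by positivity) (fun S => card_unitsIn_le _)
    fun S S' h => Nat.cast_le.2 (Finset.card_le_card (unitsIn_mono (extend_mono _ h)))

/-- The sum in `card_affected_sq_le` is `n` times the mean gain from one more uniform unit row,
which is at most `n / P`. The second moment is thus at most `n ^ 2 / P`. -/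
theorem wE_card_affected_le [NeZero n] [NeZero P] (A : Matrix (Fin n) (Fin n) F) (k : Fin n) :
    wE (unif (Pert n P)) (fun θ => ((affected (pert A θ) k).card : ℝ)) ≤ n / √P := by
  have hn : (0 : ℝ) < n := by exact_mod_cast Nat.pos_of_ne_zero (NeZero.ne n)
  have hP : (0 : ℝ) < P := by exact_mod_cast Nat.pos_of_ne_zero (NeZero.ne P)
  have hsq : wE (unif (Pert n P)) (fun θ => ((affected (pert A θ) k).card : ℝ) ^ 2) ≤
      n ^ 2 / P := by
    refine (isProb_unif.mono fun θ => card_affected_sq_le (pert A θ) k).trans ?_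
    simp only [rowSpaceOff_pert, card_extend_sdiff]
    refine wE_pert_le fun b cp => ?_
    have := wE_increment_le (α := Fin n) (P := P) 1
      (ψ := fun S => ((unitsIn (extend (rowSpaceOff (colMat A b cp) k) S)).card : ℝ)) (C := n)
      (fun S => by positivity) (fun S => card_unitsIn_le _)
    have h2 := mul_le_mul_of_nonneg_left this hn.le
    have h3 : (n : ℝ) * (((1 : ℕ) : ℝ) * n / P) = n ^ 2 / P := by push_cast; ring
    rw [h3] at h2
    refine le_of_eq_of_le ?_ h2
    -- One additional uniform position is a tuple indexed by `Fin 1`; its average times `n` is the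
    -- sum over `l`.
    rw [← wE_unif_equiv (Equiv.funUnique (Fin 1) (Fin n)).symm]
    simp only [wE_unif (α := Fin n)]
    rw [Fintype.card_fin, mul_div_cancel₀ _ hn.ne']
    simp only [wE_sum]
    refine Finset.sum_congr rfl fun l _ => ?_
    simp [Pert.rowLabels]
  have := isProb_unif.wE_abs_le_sqrt _ (by positivity) hsq
  simp only [Nat.abs_cast] at this
  rwa [Real.sqrt_div (by positivity), Real.sqrt_sq hn.le] at this

theorem wE_pert_side_le [NeZero n] [NeZero P] {p : ℝ} (h0 : 0 ≤ p) (h1 : p ≤ 1) (i : Fin n)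
    (A : Matrix (Fin n) (Fin n) F) :
    wE (unif (Pert n P)) (fun θ => wE (bw (Sym2 (Fin n)) p) fun g => side (pert A θ) (star i g)) ≤
      n * ((1 + n * p) * (n * p) * Real.exp (n * p) / P + 2 * (n * p) / √P) := by
  refine (isProb_unif.mono fun θ => wE_side_le h0 h1 i (pert A θ)).trans ?_
  simp only [wE_add, wE_mul_left, wE_sum]
  have e1 := mul_le_mul_of_nonneg_left (wE_card_increment_le (P := P) h0 h1 i A)
    (show (0 : ℝ) ≤ 1 + n * p by positivity)
  have e2 : ∑ k, wE (unif (Pert n P)) (fun θ => ((affected (pert A θ) k).card : ℝ)) ≤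
      ∑ _k : Fin n, (n : ℝ) / √P := Finset.sum_le_sum fun k _ => wE_card_affected_le A k
  rw [Finset.sum_const, Finset.card_univ, Fintype.card_fin, nsmul_eq_mul] at e2
  have e3 := mul_le_mul_of_nonneg_left e2 (show (0 : ℝ) ≤ 2 * p by positivity)
  refine (add_le_add e1 e3).trans_eq ?_
  ring

/-- Transposing two labels shows that all values of `rp k` are equally likely, and the probabilities
add up to 1. -/
theorem wE_apply_eq [NeZero n] (k : Fin P) (i : Fin n) :
    wE (unif (Fin P → Fin n)) (fun rp => if rp k = i then 1 else 0) = 1 / n := by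
  have h : ∀ j, wE (unif (Fin P → Fin n)) (fun rp => if rp k = j then 1 else 0) =
      wE (unif (Fin P → Fin n)) (fun rp => if rp k = i then 1 else 0) := by
    intro j
    rw [← wE_unif_equiv (Equiv.arrowCongr (Equiv.refl (Fin P)) (Equiv.swap i j))]
    congr 1
    ext rp
    simp [Equiv.swap_apply_eq_iff]
  have h2 : ∑ j, wE (unif (Fin P → Fin n)) (fun rp => if rp k = j then 1 else 0) = 1 := by
    rw [← wE_sum]
    simp [isProb_unif.const]
  simp only [h] at h2
  rw [Finset.sum_const, Finset.card_univ, Fintype.card_fin, nsmul_eq_mul] at h2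
  exact eq_one_div_of_mul_eq_one_right h2

open scoped Classical in
theorem wE_hits_le [NeZero n] [NeZero P] (i : Fin n) (c : ℝ) (hc : 0 ≤ c) :
    wE (unif (Pert n P)) (fun θ => if θ.Hits i then c else 0) ≤ c * (2 * P / n) := by
  have h : ∀ θ : Pert n P, (if θ.Hits i then c else 0) ≤
      c * ((∑ k, if θ.2.1 k = i then 1 else 0) + ∑ k, if θ.2.2 k = i then 1 else 0) := by
    intro θ
    have p1 : (0 : ℝ) ≤ ∑ k, if θ.2.1 k = i then 1 else 0 :=
      Finset.sum_nonneg fun k _ => by split_ifs <;> norm_num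
    have p2 : (0 : ℝ) ≤ ∑ k, if θ.2.2 k = i then 1 else 0 :=
      Finset.sum_nonneg fun k _ => by split_ifs <;> norm_num
    split_ifs with hi
    · refine le_mul_of_one_le_right hc ?_
      rcases hi with ⟨k, hk⟩ | ⟨k, hk⟩
      · have := Finset.single_le_sum (f := fun k => if θ.2.1 k = i then (1 : ℝ) else 0)
          (fun k _ => by split_ifs <;> norm_num) (Finset.mem_univ k)
        simp only [hk, if_true] at this
        linarith
      · have := Finset.single_le_sum (f := fun k => if θ.2.2 k = i then (1 : ℝ) else 0)
          (fun k _ => by split_ifs <;> norm_num) (Finset.mem_univ k)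
        simp only [hk, if_true] at this
        linarith
    · positivity
  refine (isProb_unif.mono h).trans_eq ?_
  simp only [wE_mul_left, wE_add, wE_sum, Pert, wE_unif_prod]
  have e : ∀ k : Fin P, (wE (unif (Fin P)) fun _ => wE (unif (Fin P)) fun _ =>
      wE (unif (Fin P → Fin n)) fun rp => wE (unif (Fin P → Fin n)) fun _ =>
        if rp k = i then 1 else 0) = 1 / n := fun k => by
    simp only [isProb_unif.const, wE_apply_eq]
  have e' : ∀ k : Fin P, (wE (unif (Fin P)) fun _ => wE (unif (Fin P)) fun _ =>
      wE (unif (Fin P → Fin n)) fun _ => wE (unif (Fin P → Fin n)) fun cp =>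
        if cp k = i then 1 else 0) = 1 / n := fun k => by
    simp only [isProb_unif.const, wE_apply_eq]
  simp only [e, e', Finset.sum_const, Finset.card_univ, Fintype.card_fin, nsmul_eq_mul]
  ring

/-- The bound for the expected influence of a vertex, relative to `n`. -/
noncomputable def rate (d : ℝ) (n P : ℕ) : ℝ :=
  (1 + 2 * P) / n + 2 * ((1 + d) * d * Real.exp d / P + 2 * d / √P)

/-- Exchanging rows and columns, as a bijection. -/
def Pert.swapEquiv : Pert n P ≃ Pert n P :=
  (Equiv.prodComm _ _).prodCongr (Equiv.prodComm _ _)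

/-- The contributions to `n * rate d n P` are 1 for the vertex itself, `2 * P` for a hit
(probability at most `2 * P / n`, cost `n`), and twice the bound for `side`. The transposed side is
treated by exchanging the row and the column perturbation, which preserves their law. -/
theorem wE_influence_le [NeZero n] [NeZero P] {d p : ℝ} (h0 : 0 ≤ p) (h1 : p ≤ 1)
    (hd : n * p ≤ d) (i : Fin n) (A : Matrix (Fin n) (Fin n) F) :
    wE (unif (Pert n P)) (fun θ => wE (bw (Sym2 (Fin n)) p) fun g =>
      influence A θ i (star i g)) ≤ n * rate d n P := by
  have hn : (0 : ℝ) < n := by exact_mod_cast Nat.pos_of_ne_zero (NeZero.ne n)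
  simp only [influence, wE_add, (isProb_bw h0 h1).const]
  rw [isProb_unif.const]
  have a1 := wE_hits_le (P := P) i (n : ℝ) hn.le
  have a2 := wE_pert_side_le (P := P) h0 h1 i A
  have a3 := wE_pert_side_le (P := P) h0 h1 i A.transpose
  rw [← wE_unif_equiv Pert.swapEquiv] at a3
  have a3' : wE (unif (Pert n P)) (fun θ => wE (bw (Sym2 (Fin n)) p) fun g =>
      side (pert A.transpose θ.swap) (star i g)) ≤ _ := a3
  have a4 : (1 + n * p) * (n * p) * Real.exp (n * p) / P + 2 * (n * p) / √P ≤
      (1 + d) * d * Real.exp d / P + 2 * d / √P := by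
    have h2 : 0 ≤ n * p := by positivity
    have h3 : 0 ≤ d := h2.trans hd
    gcongr
  have a5 := mul_le_mul_of_nonneg_left a4 hn.le
  have a6 : (n : ℝ) * rate d n P = 1 + n * (2 * P / n) +
      2 * (n * ((1 + d) * d * Real.exp d / P + 2 * d / √P)) := by
    rw [rate]
    field_simp
  rw [a6]
  linarith

end Influence

/-! ### Concentration of the number of vertices with all neighbours in a stable set. -/

section SecondMoment

variable {F : Type*} [Field F] {n P : ℕ}

theorem isolate_comm (i j : Fin n) (g : Sym2 (Fin n) → Bool) :
    isolate i (isolate j g) = isolate j (isolate i g) := by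
  ext z
  by_cases h : i ∈ z <;> by_cases h' : j ∈ z <;> simp [isolate, h, h']

theorem nbrs_isolate {i j : Fin n} (h : i ≠ j) (g : Sym2 (Fin n) → Bool) :
    nbrs j (isolate i g) = (nbrs j g).erase i := by
  ext k
  simp only [nbrs, Finset.mem_erase, mem_star, isolate, Sym2.mem_iff, h, false_or]
  by_cases hk : i = k
  · simp [hk]
  · simp [hk, Ne.symm hk]

theorem nbrs_subset_star (i : Fin n) (g : Sym2 (Fin n) → Bool) : nbrs i g ⊆ star i g :=
  Finset.erase_subset _ _

theorem nbrs_isolate_subset (i j : Fin n) (g : Sym2 (Fin n) → Bool) :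
    nbrs j (isolate i g) ⊆ star j g := by
  intro k hk
  rw [nbrs, Finset.mem_erase, mem_star, isolate] at hk
  rw [mem_star]
  by_cases h : i ∈ s(j, k)
  · simp [h] at hk
  · simpa [h] using hk.2

/-- The edges at a vertex are independent of the rest of the graph. -/
theorem wE_isolate_star {p : ℝ} (h0 : 0 ≤ p) (h1 : p ≤ 1) (i : Fin n)
    (f : (Sym2 (Fin n) → Bool) → Finset (Fin n) → ℝ) :
    wE (bw (Sym2 (Fin n)) p) (fun g => f (isolate i g) (star i g)) =
      wE (bw (Sym2 (Fin n)) p) fun g => wE (bw (Sym2 (Fin n)) p) fun g' =>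
        f (isolate i g) (star i g') := by
  -- Resample exactly the pairs containing `i`: `isolate i` ignores them and `star i` sees nothing
  -- else.
  rw [wE_bw_resample (Finset.univ.filter fun z => i ∈ z) h0 h1]
  congr 1
  ext g
  congr 1
  ext g'
  congr 1
  · ext z
    by_cases h : i ∈ z <;> simp [isolate, h, Finset.piecewise]
  · ext k
    simp [mem_star, Finset.piecewise]

theorem wE_erase_subset {p : ℝ} (i : Fin n) (S : Finset (Fin n)) :
    wE (bw (Sym2 (Fin n)) p) (fun g => if (star i g).erase i ⊆ S then 1 else 0) =
      (1 - p) ^ (Finset.univ.erase i \ S).card := by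
  have h := wE_bw_forall p false ((Finset.univ.erase i \ S).image fun k => s(i, k))
  rw [Finset.card_image_of_injective _ (pair_injective i), if_neg (by simp)] at h
  rw [← h]
  congr 1
  ext g
  congr 1
  simp only [Finset.subset_iff, Finset.mem_erase, mem_star, Finset.forall_mem_image,
    Finset.mem_sdiff, Finset.mem_univ, and_true, eq_iff_iff]
  refine forall_congr' fun k => ?_
  cases g s(i, k) <;> simp

variable (S : Pert n P → (Sym2 (Fin n) → Bool) → Finset (Fin n)) (p : ℝ)

/-- The indicator that all neighbours of `i` lie in the set of the graph without `i`. -/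
noncomputable def nbrInd (θ : Pert n P) (i : Fin n) (g : Sym2 (Fin n) → Bool) : ℝ :=
  if nbrs i g ⊆ S θ (isolate i g) then 1 else 0

/-- The conditional expectation of `nbrInd` given the graph without `i`. -/
noncomputable def nbrProb (θ : Pert n P) (i : Fin n) (g : Sym2 (Fin n) → Bool) : ℝ :=
  (1 - p) ^ (Finset.univ.erase i \ S θ (isolate i g)).card

/-- Given the graph without `i`, the difference is centred, hence orthogonal to every function of
that graph. -/
theorem wE_nbrInd_sub_nbrProb_mul (h0 : 0 ≤ p) (h1 : p ≤ 1) (θ : Pert n P) (i : Fin n)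
    (X : (Sym2 (Fin n) → Bool) → ℝ) :
    wE (bw (Sym2 (Fin n)) p) (fun g => (nbrInd S θ i g - nbrProb S p θ i g) * X (isolate i g)) =
      0 := by
  have := wE_isolate_star h0 h1 i fun g U => ((if U.erase i ⊆ S θ g then 1 else 0) -
    (1 - p) ^ (Finset.univ.erase i \ S θ g).card) * X g
  refine this.trans ?_
  have h2 : ∀ g, (wE (bw (Sym2 (Fin n)) p) fun g' =>
      ((if (star i g').erase i ⊆ S θ (isolate i g) then (1 : ℝ) else 0) -
      (1 - p) ^ (Finset.univ.erase i \ S θ (isolate i g)).card) * X (isolate i g)) = 0 := by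
    intro g
    simp only [mul_comm _ (X (isolate i g))]
    rw [wE_mul_left, wE_sub, wE_erase_subset, (isProb_bw h0 h1).const, sub_self, mul_zero]
  simp only [h2]
  exact (isProb_bw h0 h1).const 0

theorem abs_pow_sub_pow_le_mul {q : ℝ} (h0 : 0 ≤ q) (h1 : q ≤ 1) (a b : ℕ) :
    |q ^ a - q ^ b| ≤ (1 - q) * |(a : ℝ) - b| := by
  wlog h : a ≤ b generalizing a b
  · rw [abs_sub_comm, abs_sub_comm (a : ℝ)]
    exact this b a (le_of_not_ge h)
  obtain ⟨k, rfl⟩ := Nat.exists_eq_add_of_le h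
  have h2 : q ^ a - q ^ (a + k) = q ^ a * (1 - q ^ k) := by ring
  have h3 : 1 - q ^ k ≤ (1 - q) * k := by
    have := one_add_mul_le_pow (a := q - 1) (by linarith) k
    rw [add_sub_cancel] at this
    linarith
  have h4 : (0 : ℝ) ≤ 1 - q ^ k := sub_nonneg.2 (pow_le_one₀ h0 h1)
  rw [h2, abs_of_nonneg (mul_nonneg (pow_nonneg h0 _) h4)]
  push_cast
  rw [sub_add_cancel_left, abs_neg, Nat.abs_cast]
  exact (mul_le_of_le_one_left h4 (pow_le_one₀ h0 h1)).trans h3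

theorem abs_card_sub_card_le {ι : Type*} [DecidableEq ι] (s s' T : Finset ι) :
    |((T \ s).card : ℝ) - (T \ s').card| ≤ (symmDiff s s').card := by
  have key : ∀ s s' : Finset ι, (T \ s).card ≤ (T \ s').card + (symmDiff s s').card := by
    intro s s'
    refine (Finset.card_le_card fun x hx => ?_).trans (Finset.card_union_le _ _)
    simp only [Finset.mem_union, Finset.mem_sdiff, Finset.mem_symmDiff] at hx ⊢
    tauto
  have h1 : ((T \ s).card : ℝ) ≤ (T \ s').card + (symmDiff s s').card := by
    exact_mod_cast key s s'
  have h2 : ((T \ s').card : ℝ) ≤ (T \ s).card + (symmDiff s s').card := by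
    rw [symmDiff_comm]
    exact_mod_cast key s' s
  rw [abs_le]
  constructor <;> linarith

theorem abs_nbrProb_sub_le (h0 : 0 ≤ p) (h1 : p ≤ 1) (θ : Pert n P) (i j : Fin n)
    (g : Sym2 (Fin n) → Bool) :
    |nbrProb S p θ j g - nbrProb S p θ j (isolate i g)| ≤
      p * (symmDiff (S θ (isolate j g)) (S θ (isolate i (isolate j g)))).card := by
  refine (abs_pow_sub_pow_le_mul (by linarith) (by linarith) _ _).trans ?_
  rw [sub_sub_cancel, isolate_comm j i]
  exact mul_le_mul_of_nonneg_left (abs_card_sub_card_le _ _ _) h0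

/-- Isolating `i` changes the indicator at `j` only if `i` is adjacent to `j` or some neighbour of
`j` enters or leaves the set. -/
theorem abs_nbrInd_sub_le (θ : Pert n P) {i j : Fin n} (hij : i ≠ j) (g : Sym2 (Fin n) → Bool) :
    |nbrInd S θ j g - nbrInd S θ j (isolate i g)| ≤
      (if i ∈ star j g then 1 else 0) +
        (star j g ∩ symmDiff (S θ (isolate j g)) (S θ (isolate i (isolate j g)))).card := by
  rw [nbrInd, nbrInd, nbrs_isolate hij, isolate_comm j i]
  set D := symmDiff (S θ (isolate j g)) (S θ (isolate i (isolate j g))) with hD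
  by_cases hi : i ∈ star j g
  · rw [if_pos hi]
    have : (0 : ℝ) ≤ ((star j g ∩ D).card : ℝ) := by positivity
    refine le_add_of_le_of_nonneg ?_ this
    split_ifs <;> norm_num
  · rw [if_neg hi, zero_add, Finset.erase_eq_of_notMem fun h => hi (nbrs_subset_star _ _ h)]
    by_cases he : star j g ∩ D = ∅
    · have : nbrs j g ⊆ S θ (isolate j g) ↔ nbrs j g ⊆ S θ (isolate i (isolate j g)) := by
        refine forall_congr' fun k => imp_congr_right fun hk => ?_
        have hk' : k ∉ D := fun h =>
          Finset.notMem_empty k (he ▸ Finset.mem_inter.2 ⟨nbrs_subset_star _ _ hk, h⟩)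
        rw [hD, Finset.mem_symmDiff] at hk'
        tauto
      simp [this, he]
    · have : (1 : ℝ) ≤ ((star j g ∩ D).card : ℝ) := by
        exact_mod_cast Finset.card_pos.2 (Finset.nonempty_iff_ne_empty.2 he)
      refine le_trans ?_ this
      split_ifs <;> norm_num

variable {S p} {K : Fin n → Fin n → F} {d : ℝ}

/-- Stability holds for every `U` containing the neighbourhood, and `star i g` is a choice
independent of the isolated graph. The influence bound then applies with that graph held fixed. -/
theorem Stable.wE_symmDiff_le [NeZero n] [NeZero P] (hS : Stable K S) (h0 : 0 ≤ p) (h1 : p ≤ 1)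
    (hd : n * p ≤ d) (i : Fin n) :
    wE (unif (Pert n P)) (fun θ => wE (bw (Sym2 (Fin n)) p) fun g =>
      ((symmDiff (S θ g) (S θ (isolate i g))).card : ℝ)) ≤ n * rate d n P := by
  have e1 : ∀ θ g, ((symmDiff (S θ g) (S θ (isolate i g))).card : ℝ) ≤
      influence (graphMat K (isolate i g)) θ i (star i g) := fun θ g =>
    hS θ g i _ (nbrs_subset_star i g)
  refine (isProb_unif.mono fun θ => (isProb_bw h0 h1).mono (e1 θ)).trans ?_
  have e2 : ∀ θ : Pert n P, _ := fun θ => wE_isolate_star h0 h1 i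
    fun g U => influence (graphMat K g) θ i U
  simp only [e2]
  rw [wE_comm]
  exact (isProb_bw h0 h1).le_const fun g => wE_influence_le h0 h1 hd i _

theorem Stable.wE_symmDiff_isolate_le [NeZero n] [NeZero P] (hS : Stable K S) (h0 : 0 ≤ p)
    (h1 : p ≤ 1) (hd : n * p ≤ d) (i j : Fin n) :
    wE (unif (Pert n P)) (fun θ => wE (bw (Sym2 (Fin n)) p) fun g =>
      ((symmDiff (S θ (isolate j g)) (S θ (isolate i (isolate j g)))).card : ℝ)) ≤
      n * rate d n P := by
  have e1 : ∀ θ g, ((symmDiff (S θ (isolate j g)) (S θ (isolate i (isolate j g)))).card : ℝ) ≤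
      influence (graphMat K (isolate j (isolate i g))) θ i (star i g) := fun θ g => by
    rw [isolate_comm j i]
    exact hS θ _ i _ (nbrs_isolate_subset j i g)
  refine (isProb_unif.mono fun θ => (isProb_bw h0 h1).mono (e1 θ)).trans ?_
  have e2 : ∀ θ : Pert n P, _ := fun θ => wE_isolate_star h0 h1 i
    fun g U => influence (graphMat K (isolate j g)) θ i U
  simp only [e2]
  rw [wE_comm]
  exact (isProb_bw h0 h1).le_const fun g => wE_influence_le h0 h1 hd i _

theorem abs_nbrInd_sub_nbrProb_le (h0 : 0 ≤ p) (h1 : p ≤ 1) (θ : Pert n P) (i : Fin n)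
    (g : Sym2 (Fin n) → Bool) : |nbrInd S θ i g - nbrProb S p θ i g| ≤ 1 := by
  have h2 : 0 ≤ nbrProb S p θ i g := pow_nonneg (by linarith) _
  have h3 : nbrProb S p θ i g ≤ 1 := pow_le_one₀ (by linarith) (by linarith)
  have h4 : 0 ≤ nbrInd S θ i g ∧ nbrInd S θ i g ≤ 1 := by
    unfold nbrInd
    split_ifs <;> norm_num
  rw [abs_le]
  constructor <;> linarith

/-- The factor of `j` is replaced by its version without `i`, which is orthogonal to the centred
factor of `i`. Three errors remain: `p` for an edge between `i` and `j`, and `p` times the size of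
the changed set once for the indicator and once for the conditional probability. -/
theorem Stable.wE_mul_le [NeZero n] [NeZero P] (hS : Stable K S) (h0 : 0 ≤ p)
    (h1 : p ≤ 1) (hd : n * p ≤ d) {i j : Fin n} (hij : i ≠ j) :
    wE (unif (Pert n P)) (fun θ => wE (bw (Sym2 (Fin n)) p) fun g =>
      (nbrInd S θ i g - nbrProb S p θ i g) * (nbrInd S θ j g - nbrProb S p θ j g)) ≤
      p + 2 * p * (n * rate d n P) := by
  set D : Pert n P → (Sym2 (Fin n) → Bool) → Finset (Fin n) := fun θ g =>
    symmDiff (S θ g) (S θ (isolate i g)) with hD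
  have e1 : ∀ θ : Pert n P, (wE (bw (Sym2 (Fin n)) p) fun g =>
      (nbrInd S θ i g - nbrProb S p θ i g) * (nbrInd S θ j g - nbrProb S p θ j g)) ≤
      p + 2 * p * wE (bw (Sym2 (Fin n)) p) fun g => ((D θ (isolate j g)).card : ℝ) := by
    intro θ
    have z := wE_nbrInd_sub_nbrProb_mul S p h0 h1 θ i
      fun g => nbrInd S θ j g - nbrProb S p θ j g
    have e2 : ∀ g, (nbrInd S θ i g - nbrProb S p θ i g) * (nbrInd S θ j g - nbrProb S p θ j g) ≤
        (nbrInd S θ i g - nbrProb S p θ i g) *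
          (nbrInd S θ j (isolate i g) - nbrProb S p θ j (isolate i g)) +
        ((if i ∈ star j g then 1 else 0) + (star j g ∩ D θ (isolate j g)).card +
          p * (D θ (isolate j g)).card) := by
      intro g
      have a1 := abs_nbrProb_sub_le S p h0 h1 θ i j g
      have a2 := abs_nbrInd_sub_le S θ hij g
      have a3 := abs_nbrInd_sub_nbrProb_le (S := S) h0 h1 θ i g
      rw [← sub_le_iff_le_add', ← mul_sub]
      refine (le_abs_self _).trans ?_
      rw [abs_mul]
      refine (mul_le_of_le_one_left (abs_nonneg _) a3).trans ?_
      rw [sub_sub_sub_comm]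
      exact (abs_sub _ _).trans (add_le_add a2 a1)
    refine ((isProb_bw h0 h1).mono e2).trans ?_
    simp only [wE_add, wE_mul_left]
    -- The changed set is evaluated at `isolate j g`, so it is independent of `star j g`, which
    -- meets it in a proportion `p` on average.
    have e3 := wE_isolate_star h0 h1 j fun g U => ((U ∩ D θ g).card : ℝ)
    simp only [wE_card_star_inter h0 h1, wE_mul_left] at e3
    rw [z, e3, wE_mem_star h0 h1]
    linarith
  refine (isProb_unif.mono e1).trans ?_
  rw [wE_add, isProb_unif.const, wE_mul_left]
  have := hS.wE_symmDiff_isolate_le (P := P) h0 h1 hd i j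
  have := mul_le_mul_of_nonneg_left this (show 0 ≤ 2 * p by positivity)
  linarith

theorem rate_nonneg (hd : 0 ≤ d) (n P : ℕ) : 0 ≤ rate d n P := by
  unfold rate
  positivity

theorem Stable.wE_abs_avg_le [NeZero n] [NeZero P] (hS : Stable K S) (h0 : 0 ≤ p)
    (h1 : p ≤ 1) (hd : n * p ≤ d) :
    wE (unif (Pert n P)) (fun θ => wE (bw (Sym2 (Fin n)) p) fun g =>
      |(∑ i, (nbrInd S θ i g - nbrProb S p θ i g)) / n|) ≤
      √((1 + d) / n + 2 * d * rate d n P) := by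
  have hn : (0 : ℝ) < n := by exact_mod_cast Nat.pos_of_ne_zero (NeZero.ne n)
  have hd0 : 0 ≤ d := le_trans (by positivity) hd
  set w : Pert n P × (Sym2 (Fin n) → Bool) → ℝ := fun x =>
    unif (Pert n P) x.1 * bw (Sym2 (Fin n)) p x.2 with hw
  have hE : ∀ f : Pert n P → (Sym2 (Fin n) → Bool) → ℝ,
      wE (unif (Pert n P)) (fun θ => wE (bw (Sym2 (Fin n)) p) (f θ)) =
        wE w fun x => f x.1 x.2 := by
    intro f
    simp only [wE, hw, Fintype.sum_prod_type, Finset.mul_sum, mul_assoc]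
  have hprob : IsProb w := by
    refine ⟨fun x => mul_nonneg (isProb_unif.nonneg _) ((isProb_bw h0 h1).nonneg _), ?_⟩
    have := hE fun _ _ => 1
    simp only [(isProb_bw h0 h1).const, isProb_unif.const] at this
    simpa [wE] using this.symm
  rw [hE fun θ g => |(∑ i, (nbrInd S θ i g - nbrProb S p θ i g)) / n|]
  refine hprob.wE_abs_le_sqrt (fun x => (∑ i, (nbrInd S x.1 i x.2 - nbrProb S p x.1 i x.2)) / n)
    (by have := rate_nonneg hd0 n P; positivity) ?_
  rw [← hE fun θ g => ((∑ i, (nbrInd S θ i g - nbrProb S p θ i g)) / n) ^ 2]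
  have e1 : ∀ θ g, ((∑ i, (nbrInd S θ i g - nbrProb S p θ i g)) / n) ^ 2 = (1 / (n : ℝ) ^ 2) *
      ∑ i, ∑ j, (nbrInd S θ i g - nbrProb S p θ i g) * (nbrInd S θ j g - nbrProb S p θ j g) := by
    intro θ g
    rw [div_pow, sq (∑ i, (nbrInd S θ i g - nbrProb S p θ i g)), Finset.sum_mul_sum]
    ring
  simp only [e1, wE_mul_left, wE_sum]
  -- Each diagonal pair costs at most 1, which contributes `1 / n` after division by `n ^ 2`.
  have e2 : ∀ i j : Fin n, wE (unif (Pert n P)) (fun θ => wE (bw (Sym2 (Fin n)) p) fun g =>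
      (nbrInd S θ i g - nbrProb S p θ i g) * (nbrInd S θ j g - nbrProb S p θ j g)) ≤
      (if i = j then 1 else 0) + (p + 2 * p * (n * rate d n P)) := by
    intro i j
    have hr := rate_nonneg hd0 n P
    split_ifs with hij
    · have : wE (unif (Pert n P)) (fun θ => wE (bw (Sym2 (Fin n)) p) fun g =>
        (nbrInd S θ i g - nbrProb S p θ i g) * (nbrInd S θ j g - nbrProb S p θ j g)) ≤ 1 := by
        refine isProb_unif.le_const fun θ => (isProb_bw h0 h1).le_const fun g => ?_
        refine (le_abs_self _).trans ?_
        rw [abs_mul]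
        exact mul_le_one₀ (abs_nbrInd_sub_nbrProb_le h0 h1 θ i g) (abs_nonneg _)
          (abs_nbrInd_sub_nbrProb_le h0 h1 θ j g)
      have : 0 ≤ p + 2 * p * (n * rate d n P) := by positivity
      linarith
    · rw [zero_add]
      exact hS.wE_mul_le h0 h1 hd hij
  have e3 := Finset.sum_le_sum fun i (_ : i ∈ Finset.univ) =>
    Finset.sum_le_sum fun j (_ : j ∈ Finset.univ) => e2 i j
  simp only [Finset.sum_add_distrib, Finset.sum_ite_eq, Finset.mem_univ, if_true, Finset.sum_const,
    Finset.card_univ, Fintype.card_fin, nsmul_eq_mul, mul_one] at e3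
  have e4 := mul_le_mul_of_nonneg_left e3 (show 0 ≤ 1 / (n : ℝ) ^ 2 by positivity)
  refine e4.trans ?_
  have hr := rate_nonneg hd0 n P
  have e6 : 1 / (n : ℝ) ^ 2 * (n + (n * (n * p) + n * (n * (2 * p * (n * rate d n P))))) =
      (1 + n * p) / n + 2 * (n * p) * rate d n P := by
    field_simp
    ring
  have e7 : (1 + n * p) / n + 2 * (n * p) * rate d n P ≤ (1 + d) / n + 2 * d * rate d n P := by
    gcongr
  exact e6.trans_le e7

/-- With `m = n - |S|` the target equals `exp (-p) ^ m`. Omitting `i` and isolating it change the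
exponent, at cost `p` per unit; replacing `1 - p` by `exp (-p)` costs at most `p ^ 2` in each of at
most `n` factors. -/
theorem abs_nbrProb_sub_phi_le [NeZero n] (h0 : 0 ≤ p) (h1 : p ≤ 1) (θ : Pert n P) (i : Fin n)
    (g : Sym2 (Fin n) → Bool) :
    |nbrProb S p θ i g - phi (n * p) ((S θ g).card / n)| ≤
      p * (1 + (symmDiff (S θ g) (S θ (isolate i g))).card) + n * p ^ 2 := by
  have hn : (0 : ℝ) < n := by exact_mod_cast Nat.pos_of_ne_zero (NeZero.ne n)
  set m : ℕ := (Finset.univ \ S θ g).card with hm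
  have hmn : (m : ℝ) = n - (S θ g).card := by
    rw [hm, Finset.card_sdiff_of_subset (Finset.subset_univ _), Finset.card_univ, Nat.cast_sub
      (Finset.card_le_univ _)]
    simp
  have hphi : phi (n * p) ((S θ g).card / n) = Real.exp (-p) ^ m := by
    rw [phi, ← Real.exp_nat_mul, hmn]
    congr 1
    field_simp
    ring
  have a1 : |nbrProb S p θ i g - (1 - p) ^ m| ≤
      p * (1 + (symmDiff (S θ g) (S θ (isolate i g))).card) := by
    refine (abs_pow_sub_pow_le_mul (by linarith) (by linarith) _ _).trans ?_
    rw [sub_sub_cancel]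
    refine mul_le_mul_of_nonneg_left ?_ h0
    have b1 := abs_card_sub_card_le (S θ (isolate i g)) (S θ g) Finset.univ
    rw [symmDiff_comm] at b1
    have b2 : ((Finset.univ.erase i \ S θ (isolate i g)).card : ℝ) ≤
        (Finset.univ \ S θ (isolate i g)).card :=
      Nat.cast_le.2 (Finset.card_le_card (Finset.sdiff_subset_sdiff (Finset.erase_subset _ _)
        le_rfl))
    have b3 : ((Finset.univ \ S θ (isolate i g)).card : ℝ) ≤
        (Finset.univ.erase i \ S θ (isolate i g)).card + 1 := by
      rw [Finset.erase_sdiff_comm]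
      have := Finset.pred_card_le_card_erase (s := Finset.univ \ S θ (isolate i g)) (a := i)
      exact_mod_cast Nat.sub_le_iff_le_add.1 this
    rw [abs_le] at b1 ⊢
    constructor <;> linarith
  have a2 : |(1 - p) ^ m - Real.exp (-p) ^ m| ≤ n * p ^ 2 := by
    have c0 : 0 < Real.exp (-p) := Real.exp_pos _
    have c1 : Real.exp (-p) ≤ 1 := Real.exp_le_one_iff.2 (by linarith)
    refine (abs_pow_sub_pow_le _ _ _).trans ?_
    have c2 : |1 - p - Real.exp (-p)| ≤ p ^ 2 := by
      have := Real.abs_exp_sub_one_sub_id_le (x := -p) (by rw [abs_neg, abs_of_nonneg h0]; exact h1)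
      rw [neg_sq] at this
      rw [abs_sub_comm]
      convert this using 2
      ring
    have c3 : max |1 - p| |Real.exp (-p)| ^ (m - 1) ≤ 1 := by
      refine pow_le_one₀ (le_max_of_le_left (abs_nonneg _)) (max_le ?_ ?_)
      · rw [abs_of_nonneg (by linarith)]; linarith
      · rw [abs_of_pos c0]; exact c1
    have c4 : (m : ℝ) ≤ n := by
      rw [hmn]
      have : (0 : ℝ) ≤ (S θ g).card := by positivity
      linarith
    calc _ ≤ p ^ 2 * n * 1 := by gcongr
      _ = _ := by ring
  rw [hphi]
  calc _ ≤ |nbrProb S p θ i g - (1 - p) ^ m| + |(1 - p) ^ m - Real.exp (-p) ^ m| :=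
        abs_sub_le _ _ _
    _ ≤ _ := add_le_add a1 a2

/-- The error in the concentration of the number of vertices all of whose neighbours lie in a
stable set. -/
noncomputable def concRate (d : ℝ) (n P : ℕ) : ℝ :=
  √((1 + d) / n + 2 * d * rate d n P) + ((d + d ^ 2) / n + d * rate d n P)

/-- The proportion of vertices all of whose neighbours lie in a stable set concentrates. -/
theorem Stable.wE_abs_sub_phi_le [NeZero n] [NeZero P] (hS : Stable K S) (h0 : 0 ≤ p)
    (h1 : p ≤ 1) (hd : n * p ≤ d) :
    wE (unif (Pert n P)) (fun θ => wE (bw (Sym2 (Fin n)) p) fun g =>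
      |(∑ i, nbrInd S θ i g) / n - phi (n * p) ((S θ g).card / n)|) ≤ concRate d n P := by
  have hn : (0 : ℝ) < n := by exact_mod_cast Nat.pos_of_ne_zero (NeZero.ne n)
  have hd0 : 0 ≤ d := le_trans (by positivity) hd
  have e1 : ∀ θ g, |(∑ i, nbrInd S θ i g) / n - phi (n * p) ((S θ g).card / n)| ≤
      |(∑ i, (nbrInd S θ i g - nbrProb S p θ i g)) / n| +
      (1 / n) * ∑ i, (p * (1 + (symmDiff (S θ g) (S θ (isolate i g))).card) + n * p ^ 2) := by
    intro θ g
    have a1 : (∑ i, nbrInd S θ i g) / n - phi (n * p) ((S θ g).card / n) =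
        (∑ i, (nbrInd S θ i g - nbrProb S p θ i g)) / n +
        (1 / n) * ∑ i, (nbrProb S p θ i g - phi (n * p) ((S θ g).card / n)) := by
      rw [Finset.sum_sub_distrib, Finset.sum_sub_distrib, Finset.sum_const, Finset.card_univ,
        Fintype.card_fin, nsmul_eq_mul]
      field_simp
      ring
    rw [a1]
    refine (abs_add_le _ _).trans (add_le_add le_rfl ?_)
    rw [abs_mul, abs_of_pos (by positivity : 0 < 1 / (n : ℝ))]
    refine mul_le_mul_of_nonneg_left ?_ (by positivity)
    exact (Finset.abs_sum_le_sum_abs _ _).trans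
      (Finset.sum_le_sum fun i _ => abs_nbrProb_sub_phi_le h0 h1 θ i g)
  refine (isProb_unif.mono fun θ => (isProb_bw h0 h1).mono (e1 θ)).trans ?_
  simp only [wE_add, wE_mul_left, wE_sum, (isProb_bw h0 h1).const]
  rw [concRate]
  refine add_le_add (hS.wE_abs_avg_le h0 h1 hd) ?_
  simp only [isProb_unif.const]
  have e2 : ∑ i : Fin n, (p * (1 + wE (unif (Pert n P)) fun θ => wE (bw (Sym2 (Fin n)) p) fun g =>
      ((symmDiff (S θ g) (S θ (isolate i g))).card : ℝ)) + n * p ^ 2) ≤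
      ∑ _i : Fin n, (p * (1 + n * rate d n P) + n * p ^ 2) :=
    Finset.sum_le_sum fun i _ => add_le_add (mul_le_mul_of_nonneg_left
      (add_le_add le_rfl (hS.wE_symmDiff_le h0 h1 hd i)) h0) le_rfl
  refine (mul_le_mul_of_nonneg_left e2 (by positivity)).trans ?_
  rw [Finset.sum_const, Finset.card_univ, Fintype.card_fin, nsmul_eq_mul]
  have hr := rate_nonneg hd0 n P
  have hnp : 0 ≤ n * p := by positivity
  calc _ = (n * p + (n * p) ^ 2) / n + (n * p) * rate d n P := by field_simp; ring
    _ ≤ _ := by gcongr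

end SecondMoment

/-! ### From types to frozen sets, and the balance equations for a fixed permutation. -/

section TypeCounts

variable {F : Type*} [Field F] {n P : ℕ}

/-- The proportion of the labels of type `W`. -/
noncomputable def typeProp {α β : Type*} [Fintype α] [Fintype β] [DecidableEq α] [DecidableEq β]
    (W : VarType) (M : Matrix (Fin n ⊕ α) (Fin n ⊕ β) F) : ℝ :=
  (Set.ncard {i : Fin n | HasType M (Sum.inl i) (Sum.inl i) W} : ℝ) / n

section

variable {α β : Type*} [Fintype α] [Fintype β] [DecidableEq α] [DecidableEq β]
  (M : Matrix (Fin n ⊕ α) (Fin n ⊕ β) F)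

/-- A frailly frozen label is frozen on both sides, and a firmly frozen label whose row is frozen is
completely frozen. This splits the labels frozen on both sides into types X and Y. -/
theorem hasType_X_iff (i : Fin n) : HasType M (Sum.inl i) (Sum.inl i) .X ↔
    i ∈ (frozenSet M ∩ frozenSet M.transpose) \ completeSet M := by
  rw [Finset.mem_sdiff, Finset.mem_inter, mem_frozenSet, mem_frozenSet, mem_completeSet]
  constructor
  · intro h
    exact ⟨⟨h.1, h.frozen_transpose⟩, fun hc => h.2 hc.1⟩
  · rintro ⟨⟨h1, h2⟩, h3⟩
    exact ⟨h1, fun h => h3 ⟨h, firmlyFrozen_transpose h h2⟩⟩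

theorem hasType_Y_iff (i : Fin n) : HasType M (Sum.inl i) (Sum.inl i) .Y ↔ i ∈ completeSet M :=
  mem_completeSet.symm

theorem firmlyFrozen_of_frozen {r : Fin n ⊕ α} {c : Fin n ⊕ β} (h : c ∈ frozen M)
    (hr : r ∉ frozen M.transpose) : FirmlyFrozen M r c := by
  by_contra h1
  exact hr (FraillyFrozen.frozen_transpose ⟨h, h1⟩)

theorem hasType_V_iff (i : Fin n) : HasType M (Sum.inl i) (Sum.inl i) .V ↔
    i ∈ frozenSet M \ frozenSet M.transpose := by
  rw [Finset.mem_sdiff, mem_frozenSet, mem_frozenSet]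
  exact ⟨fun h => ⟨h.1.frozen, h.2⟩, fun h => ⟨firmlyFrozen_of_frozen M h.1 h.2, h.2⟩⟩

theorem hasType_U_iff (i : Fin n) : HasType M (Sum.inl i) (Sum.inl i) .U ↔
    i ∈ frozenSet M.transpose \ frozenSet M := by
  rw [Finset.mem_sdiff, mem_frozenSet, mem_frozenSet]
  exact ⟨fun h => ⟨h.2.frozen, h.1⟩,
    fun h => ⟨h.2, firmlyFrozen_of_frozen M.transpose h.1 (by simpa using h.2)⟩⟩

theorem hasType_Z_iff (i : Fin n) : HasType M (Sum.inl i) (Sum.inl i) .Z ↔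
    i ∈ Finset.univ \ (frozenSet M ∪ frozenSet M.transpose) := by
  rw [Finset.mem_sdiff, Finset.mem_union, mem_frozenSet, mem_frozenSet, not_or]
  exact ⟨fun h => ⟨Finset.mem_univ i, h⟩, fun h => h.2⟩

variable {M} in
theorem typeProp_eq {W : VarType} {s : Finset (Fin n)}
    (h : ∀ i, HasType M (Sum.inl i) (Sum.inl i) W ↔ i ∈ s) : typeProp W M = s.card / n := by
  rw [typeProp]
  congr 2
  rw [← Set.ncard_coe_finset]
  congr 1
  ext i
  exact h i

theorem completeSet_subset : completeSet M ⊆ frozenSet M ∩ frozenSet M.transpose := by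
  intro i hi
  rw [mem_completeSet] at hi
  exact Finset.mem_inter.2 ⟨mem_frozenSet.2 hi.1.frozen, mem_frozenSet.2 hi.2.frozen⟩

theorem typeProp_XY : typeProp .X M + typeProp .Y M =
    (frozenSet M ∩ frozenSet M.transpose).card / n := by
  rw [typeProp_eq (hasType_X_iff M), typeProp_eq (hasType_Y_iff M), ← add_div]
  congr 1
  exact_mod_cast Finset.card_sdiff_add_card_eq_card (completeSet_subset M)

theorem typeProp_XYU : typeProp .X M + typeProp .Y M + typeProp .U M =
    (frozenSet M.transpose).card / n := by
  rw [typeProp_XY, typeProp_eq (hasType_U_iff M), ← add_div, Finset.inter_comm]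
  congr 1
  exact_mod_cast Finset.card_inter_add_card_sdiff _ _

theorem typeProp_XYV : typeProp .X M + typeProp .Y M + typeProp .V M = (frozenSet M).card / n := by
  rw [typeProp_XY, typeProp_eq (hasType_V_iff M), ← add_div]
  congr 1
  exact_mod_cast Finset.card_inter_add_card_sdiff _ _

end

variable (K : Fin n → Fin n → F)

/-- The frozen labels as a function of the perturbation and the graph. -/
noncomputable def colSet (θ : Pert n P) (g : Sym2 (Fin n) → Bool) : Finset (Fin n) :=
  frozenSet (pert (graphMat K g) θ)

/-- The labels frozen in the transpose as a function of the perturbation and the graph. -/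
noncomputable def rowSet (θ : Pert n P) (g : Sym2 (Fin n) → Bool) : Finset (Fin n) :=
  frozenSet (pert (graphMat K g) θ).transpose

/-- The labels frozen on both sides as a function of the perturbation and the graph. -/
noncomputable def bothSet (θ : Pert n P) (g : Sym2 (Fin n) → Bool) : Finset (Fin n) :=
  colSet K θ g ∩ rowSet K θ g

/-- The completely frozen labels as a function of the perturbation and the graph. -/
noncomputable def fullSet (θ : Pert n P) (g : Sym2 (Fin n) → Bool) : Finset (Fin n) :=
  completeSet (pert (graphMat K g) θ)

/-- The indicator of `i ∈ s`. -/
def ind {ι : Type*} [DecidableEq ι] (s : Finset ι) (i : ι) : ℝ := if i ∈ s then 1 else 0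

theorem sum_ind {ι : Type*} [DecidableEq ι] [Fintype ι] (s : Finset ι) :
    ∑ i, ind s i = s.card := by
  simp [ind]

theorem nbrInd_bothSet (θ : Pert n P) (i : Fin n) (g : Sym2 (Fin n) → Bool) :
    nbrInd (bothSet K) θ i g = nbrInd (colSet K) θ i g * nbrInd (rowSet K) θ i g := by
  simp only [nbrInd, bothSet, Finset.subset_inter_iff]
  by_cases h1 : nbrs i g ⊆ colSet K θ (isolate i g) <;>
    by_cases h2 : nbrs i g ⊆ rowSet K θ (isolate i g) <;> simp [h1, h2]

variable {K}

theorem transpose_ne_zero (hK : ∀ i j, K i j ≠ 0) (g : Sym2 (Fin n) → Bool) (i k : Fin n) :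
    graphMat K g k i ≠ 0 ↔ k ∈ nbrs i g := by
  have := graphMat_ne_zero (K := fun i j => K j i) (fun i j => hK j i) g i k
  rwa [← graphMat_transpose] at this

/-- Divided by `n`, the influence dominates the indicator of the exceptional event, so its mean also
bounds the exceptional probability. -/
theorem one_le_influence_div [NeZero n] {θ : Pert n P} {i : Fin n} {g : Sym2 (Fin n) → Bool}
    (h : θ.Hits i ∨ dependent (rowSpace (pert (graphMat K (isolate i g)) θ)) (nbrs i g) ≠ ∅ ∨
      dependent (rowSpace (pert (graphMat K (isolate i g)) θ).transpose) (nbrs i g) ≠ ∅) :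
    1 ≤ influence (graphMat K (isolate i g)) θ i (star i g) / n := by
  have hn : (0 : ℝ) < n := by exact_mod_cast Nat.pos_of_ne_zero (NeZero.ne n)
  rw [le_div_iff₀ hn, one_mul]
  set B := pert (graphMat K (isolate i g)) θ with hB
  have e0 : side (pert (graphMat K (isolate i g)).transpose θ.swap) (star i g) =
      side B.transpose (star i g) := by
    rw [hB, pert_transpose]
    rfl
  classical
  rw [influence, e0]
  have s1 := side_nonneg B (star i g)
  have s2 := side_nonneg B.transpose (star i g)
  have hcard : ∀ {x : ℕ}, x ≠ 0 → (n : ℝ) ≤ n * x := fun {x} hx =>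
    le_mul_of_one_le_right hn.le (by exact_mod_cast Nat.one_le_iff_ne_zero.2 hx)
  have s3 : (0 : ℝ) ≤ if θ.Hits i then (n : ℝ) else 0 := by split_ifs <;> positivity
  rcases h with h | h | h
  · rw [if_pos h]
    linarith
  · have a1 := card_influenced_le B (nbrs_subset_star i g)
    rw [Fintype.card_fin] at a1
    have a2 := hcard (mt Finset.card_eq_zero.1 h)
    have a3 : (0 : ℝ) ≤ (influenced B (nbrs i g)).card := by positivity
    linarith
  · have a1 := card_influenced_le B.transpose (nbrs_subset_star i g)
    rw [Fintype.card_fin] at a1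
    have a2 := hcard (mt Finset.card_eq_zero.1 h)
    have a3 : (0 : ℝ) ≤ (influenced B.transpose (nbrs i g)).card := by positivity
    linarith

theorem influence_nonneg (A : Matrix (Fin n) (Fin n) F) (θ : Pert n P) (i : Fin n)
    (U : Finset (Fin n)) : 0 ≤ influence A θ i U := by
  have s1 := side_nonneg (pert A θ) U
  have s2 := side_nonneg (pert A.transpose θ.swap) U
  classical
  unfold influence
  have s3 : (0 : ℝ) ≤ if θ.Hits i then (n : ℝ) else 0 := by split_ifs <;> positivity
  linarith

/-- Membership of a vertex in the frozen sets in terms of its neighbours. -/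
theorem mem_iff_nbrs (hK : ∀ i j, K i j ≠ 0) {θ : Pert n P} {i : Fin n}
    {g : Sym2 (Fin n) → Bool} (hi : ¬ θ.Hits i)
    (h1 : dependent (rowSpace (pert (graphMat K (isolate i g)) θ)) (nbrs i g) = ∅)
    (h2 : dependent (rowSpace (pert (graphMat K (isolate i g)) θ).transpose) (nbrs i g) = ∅) :
    (i ∈ fullSet K θ g ↔ ¬ nbrs i g ⊆ rowSet K θ (isolate i g) ∧
        ¬ nbrs i g ⊆ colSet K θ (isolate i g)) ∧
      (i ∈ rowSet K θ g \ colSet K θ g ↔ nbrs i g ⊆ rowSet K θ (isolate i g) ∧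
        ¬ nbrs i g ⊆ colSet K θ (isolate i g)) ∧
      (i ∈ colSet K θ g \ rowSet K θ g ↔ nbrs i g ⊆ colSet K θ (isolate i g) ∧
        ¬ nbrs i g ⊆ rowSet K θ (isolate i g)) := by
  have hb := border_pert K g hi
  have f1 : FirmlyFrozen (pert (graphMat K g) θ) (Sum.inl i) (Sum.inl i) ↔
      ¬ nbrs i g ⊆ rowSet K θ (isolate i g) := by
    rw [hb.firmlyFrozen_iff, elim_mem_iff (transpose_ne_zero hK g i) h2]
    rfl
  have f2 : FirmlyFrozen (pert (graphMat K g) θ).transpose (Sum.inl i) (Sum.inl i) ↔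
      ¬ nbrs i g ⊆ colSet K θ (isolate i g) := by
    rw [hb.firmlyFrozen_transpose_iff, elim_mem_iff (graphMat_ne_zero hK g i) h1]
    rfl
  refine ⟨?_, ?_, ?_⟩
  · rw [fullSet, mem_completeSet, CompletelyFrozen, f1, f2]
  · rw [rowSet, colSet, ← hasType_U_iff, ← f2, ← not_not (a := nbrs i g ⊆ _), ← f1]
    constructor
    · rintro ⟨a, b⟩
      exact ⟨fun h => a h.frozen, b⟩
    · rintro ⟨a, b⟩
      exact ⟨not_frozen_of_not_firmlyFrozen a b, b⟩
  · rw [rowSet, colSet, ← hasType_V_iff, ← f1, ← not_not (a := nbrs i g ⊆ _), ← f2]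
    constructor
    · rintro ⟨a, b⟩
      exact ⟨fun h => b h.frozen, a⟩
    · rintro ⟨a, b⟩
      exact ⟨b, not_frozen_of_not_firmlyFrozen (A := (pert (graphMat K g) θ).transpose) a
        (by simpa using b)⟩

theorem abs_ind_sub_le [NeZero n] (hK : ∀ i j, K i j ≠ 0) (θ : Pert n P) (i : Fin n)
    (g : Sym2 (Fin n) → Bool) :
    |ind (fullSet K θ g) i - (1 - nbrInd (rowSet K) θ i g - nbrInd (colSet K) θ i g +
        nbrInd (bothSet K) θ i g)| ≤
        influence (graphMat K (isolate i g)) θ i (star i g) / n ∧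
      |ind (rowSet K θ g \ colSet K θ g) i -
        (nbrInd (rowSet K) θ i g - nbrInd (bothSet K) θ i g)| ≤
        influence (graphMat K (isolate i g)) θ i (star i g) / n ∧
      |ind (colSet K θ g \ rowSet K θ g) i -
        (nbrInd (colSet K) θ i g - nbrInd (bothSet K) θ i g)| ≤
        influence (graphMat K (isolate i g)) θ i (star i g) / n := by
  rw [nbrInd_bothSet]
  by_cases hg : θ.Hits i ∨
      dependent (rowSpace (pert (graphMat K (isolate i g)) θ)) (nbrs i g) ≠ ∅ ∨
      dependent (rowSpace (pert (graphMat K (isolate i g)) θ).transpose) (nbrs i g) ≠ ∅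
  · have h1 := one_le_influence_div hg
    simp only [ind, nbrInd]
    -- In the exceptional case every compared quantity is 0 or 1.
    refine ⟨le_trans ?_ h1, le_trans ?_ h1, le_trans ?_ h1⟩ <;> split_ifs <;> norm_num
  · simp only [not_or, not_not] at hg
    obtain ⟨m1, m2, m3⟩ := mem_iff_nbrs hK hg.1 hg.2.1 hg.2.2
    have h1 : 0 ≤ influence (graphMat K (isolate i g)) θ i (star i g) / n :=
      div_nonneg (influence_nonneg _ _ _ _) (Nat.cast_nonneg n)
    simp only [ind, nbrInd, m1, m2, m3]
    by_cases c1 : nbrs i g ⊆ rowSet K θ (isolate i g) <;>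
      by_cases c2 : nbrs i g ⊆ colSet K θ (isolate i g) <;> simp [c1, c2, h1]

/-- The number of interacting pairs of labels in `U`. -/
noncomputable def pairCount (A : Matrix (Fin n) (Fin n) F) (θ : Pert n P)
    (U : Finset (Fin n)) : ℝ :=
  ∑ k, ∑ l ∈ (affected (pert A θ) k).erase k, if k ∈ U then (if l ∈ U then 1 else 0) else 0

theorem pairCount_nonneg (A : Matrix (Fin n) (Fin n) F) (θ : Pert n P) (U : Finset (Fin n)) :
    0 ≤ pairCount A θ U :=
  Finset.sum_nonneg fun k _ => Finset.sum_nonneg fun l _ => by split_ifs <;> norm_num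

/-- Without a hit and without an interacting pair of neighbours, label `i` is not frozen in the
matrix by `Border.not_frozen_of_subset_completeSet`. If it were frozen in the transpose, it would be
firmly frozen there, although the inserted row is a combination of unit vectors in the row space.
The error terms pay for hits and interacting pairs. -/
theorem nbrInd_le [NeZero n] (hK : ∀ i j, K i j ≠ 0) (θ : Pert n P) (i : Fin n)
    (g : Sym2 (Fin n) → Bool) :
    nbrInd (fullSet K) θ i g ≤ ind (Finset.univ \ (colSet K θ g ∪ rowSet K θ g)) i +
      influence (graphMat K (isolate i g)) θ i (star i g) / n +
      pairCount (graphMat K (isolate i g)) θ (star i g) := by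
  have hI : 0 ≤ influence (graphMat K (isolate i g)) θ i (star i g) / n :=
    div_nonneg (influence_nonneg _ _ _ _) (Nat.cast_nonneg n)
  have hp := pairCount_nonneg (graphMat K (isolate i g)) θ (star i g)
  have h0 : 0 ≤ ind (Finset.univ \ (colSet K θ g ∪ rowSet K θ g)) i := by
    unfold ind
    split_ifs <;> norm_num
  rw [nbrInd]
  split_ifs with hN
  swap
  · positivity
  by_cases hi : θ.Hits i
  · have := one_le_influence_div (K := K) (g := g) (Or.inl hi)
    linarith
  by_cases hΓ : ∀ k ∈ nbrs i g, ∀ l ∈ nbrs i g, k ≠ l →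
      l ∉ affected (pert (graphMat K (isolate i g)) θ) k
  · have hb := border_pert K g hi
    have n1 := hb.not_frozen_of_subset_completeSet (graphMat_ne_zero hK g i)
      (transpose_ne_zero hK g i) hN hΓ
    have n2 : Sum.inl i ∉ frozen (pert (graphMat K g) θ).transpose := by
      intro hr
      have hf := firmlyFrozen_of_frozen (pert (graphMat K g) θ).transpose hr (by simpa using n1)
      rw [hb.firmlyFrozen_transpose_iff] at hf
      exact hf (elim_mem_of_subset (graphMat_ne_zero hK g i)
        (hN.trans ((completeSet_subset _).trans Finset.inter_subset_left)))
    have : ind (Finset.univ \ (colSet K θ g ∪ rowSet K θ g)) i = 1 := by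
      rw [ind, if_pos]
      rw [Finset.mem_sdiff, Finset.mem_union, colSet, rowSet, mem_frozenSet, mem_frozenSet]
      exact ⟨Finset.mem_univ i, not_or.2 ⟨n1, n2⟩⟩
    linarith
  · push Not at hΓ
    obtain ⟨k, hk, l, hl, hkl, h⟩ := hΓ
    have : 1 ≤ pairCount (graphMat K (isolate i g)) θ (star i g) := by
      have a1 := Finset.single_le_sum (f := fun l => if k ∈ star i g then
        (if l ∈ star i g then (1 : ℝ) else 0) else 0)
        (fun l _ => by split_ifs <;> norm_num) (Finset.mem_erase.2 ⟨hkl.symm, h⟩)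
      have a2 := Finset.single_le_sum (f := fun k => ∑ l ∈
        (affected (pert (graphMat K (isolate i g)) θ) k).erase k, if k ∈ star i g then
        (if l ∈ star i g then (1 : ℝ) else 0) else 0)
        (fun k _ => Finset.sum_nonneg fun l _ => by split_ifs <;> norm_num) (Finset.mem_univ k)
      simp only [nbrs_subset_star _ _ hk, nbrs_subset_star _ _ hl, if_true] at a1
      simp only [nbrs_subset_star _ _ hk, if_true] at a2
      have a3 := a1.trans a2
      exact a3
    linarith

variable {d p : ℝ}

/-- Two distinct labels are both joined to `i` with probability `p ^ 2`, and on average there are at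
most `n * (n / √P)` interacting pairs. The erasure of `k` in `pairCount` keeps the two edges
distinct. -/
theorem wE_pairCount_le [NeZero n] [NeZero P] (h0 : 0 ≤ p) (h1 : p ≤ 1)
    (hd : n * p ≤ d) (i : Fin n) (A : Matrix (Fin n) (Fin n) F) :
    wE (unif (Pert n P)) (fun θ => wE (bw (Sym2 (Fin n)) p) fun g =>
      pairCount A θ (star i g)) ≤ d ^ 2 / √P := by
  have hn : (0 : ℝ) < n := by exact_mod_cast Nat.pos_of_ne_zero (NeZero.ne n)
  have hd0 : 0 ≤ d := le_trans (by positivity) hd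
  have e1 : ∀ k l : Fin n, l ≠ k → wE (bw (Sym2 (Fin n)) p) (fun g =>
      if k ∈ star i g then (if l ∈ star i g then (1 : ℝ) else 0) else 0) = p ^ 2 := by
    intro k l hkl
    simp only [mem_star (k := k)]
    rw [wE_bw_ite_of_indep h0 h1 s(i, k) (f := fun g => if l ∈ star i g then (1 : ℝ) else 0)]
    · rw [wE_mem_star h0 h1, mul_one, sq]
    · intro g g' hg
      simp only [mem_star, hg s(i, l) fun h => hkl (pair_injective i h)]
  have e2 : ∀ θ : Pert n P, wE (bw (Sym2 (Fin n)) p) (fun g => pairCount A θ (star i g)) ≤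
      p ^ 2 * ∑ k, ((affected (pert A θ) k).card : ℝ) := by
    intro θ
    simp only [pairCount, wE_sum]
    rw [Finset.mul_sum]
    refine Finset.sum_le_sum fun k _ => ?_
    rw [Finset.sum_congr rfl fun l hl => e1 k l (Finset.ne_of_mem_erase hl), Finset.sum_const,
      nsmul_eq_mul, mul_comm]
    refine mul_le_mul_of_nonneg_left ?_ (by positivity)
    exact Nat.cast_le.2 (Finset.card_le_card (Finset.erase_subset _ _))
  refine (isProb_unif.mono e2).trans ?_
  rw [wE_mul_left, wE_sum]
  have e3 : ∑ k, wE (unif (Pert n P)) (fun θ => ((affected (pert A θ) k).card : ℝ)) ≤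
      ∑ _k : Fin n, (n : ℝ) / √P := Finset.sum_le_sum fun k _ => wE_card_affected_le A k
  rw [Finset.sum_const, Finset.card_univ, Fintype.card_fin, nsmul_eq_mul] at e3
  refine (mul_le_mul_of_nonneg_left e3 (by positivity)).trans ?_
  have hnp : 0 ≤ n * p := by positivity
  calc _ = (n * p) ^ 2 / √P := by ring
    _ ≤ _ := by gcongr

theorem wE_avg_influence_le [NeZero n] [NeZero P] (K : Fin n → Fin n → F) (h0 : 0 ≤ p) (h1 : p ≤ 1)
    (hd : n * p ≤ d) :
    wE (unif (Pert n P)) (fun θ => wE (bw (Sym2 (Fin n)) p) fun g =>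
      (∑ i, influence (graphMat K (isolate i g)) θ i (star i g) / n) / n) ≤ rate d n P := by
  have hn : (0 : ℝ) < n := by exact_mod_cast Nat.pos_of_ne_zero (NeZero.ne n)
  have e1 : ∀ i, wE (unif (Pert n P)) (fun θ => wE (bw (Sym2 (Fin n)) p) fun g =>
      influence (graphMat K (isolate i g)) θ i (star i g)) ≤ n * rate d n P := by
    intro i
    have e2 : ∀ θ : Pert n P, _ := fun θ => wE_isolate_star h0 h1 i
      fun g U => influence (graphMat K g) θ i U
    simp only [e2]
    rw [wE_comm]
    exact (isProb_bw h0 h1).le_const fun g => wE_influence_le h0 h1 hd i _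
  simp only [div_eq_inv_mul, wE_mul_left, wE_sum]
  have e3 := Finset.sum_le_sum fun i (_ : i ∈ Finset.univ) =>
    mul_le_mul_of_nonneg_left (e1 i) (inv_nonneg.2 hn.le)
  refine (mul_le_mul_of_nonneg_left e3 (inv_nonneg.2 hn.le)).trans_eq ?_
  rw [Finset.sum_const, Finset.card_univ, Fintype.card_fin, nsmul_eq_mul]
  field_simp

theorem wE_avg_pairCount_le [NeZero n] [NeZero P] (K : Fin n → Fin n → F) (h0 : 0 ≤ p) (h1 : p ≤ 1)
    (hd : n * p ≤ d) :
    wE (unif (Pert n P)) (fun θ => wE (bw (Sym2 (Fin n)) p) fun g =>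
      (∑ i, pairCount (graphMat K (isolate i g)) θ (star i g)) / n) ≤ d ^ 2 / √P := by
  have hn : (0 : ℝ) < n := by exact_mod_cast Nat.pos_of_ne_zero (NeZero.ne n)
  have e1 : ∀ i, wE (unif (Pert n P)) (fun θ => wE (bw (Sym2 (Fin n)) p) fun g =>
      pairCount (graphMat K (isolate i g)) θ (star i g)) ≤ d ^ 2 / √P := by
    intro i
    have e2 : ∀ θ : Pert n P, _ := fun θ => wE_isolate_star h0 h1 i
      fun g U => pairCount (graphMat K g) θ U
    simp only [e2]
    rw [wE_comm]
    exact (isProb_bw h0 h1).le_const fun g => wE_pairCount_le h0 h1 hd i _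
  simp only [div_eq_inv_mul _ (n : ℝ), wE_mul_left, wE_sum]
  have e3 := Finset.sum_le_sum fun i (_ : i ∈ Finset.univ) => e1 i
  refine (mul_le_mul_of_nonneg_left e3 (inv_nonneg.2 hn.le)).trans_eq ?_
  rw [Finset.sum_const, Finset.card_univ, Fintype.card_fin, nsmul_eq_mul]
  field_simp

/-- The total error in the balance equations. -/
noncomputable def totalRate (d : ℝ) (n P : ℕ) : ℝ :=
  3 * concRate d n P + rate d n P + d ^ 2 / √P

theorem avg_sub_eq_div (f g : Fin n → ℝ) :
    (∑ i, f i) / n - (∑ i, g i) / n = (∑ i, (f i - g i)) / n := by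
  rw [Finset.sum_sub_distrib, sub_div]

theorem abs_avg_le {f e : Fin n → ℝ} (h : ∀ i, |f i| ≤ e i) :
    |(∑ i, f i) / n| ≤ (∑ i, e i) / n := by
  rw [abs_div, Nat.abs_cast]
  gcongr
  exact (Finset.abs_sum_le_sum_abs _ _).trans (Finset.sum_le_sum fun i _ => h i)

theorem stable_colSet (hK : ∀ i j, K i j ≠ 0) : Stable K (colSet (P := P) K) :=
  stable_frozenSet hK

theorem stable_rowSet (hK : ∀ i j, K i j ≠ 0) : Stable K (rowSet (P := P) K) :=
  stable_frozenSet_transpose hK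

theorem stable_bothSet (hK : ∀ i j, K i j ≠ 0) : Stable K (bothSet (P := P) K) :=
  stable_inter hK

theorem stable_fullSet (hK : ∀ i j, K i j ≠ 0) : Stable K (fullSet (P := P) K) :=
  stable_completeSet hK

theorem concRate_nonneg (hd : 0 ≤ d) (n P : ℕ) : 0 ≤ concRate d n P := by
  have := rate_nonneg hd n P
  unfold concRate
  positivity

theorem wE_balance_Y [NeZero n] [NeZero P] (hK : ∀ i j, K i j ≠ 0) (h0 : 0 ≤ p) (h1 : p ≤ 1)
    (hd : n * p ≤ d) :
    wE (unif (Pert n P)) (fun θ => wE (bw (Sym2 (Fin n)) p) fun g =>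
      |((fullSet K θ g).card : ℝ) / n - (1 - phi (n * p) ((rowSet K θ g).card / n) -
        phi (n * p) ((colSet K θ g).card / n) + phi (n * p) ((bothSet K θ g).card / n))|) ≤
      totalRate d n P := by
  have hn : (0 : ℝ) < n := by exact_mod_cast Nat.pos_of_ne_zero (NeZero.ne n)
  have hd0 : 0 ≤ d := le_trans (by positivity) hd
  have e1 : ∀ (θ : Pert n P) g, |((fullSet K θ g).card : ℝ) / n - (1 - phi (n * p) ((rowSet K θ g).card / n) -
        phi (n * p) ((colSet K θ g).card / n) + phi (n * p) ((bothSet K θ g).card / n))| ≤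
      (∑ i, influence (graphMat K (isolate i g)) θ i (star i g) / n) / n +
      |(∑ i, nbrInd (rowSet K) θ i g) / n - phi (n * p) ((rowSet K θ g).card / n)| +
      |(∑ i, nbrInd (colSet K) θ i g) / n - phi (n * p) ((colSet K θ g).card / n)| +
      |(∑ i, nbrInd (bothSet K) θ i g) / n - phi (n * p) ((bothSet K θ g).card / n)| := by
    intro θ g
    have a1 := abs_avg_le fun i => (abs_ind_sub_le hK θ i g).1
    rw [← avg_sub_eq_div, sum_ind, Finset.sum_add_distrib, Finset.sum_sub_distrib,
      Finset.sum_sub_distrib, Finset.sum_const, Finset.card_univ, Fintype.card_fin, nsmul_eq_mul,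
      mul_one, add_div, sub_div, sub_div, div_self hn.ne'] at a1
    set r := (∑ i, nbrInd (rowSet K) θ i g) / n
    set c := (∑ i, nbrInd (colSet K) θ i g) / n
    set b := (∑ i, nbrInd (bothSet K) θ i g) / n
    rw [abs_le] at a1 ⊢
    have b1 := neg_abs_le (r - phi (n * p) ((rowSet K θ g).card / n))
    have b2 := le_abs_self (r - phi (n * p) ((rowSet K θ g).card / n))
    have b3 := neg_abs_le (c - phi (n * p) ((colSet K θ g).card / n))
    have b4 := le_abs_self (c - phi (n * p) ((colSet K θ g).card / n))
    have b5 := neg_abs_le (b - phi (n * p) ((bothSet K θ g).card / n))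
    have b6 := le_abs_self (b - phi (n * p) ((bothSet K θ g).card / n))
    constructor <;> linarith
  refine (isProb_unif.mono fun θ => (isProb_bw h0 h1).mono (e1 θ)).trans ?_
  simp only [wE_add]
  have c1 := wE_avg_influence_le (P := P) K h0 h1 hd
  have c2 := (stable_rowSet (P := P) hK).wE_abs_sub_phi_le h0 h1 hd
  have c3 := (stable_colSet (P := P) hK).wE_abs_sub_phi_le h0 h1 hd
  have c4 := (stable_bothSet (P := P) hK).wE_abs_sub_phi_le h0 h1 hd
  have c5 : 0 ≤ d ^ 2 / √P := by positivity
  rw [totalRate]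
  linarith

theorem wE_balance_U [NeZero n] [NeZero P] (hK : ∀ i j, K i j ≠ 0) (h0 : 0 ≤ p) (h1 : p ≤ 1)
    (hd : n * p ≤ d) :
    wE (unif (Pert n P)) (fun θ => wE (bw (Sym2 (Fin n)) p) fun g =>
      |((rowSet K θ g \ colSet K θ g).card : ℝ) / n - (phi (n * p) ((rowSet K θ g).card / n) -
        phi (n * p) ((bothSet K θ g).card / n))|) ≤ totalRate d n P := by
  have hd0 : 0 ≤ d := le_trans (by positivity) hd
  have e1 : ∀ (θ : Pert n P) g, |((rowSet K θ g \ colSet K θ g).card : ℝ) / n -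
        (phi (n * p) ((rowSet K θ g).card / n) - phi (n * p) ((bothSet K θ g).card / n))| ≤
      (∑ i, influence (graphMat K (isolate i g)) θ i (star i g) / n) / n +
      |(∑ i, nbrInd (rowSet K) θ i g) / n - phi (n * p) ((rowSet K θ g).card / n)| +
      |(∑ i, nbrInd (bothSet K) θ i g) / n - phi (n * p) ((bothSet K θ g).card / n)| := by
    intro θ g
    have a1 := abs_avg_le fun i => (abs_ind_sub_le hK θ i g).2.1
    rw [← avg_sub_eq_div, sum_ind, Finset.sum_sub_distrib, sub_div] at a1
    set r := (∑ i, nbrInd (rowSet K) θ i g) / n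
    set b := (∑ i, nbrInd (bothSet K) θ i g) / n
    rw [abs_le] at a1 ⊢
    have b1 := neg_abs_le (r - phi (n * p) ((rowSet K θ g).card / n))
    have b2 := le_abs_self (r - phi (n * p) ((rowSet K θ g).card / n))
    have b5 := neg_abs_le (b - phi (n * p) ((bothSet K θ g).card / n))
    have b6 := le_abs_self (b - phi (n * p) ((bothSet K θ g).card / n))
    constructor <;> linarith
  refine (isProb_unif.mono fun θ => (isProb_bw h0 h1).mono (e1 θ)).trans ?_
  simp only [wE_add]
  have c1 := wE_avg_influence_le (P := P) K h0 h1 hd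
  have c2 := (stable_rowSet (P := P) hK).wE_abs_sub_phi_le h0 h1 hd
  have c4 := (stable_bothSet (P := P) hK).wE_abs_sub_phi_le h0 h1 hd
  have c5 : 0 ≤ d ^ 2 / √P := by positivity
  have c6 := concRate_nonneg hd0 n P
  rw [totalRate]
  linarith

theorem wE_balance_V [NeZero n] [NeZero P] (hK : ∀ i j, K i j ≠ 0) (h0 : 0 ≤ p) (h1 : p ≤ 1)
    (hd : n * p ≤ d) :
    wE (unif (Pert n P)) (fun θ => wE (bw (Sym2 (Fin n)) p) fun g =>
      |((colSet K θ g \ rowSet K θ g).card : ℝ) / n - (phi (n * p) ((colSet K θ g).card / n) -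
        phi (n * p) ((bothSet K θ g).card / n))|) ≤ totalRate d n P := by
  have hd0 : 0 ≤ d := le_trans (by positivity) hd
  have e1 : ∀ (θ : Pert n P) g, |((colSet K θ g \ rowSet K θ g).card : ℝ) / n -
        (phi (n * p) ((colSet K θ g).card / n) - phi (n * p) ((bothSet K θ g).card / n))| ≤
      (∑ i, influence (graphMat K (isolate i g)) θ i (star i g) / n) / n +
      |(∑ i, nbrInd (colSet K) θ i g) / n - phi (n * p) ((colSet K θ g).card / n)| +
      |(∑ i, nbrInd (bothSet K) θ i g) / n - phi (n * p) ((bothSet K θ g).card / n)| := by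
    intro θ g
    have a1 := abs_avg_le fun i => (abs_ind_sub_le hK θ i g).2.2
    rw [← avg_sub_eq_div, sum_ind, Finset.sum_sub_distrib, sub_div] at a1
    set r := (∑ i, nbrInd (colSet K) θ i g) / n
    set b := (∑ i, nbrInd (bothSet K) θ i g) / n
    rw [abs_le] at a1 ⊢
    have b1 := neg_abs_le (r - phi (n * p) ((colSet K θ g).card / n))
    have b2 := le_abs_self (r - phi (n * p) ((colSet K θ g).card / n))
    have b5 := neg_abs_le (b - phi (n * p) ((bothSet K θ g).card / n))
    have b6 := le_abs_self (b - phi (n * p) ((bothSet K θ g).card / n))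
    constructor <;> linarith
  refine (isProb_unif.mono fun θ => (isProb_bw h0 h1).mono (e1 θ)).trans ?_
  simp only [wE_add]
  have c1 := wE_avg_influence_le (P := P) K h0 h1 hd
  have c2 := (stable_colSet (P := P) hK).wE_abs_sub_phi_le h0 h1 hd
  have c4 := (stable_bothSet (P := P) hK).wE_abs_sub_phi_le h0 h1 hd
  have c5 : 0 ≤ d ^ 2 / √P := by positivity
  have c6 := concRate_nonneg hd0 n P
  rw [totalRate]
  linarith

/-- Averaging the one-sided bound `nbrInd_le` over the vertices controls only the negative part; the
interacting pairs produce the term `d ^ 2 / √P` of `totalRate`. -/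
theorem wE_balance_Z [NeZero n] [NeZero P] (hK : ∀ i j, K i j ≠ 0) (h0 : 0 ≤ p) (h1 : p ≤ 1)
    (hd : n * p ≤ d) :
    wE (unif (Pert n P)) (fun θ => wE (bw (Sym2 (Fin n)) p) fun g =>
      |max 0 (-(((Finset.univ \ (colSet K θ g ∪ rowSet K θ g)).card : ℝ) / n -
        phi (n * p) ((fullSet K θ g).card / n)))|) ≤ totalRate d n P := by
  have hd0 : 0 ≤ d := le_trans (by positivity) hd
  have e1 : ∀ (θ : Pert n P) g, |max 0 (-(((Finset.univ \ (colSet K θ g ∪ rowSet K θ g)).card : ℝ) / n -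
        phi (n * p) ((fullSet K θ g).card / n)))| ≤
      (∑ i, influence (graphMat K (isolate i g)) θ i (star i g) / n) / n +
      (∑ i, pairCount (graphMat K (isolate i g)) θ (star i g)) / n +
      |(∑ i, nbrInd (fullSet K) θ i g) / n - phi (n * p) ((fullSet K θ g).card / n)| := by
    intro θ g
    have a1 : (∑ i, nbrInd (fullSet K) θ i g) / n ≤ (∑ i,
        (ind (Finset.univ \ (colSet K θ g ∪ rowSet K θ g)) i +
          influence (graphMat K (isolate i g)) θ i (star i g) / n +
          pairCount (graphMat K (isolate i g)) θ (star i g))) / n :=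
      div_le_div_of_nonneg_right (Finset.sum_le_sum fun i _ => nbrInd_le hK θ i g)
        (Nat.cast_nonneg n)
    rw [Finset.sum_add_distrib, Finset.sum_add_distrib, sum_ind, add_div, add_div] at a1
    set r := (∑ i, nbrInd (fullSet K) θ i g) / n
    have b1 := neg_abs_le (r - phi (n * p) ((fullSet K θ g).card / n))
    have b2 : 0 ≤ (∑ i, influence (graphMat K (isolate i g)) θ i (star i g) / n) / n :=
      div_nonneg (Finset.sum_nonneg fun i _ => div_nonneg (influence_nonneg _ _ _ _)
        (Nat.cast_nonneg n)) (Nat.cast_nonneg n)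
    have b3 : 0 ≤ (∑ i, pairCount (graphMat K (isolate i g)) θ (star i g)) / n :=
      div_nonneg (Finset.sum_nonneg fun i _ => pairCount_nonneg _ _ _) (Nat.cast_nonneg n)
    have b4 := abs_nonneg (r - phi (n * p) ((fullSet K θ g).card / n))
    rw [abs_of_nonneg (le_max_left _ _)]
    refine max_le (by linarith) (by linarith)
  refine (isProb_unif.mono fun θ => (isProb_bw h0 h1).mono (e1 θ)).trans ?_
  simp only [wE_add]
  have c1 := wE_avg_influence_le (P := P) K h0 h1 hd
  have c2 := (stable_fullSet (P := P) hK).wE_abs_sub_phi_le h0 h1 hd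
  have c4 := wE_avg_pairCount_le (P := P) K h0 h1 hd
  have c6 := concRate_nonneg hd0 n P
  rw [totalRate]
  linarith

end TypeCounts

/-! ### Reduction of the joint law to finite expectations, and the iterated limit. -/

section Reduction

variable {F : Type*} [Field F] {n P N : ℕ}

instance (N : ℕ) : DiscreteMeasurableSpace (Equiv.Perm (Fin N)) := ⟨fun _ => trivial⟩

/-- The coordinate of the array `q` that decides about the presence of an edge. -/
def edgeCoord (h : n ≤ N) (τ : Equiv.Perm (Fin N)) (z : Sym2 (Fin n)) : Fin N × Fin N :=
  (τ (Fin.castLE h z.inf), τ (Fin.castLE h z.sup))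

/-- The edge indicators at an outcome of the uniform variables. -/
noncomputable def edges (h : n ≤ N) (p : ℝ) (τ : Equiv.Perm (Fin N))
    (q : Fin N × Fin N → unitInterval) : Sym2 (Fin n) → Bool :=
  fun z => decide ((q (edgeCoord h τ z) : ℝ) < p)

/-- The edge weights for a given permutation. -/
def weights (h : n ≤ N) (J : Template F N) (τ : Equiv.Perm (Fin N)) (i j : Fin n) : F :=
  if i < j then J.1 (τ (Fin.castLE h i)) (τ (Fin.castLE h j))
  else J.1 (τ (Fin.castLE h j)) (τ (Fin.castLE h i))

theorem weights_ne_zero (h : n ≤ N) (J : Template F N) (τ : Equiv.Perm (Fin N)) (i j : Fin n) :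
    weights h J τ i j ≠ 0 := by
  unfold weights
  split_ifs <;> exact J.2.2 _ _

/-- For a fixed permutation distinct unordered pairs read distinct coordinates of `q`, so the edge
indicators are independent. Diagonal pairs receive an indicator too, which `graphMat` ignores. -/
theorem edgeCoord_injective (h : n ≤ N) (τ : Equiv.Perm (Fin N)) :
    Function.Injective (edgeCoord h τ) := by
  intro z z' hz
  rw [edgeCoord, edgeCoord, Prod.mk.injEq, τ.injective.eq_iff, τ.injective.eq_iff,
    (Fin.castLE_injective h).eq_iff, (Fin.castLE_injective h).eq_iff] at hz
  exact Sym2.inf_eq_inf_and_sup_eq_sup.1 hz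

theorem matT_eq (h : n ≤ N) (J : Template F N) (p : ℝ) (q : Fin N × Fin N → unitInterval)
    (τ : Equiv.Perm (Fin N)) : matT h J p q τ = graphMat (weights h J τ) (edges h p τ q) := by
  ext i j
  simp only [matT, graphMat, Matrix.of_apply, edges, edgeCoord, weights, Sym2.inf_mk, Sym2.sup_mk]
  rcases lt_trichotomy i j with hij | rfl | hij
  · simp [hij, hij.ne, hij.le]
  · simp
  · simp [hij, hij.ne', hij.le, not_lt_of_gt hij]

theorem pertT_eq (h : n ≤ N) (J : Template F N) (p : ℝ) (q : Fin N × Fin N → unitInterval)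
    (τ : Equiv.Perm (Fin N)) (θ : Pert n P) :
    pertT h J p (q, τ, θ) = pert (graphMat (weights h J τ) (edges h p τ q)) θ := by
  rw [← matT_eq]
  rfl

theorem proportion_eq (W : VarType) (h : n ≤ N) (J : Template F N) (t : ℝ)
    (q : Fin N × Fin N → unitInterval) (τ : Equiv.Perm (Fin N)) (θ : Pert n P) :
    proportion W h J t (q, τ, θ) =
      typeProp W (pert (graphMat (weights h J τ) (edges h (t / n) τ q)) θ) := by
  rw [proportion, pertT_eq]
  rfl

theorem measurable_edges (h : n ≤ N) (p : ℝ) (τ : Equiv.Perm (Fin N)) :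
    Measurable (edges h p τ) := by
  refine measurable_pi_lambda _ fun z => ?_
  have : Measurable fun x : unitInterval => decide ((x : ℝ) < p) :=
    measurable_to_bool (by
      have : (fun x : unitInterval => decide ((x : ℝ) < p)) ⁻¹' {true} =
          {x : unitInterval | (x : ℝ) < p} := by ext; simp
      rw [this]
      exact measurableSet_lt measurable_subtype_coe measurable_const)
  exact this.comp (measurable_pi_apply _)

theorem volume_lt {p : ℝ} (h0 : 0 ≤ p) (h1 : p ≤ 1) :
    volume {x : unitInterval | (x : ℝ) < p} = ENNReal.ofReal p :=
  unitInterval.volume_Iio ⟨p, h0, h1⟩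

theorem volume_not_lt {p : ℝ} (h0 : 0 ≤ p) (h1 : p ≤ 1) :
    volume {x : unitInterval | ¬ (x : ℝ) < p} = ENNReal.ofReal (1 - p) := by
  have : {x : unitInterval | ¬ (x : ℝ) < p} = Set.Ici ⟨p, h0, h1⟩ := by
    ext x
    simp [← Subtype.coe_le_coe]
  rw [this, unitInterval.volume_Ici]

/-- The preimage of a graph is a box: a coordinate of `q` is constrained by the one pair that reads
it, or not at all. -/
theorem map_edges_singleton (h : n ≤ N) {p : ℝ} (h0 : 0 ≤ p) (h1 : p ≤ 1)
    (τ : Equiv.Perm (Fin N)) (g : Sym2 (Fin n) → Bool) :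
    (Measure.pi fun _ : Fin N × Fin N => (volume : Measure unitInterval)).map (edges h p τ) {g} =
      ENNReal.ofReal (bw (Sym2 (Fin n)) p g) := by
  rw [Measure.map_apply (measurable_edges h p τ) (measurableSet_singleton g)]
  have hpre : edges h p τ ⁻¹' {g} = Set.pi Set.univ fun e : Fin N × Fin N =>
      {x : unitInterval | ∀ z, edgeCoord h τ z = e → decide ((x : ℝ) < p) = g z} := by
    ext q
    simp only [Set.mem_preimage, Set.mem_singleton_iff, Set.mem_pi, Set.mem_univ, true_imp_iff,
      Set.mem_ofPred_eq, funext_iff, edges]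
    constructor
    · rintro hq e z rfl
      exact hq z
    · intro hq z
      exact hq _ z rfl
  rw [hpre, Measure.pi_pi, bw, ENNReal.ofReal_prod_of_nonneg
    (fun e _ => by split_ifs <;> linarith)]
  rw [← Finset.prod_subset (Finset.subset_univ (Finset.univ.image (edgeCoord h τ))),
    Finset.prod_image fun _ _ _ _ hz => edgeCoord_injective h τ hz]
  · refine Finset.prod_congr rfl fun z _ => ?_
    have hz : {x : unitInterval | ∀ z', edgeCoord h τ z' = edgeCoord h τ z →
        decide ((x : ℝ) < p) = g z'} = {x : unitInterval | decide ((x : ℝ) < p) = g z} := by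
      ext x
      simp only [(edgeCoord_injective h τ).eq_iff, forall_eq, Set.mem_ofPred_eq]
    rw [hz]
    cases g z
    · simpa using volume_not_lt h0 h1
    · simpa using volume_lt h0 h1
  · intro e _ he
    have : {x : unitInterval | ∀ z, edgeCoord h τ z = e → decide ((x : ℝ) < p) = g z} =
        Set.univ := by
      ext x
      simp only [Set.mem_ofPred_eq, Set.mem_univ, iff_true]
      intro z hz
      exact absurd (Finset.mem_image.2 ⟨z, Finset.mem_univ z, hz⟩) he
    rw [this, measure_univ]

theorem lintegral_edges (h : n ≤ N) {p : ℝ} (h0 : 0 ≤ p) (h1 : p ≤ 1) (τ : Equiv.Perm (Fin N))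
    {G : (Sym2 (Fin n) → Bool) → ℝ} (hG : ∀ g, 0 ≤ G g) :
    ∫⁻ q, ENNReal.ofReal (G (edges h p τ q))
      ∂(Measure.pi fun _ : Fin N × Fin N => (volume : Measure unitInterval)) =
      ENNReal.ofReal (wE (bw (Sym2 (Fin n)) p) G) := by
  rw [← lintegral_map (f := fun g => ENNReal.ofReal (G g)) (Measurable.of_discrete)
    (measurable_edges h p τ), lintegral_fintype, wE, ENNReal.ofReal_sum_of_nonneg
    fun g _ => mul_nonneg ((isProb_bw h0 h1).nonneg g) (hG g)]
  refine Finset.sum_congr rfl fun g _ => ?_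
  rw [map_edges_singleton h h0 h1, mul_comm, ENNReal.ofReal_mul ((isProb_bw h0 h1).nonneg g)]

theorem uniformOn_univ_singleton {α : Type*} [Fintype α] [MeasurableSpace α]
    [MeasurableSingletonClass α] (x : α) :
    ProbabilityTheory.uniformOn Set.univ {x} = ENNReal.ofReal (unif α x) := by
  have : Nonempty α := ⟨x⟩
  rw [ProbabilityTheory.uniformOn_univ, Measure.count_singleton, unif,
    ENNReal.ofReal_inv_of_pos (by positivity), ENNReal.ofReal_natCast, one_div]

theorem unif_mul_unif (α β : Type*) [Fintype α] [Fintype β] (x : α) (y : β) :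
    unif α x * unif β y = unif (α × β) (x, y) := by
  simp [unif, mul_comm]

theorem unif_nonneg {α : Type*} [Fintype α] (x : α) : 0 ≤ unif α x := by
  unfold unif
  positivity

/-- The expectation with respect to the joint law, for a fixed permutation. -/
theorem lintegral_law_le [NeZero n] [NeZero P] (h : n ≤ N) {p : ℝ} (h0 : 0 ≤ p) (h1 : p ≤ 1)
    {G : Equiv.Perm (Fin N) → Pert n P → (Sym2 (Fin n) → Bool) → ℝ} (hG : ∀ τ θ g, 0 ≤ G τ θ g)
    {c : ℝ} (hc : ∀ τ, wE (unif (Pert n P)) (fun θ => wE (bw (Sym2 (Fin n)) p) (G τ θ)) ≤ c)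
    {f : Sample n P N → ENNReal}
    (hf : ∀ q τ θ, f (q, τ, θ) = ENNReal.ofReal (G τ θ (edges h p τ q))) :
    ∫⁻ ω, f ω ∂(law n P N) ≤ ENNReal.ofReal c := by
  have : IsProbabilityMeasure
      (ProbabilityTheory.uniformOn (Set.univ : Set (Equiv.Perm (Fin N)))) :=
    ProbabilityTheory.isProbabilityMeasure_uniformOn Set.finite_univ Set.univ_nonempty
  have : IsProbabilityMeasure (ProbabilityTheory.uniformOn (Set.univ : Set (Fin P × Fin P))) :=
    ProbabilityTheory.isProbabilityMeasure_uniformOn Set.finite_univ Set.univ_nonempty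
  have : IsProbabilityMeasure (ProbabilityTheory.uniformOn (Set.univ : Set (Fin P → Fin n))) :=
    ProbabilityTheory.isProbabilityMeasure_uniformOn Set.finite_univ Set.univ_nonempty
  -- All components except `q` are discrete, and for fixed values of them `f` factors through the
  -- finitely many graphs.
  have hmeas : Measurable f := by
    refine measurable_from_prod_countable_left fun r => ?_
    obtain ⟨τ, θ⟩ := r
    simp only [hf]
    exact (Measurable.of_discrete (f := fun g => ENNReal.ofReal (G τ θ g))).comp
      (measurable_edges h p τ)
  rw [law, lintegral_prod_symm' _ hmeas, lintegral_prod _ (Measurable.of_discrete).aemeasurable]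
  have key : ∀ τ : Equiv.Perm (Fin N), ∫⁻ θ : Pert n P, ∫⁻ q, f (q, τ, θ)
      ∂(Measure.pi fun _ => (volume : Measure unitInterval))
      ∂((ProbabilityTheory.uniformOn Set.univ).prod
        ((ProbabilityTheory.uniformOn Set.univ).prod (ProbabilityTheory.uniformOn Set.univ))) ≤
      ENNReal.ofReal c := by
    intro τ
    simp only [hf, lintegral_edges h h0 h1 τ (hG τ _)]
    rw [lintegral_fintype]
    refine le_trans (le_of_eq ?_) (ENNReal.ofReal_le_ofReal (hc τ))
    have hw : ∀ θ, 0 ≤ wE (bw (Sym2 (Fin n)) p) (G τ θ) := fun θ =>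
      (isProb_bw h0 h1).wE_nonneg (hG τ θ)
    rw [wE, ENNReal.ofReal_sum_of_nonneg fun θ _ => mul_nonneg (unif_nonneg θ) (hw θ)]
    refine Finset.sum_congr rfl fun θ _ => ?_
    obtain ⟨ab, rp, cp⟩ := θ
    have e : ({(ab, rp, cp)} : Set (Pert n P)) = {ab} ×ˢ ({rp} ×ˢ {cp}) := by simp
    rw [e, Measure.prod_prod, Measure.prod_prod, uniformOn_univ_singleton, uniformOn_univ_singleton,
      uniformOn_univ_singleton, ← ENNReal.ofReal_mul (unif_nonneg _),
      ← ENNReal.ofReal_mul (unif_nonneg _), unif_mul_unif, unif_mul_unif,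
      ENNReal.ofReal_mul (unif_nonneg _), mul_comm]
  -- The bound is the same for every permutation, so the average over permutations is harmless.
  refine (lintegral_mono key).trans ?_
  rw [lintegral_const, measure_univ, mul_one]

theorem tendsto_rate (d : ℝ) (P : ℕ) : Filter.Tendsto (fun n => rate d n P) Filter.atTop
    (nhds (2 * ((1 + d) * d * Real.exp d / P + 2 * d / √P))) := by
  unfold rate
  have := (tendsto_const_div_atTop_nhds_zero_nat (1 + 2 * (P : ℝ))).add_const
    (2 * ((1 + d) * d * Real.exp d / P + 2 * d / √P))
  simpa using this

theorem tendsto_totalRate (d : ℝ) (P : ℕ) : Filter.Tendsto (fun n => totalRate d n P) Filter.atTop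
    (nhds (3 * (√(2 * d * (2 * ((1 + d) * d * Real.exp d / P + 2 * d / √P))) +
      d * (2 * ((1 + d) * d * Real.exp d / P + 2 * d / √P))) +
      2 * ((1 + d) * d * Real.exp d / P + 2 * d / √P) + d ^ 2 / √P)) := by
  unfold totalRate concRate
  have h1 := tendsto_rate d P
  have h2 := ((tendsto_const_div_atTop_nhds_zero_nat (1 + d)).add (h1.const_mul (2 * d))).sqrt
  have h3 := (tendsto_const_div_atTop_nhds_zero_nat (d + d ^ 2)).add (h1.const_mul d)
  have h4 := (((h2.add h3).const_mul 3).add h1).add_const (d ^ 2 / √P)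
  simpa only [zero_add] using h4

theorem tendsto_totalRate_limit (d : ℝ) : Filter.Tendsto (fun P : ℕ =>
    3 * (√(2 * d * (2 * ((1 + d) * d * Real.exp d / P + 2 * d / √P))) +
      d * (2 * ((1 + d) * d * Real.exp d / P + 2 * d / √P))) +
      2 * ((1 + d) * d * Real.exp d / P + 2 * d / √P) + d ^ 2 / √P) Filter.atTop (nhds 0) := by
  have hs : Filter.Tendsto (fun P : ℕ => √(P : ℝ)) Filter.atTop Filter.atTop :=
    Real.tendsto_sqrt_atTop.comp tendsto_natCast_atTop_atTop
  have h1 := tendsto_const_div_atTop_nhds_zero_nat ((1 + d) * d * Real.exp d)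
  have h2 : Filter.Tendsto (fun P : ℕ => 2 * d / √P) Filter.atTop (nhds 0) :=
    hs.const_div_atTop _
  have h3 : Filter.Tendsto (fun P : ℕ => d ^ 2 / √P) Filter.atTop (nhds 0) :=
    hs.const_div_atTop _
  have h4 := (h1.add h2).const_mul 2
  have h5 := (h4.const_mul (2 * d)).sqrt
  have h6 := (((h5.add (h4.const_mul d)).const_mul 3).add h4).add h3
  simpa using h6

/-- A uniform bound for the expectations that tends to zero. -/
theorem isLittleOneP_of_le {d : ℝ} {b : Family F}
    (h : ∀ {n P N : ℕ} [NeZero n] [NeZero P] (hn : n ≤ N) (J : Template F N) (t : ℝ), 0 ≤ t →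
      t ≤ d → d ≤ n →
      ∫⁻ ω, ENNReal.ofReal |b hn J t ω| ∂(law n P N) ≤ ENNReal.ofReal (totalRate d n P)) :
    IsLittleOneP d b := by
  have h1 : ∀ P : ℕ, P ≠ 0 → Filter.limsup (fun n : ℕ =>
      ⨆ (N : ℕ) (h : n ≤ N) (J : Template F N) (t : Set.Icc (0 : ℝ) d),
        ∫⁻ ω, ENNReal.ofReal |b h J (t : ℝ) ω| ∂(law n P N)) Filter.atTop ≤
      ENNReal.ofReal (3 * (√(2 * d * (2 * ((1 + d) * d * Real.exp d / P + 2 * d / √P))) +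
      d * (2 * ((1 + d) * d * Real.exp d / P + 2 * d / √P))) +
      2 * ((1 + d) * d * Real.exp d / P + 2 * d / √P) + d ^ 2 / √P) := by
    intro P hP
    have : NeZero P := ⟨hP⟩
    rw [← (ENNReal.tendsto_ofReal (tendsto_totalRate d P)).limsup_eq]
    refine Filter.limsup_le_limsup ?_
    -- From `d ≤ n` on, `t / n` is a probability for all `t ≤ d`.
    filter_upwards [Filter.eventually_ge_atTop ⌈d⌉₊, Filter.eventually_ge_atTop 1] with n hn hn1
    have : NeZero n := ⟨by omega⟩
    exact iSup_le fun N => iSup_le fun hN => iSup_le fun J => iSup_le fun t =>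
      h hN J t t.2.1 t.2.2 (Nat.ceil_le.1 hn)
  have h2 := (ENNReal.tendsto_ofReal (tendsto_totalRate_limit d)).limsup_eq
  rw [ENNReal.ofReal_zero] at h2
  refine le_antisymm ?_ zero_le
  rw [← h2]
  refine Filter.limsup_le_limsup ?_
  filter_upwards [Filter.eventually_ne_atTop 0] with P hP using h1 P hP

end Reduction

end SymRank

theorem mainTheorem6 {F : Type*} [Field F] (d : ℝ) (hd : 0 < d) :
    SymRank.IsLittleOneP (F := F) d (fun h J t ω =>
      let x := SymRank.proportion .X h J t ω
      let y := SymRank.proportion .Y h J t ω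
      let u := SymRank.proportion .U h J t ω
      let v := SymRank.proportion .V h J t ω
      y - (1 - SymRank.phi t (x + y + u) - SymRank.phi t (x + y + v) + SymRank.phi t (x + y))) ∧
    SymRank.IsLittleOneP (F := F) d (fun h J t ω =>
      let x := SymRank.proportion .X h J t ω
      let y := SymRank.proportion .Y h J t ω
      let u := SymRank.proportion .U h J t ω
      u - (SymRank.phi t (x + y + u) - SymRank.phi t (x + y))) ∧
    SymRank.IsLittleOneP (F := F) d (fun h J t ω =>
      let x := SymRank.proportion .X h J t ω
      let y := SymRank.proportion .Y h J t ω
      let v := SymRank.proportion .V h J t ω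
      v - (SymRank.phi t (x + y + v) - SymRank.phi t (x + y))) ∧
    SymRank.GeLittleOneP (F := F) d (fun h J t ω =>
      SymRank.proportion .Z h J t ω - SymRank.phi t (SymRank.proportion .Y h J t ω)) := by
  open SymRank in
  have hp : ∀ {n : ℕ} [NeZero n] {t : ℝ}, 0 ≤ t → t ≤ d → d ≤ n →
      0 ≤ t / n ∧ t / n ≤ 1 ∧ n * (t / n) = t := by
    intro n _ t h0 h1 hn
    have : (0 : ℝ) < n := by exact_mod_cast Nat.pos_of_ne_zero (NeZero.ne n)
    exact ⟨by positivity, (div_le_one this).2 (h1.trans hn), mul_div_cancel₀ t this.ne'⟩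
  refine ⟨isLittleOneP_of_le ?_, isLittleOneP_of_le ?_, isLittleOneP_of_le ?_,
    isLittleOneP_of_le ?_⟩
  · intro n P N _ _ hN J t h0 h1 hn
    obtain ⟨p0, p1, hpt⟩ := hp h0 h1 hn
    refine lintegral_law_le hN p0 p1 (fun τ θ g => abs_nonneg _) (fun τ => wE_balance_Y
      (weights_ne_zero hN J τ) p0 p1 (hpt.trans_le h1)) fun q τ θ => ?_
    -- The triple sums are rewritten before `x + y`, which is a subterm of them.
    simp only [proportion_eq, typeProp_XYU, typeProp_XYV, hpt]
    simp only [typeProp_XY]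
    simp only [typeProp_eq (hasType_Y_iff _)]
    rfl
  · intro n P N _ _ hN J t h0 h1 hn
    obtain ⟨p0, p1, hpt⟩ := hp h0 h1 hn
    refine lintegral_law_le hN p0 p1 (fun τ θ g => abs_nonneg _) (fun τ => wE_balance_U
      (weights_ne_zero hN J τ) p0 p1 (hpt.trans_le h1)) fun q τ θ => ?_
    simp only [proportion_eq, typeProp_XYU, hpt]
    simp only [typeProp_XY]
    simp only [typeProp_eq (hasType_U_iff _)]
    rfl
  · intro n P N _ _ hN J t h0 h1 hn
    obtain ⟨p0, p1, hpt⟩ := hp h0 h1 hn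
    refine lintegral_law_le hN p0 p1 (fun τ θ g => abs_nonneg _) (fun τ => wE_balance_V
      (weights_ne_zero hN J τ) p0 p1 (hpt.trans_le h1)) fun q τ θ => ?_
    simp only [proportion_eq, typeProp_XYV, hpt]
    simp only [typeProp_XY]
    simp only [typeProp_eq (hasType_V_iff _)]
    rfl
  · intro n P N _ _ hN J t h0 h1 hn
    obtain ⟨p0, p1, hpt⟩ := hp h0 h1 hn
    refine lintegral_law_le hN p0 p1 (fun τ θ g => abs_nonneg _) (fun τ => wE_balance_Z
      (weights_ne_zero hN J τ) p0 p1 (hpt.trans_le h1)) fun q τ θ => ?_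
    simp only [proportion_eq, hpt, typeProp_eq (hasType_Z_iff _), typeProp_eq (hasType_Y_iff _)]
    rfl
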